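/- **Setting.** Let $M$ be a smooth surface with a smooth Lorentzian metric $\boldsymbol g$ of signature $(1,1)$; a vector $w$ is timelike if $\boldsymbol g(w,w)>0$. For a local orthonormal coframing, $\boldsymbol g=(\eta^1)^2-(\eta^2)^2$, the connection form $\eta^1_2$ and the Gauss curvature $K$ are determined by $$d\eta^1=-\eta^1_2\wedge\eta^2,\qquad d\eta^2=-\eta^1_2\wedge\eta^1,\qquad d\eta^1_2=-K\,\eta^1\wedge\eta^2 .$$ Let $\mathbb R^{1,2}$ carry $\langle v,w\rangle=v_1w_1-v_2w_2-v_3w_3$, let $\mathcal F$ be its bundle of $SO(1,2)$-frames $(\rho;e_1,e_2,e_3)$, with forms defined by $d\rho=e_i\,\omega^i$, $de_j=e_i\,\omega^i_j$. The isometric embedding system of $\boldsymbol g$ into $\mathbb R^{1,2}$ is the exterior differential system $\mathcal I$ generated by $$\theta_0=\omega^3,\quad \theta_1=\omega^1-\eta^1,\quad \theta_2=\omega^2-\eta^2,\quad \theta_3=\omega^1_2-\eta^1_2$$ and their exterior derivatives, on the product of (the domain in $M$ of) a local orthonormal coframing with $\mathcal F$. It is called hyperbolic if $K<0$. Such a system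 is Darboux integrable if, about each point, there is a coframe $\theta^1,\dots,\theta^r,\hat\sigma^1,\dots,\hat\sigma^p,\check\sigma^1,\dots,\check\sigma^q$ with $p,q\ge2$ for which $\mathcal I$ is generated algebraically by the $\theta^i$, by $s\ge1$ two-forms $\hat\Omega^b\in\Omega^2(\hat\sigma)$ and by $t\ge1$ two-forms $\check\Omega^\beta\in\Omega^2(\check\sigma)$; the singular systems $\{\theta^i,\hat\sigma^a,\check\Omega^\beta\}$ and $\{\theta^i,\check\sigma^\alpha,\hat\Omega^b\}$ are Pfaffian (differentially generated by their 1-forms); and their degree one parts $\hat V=\langle\theta,\hat\sigma\rangle$, $\check V=\langle\theta,\check\sigma\rangle$ form a Darboux pair: with $V^\infty$ the final element of the derived flag of $V$, one has $\hat V+\check V^\infty=\hat V^\infty+\check V=T^*$, $\hat V^\infty\cap\check V^\infty=0$, and $d\omega\in\Omega^2(\hat V)+\Omega^2(\check V)$ for every section $\omega$ of $\hat V\cap\check V$. **Theorem.** Suppose that $K<0$ on $M$, that the isometric embedding system of $\boldsymbol g$ into $\mathbb R^{1,2}$ is Darboux integrable, and that $\boldsymbol g$ admits a smooth Killing field that is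 timelike at every point of $M$. Then about every point of $M$ there are smooth local coordinates $(u,v)$, with $u>0$ on the coordinate domain, in which one of the following holds: 1. $\boldsymbol g=c\,\big(\sinh^2u\,dv^2-\cosh^4u\,du^2\big)$ for some constant $c>0$, with $K=-c^{-1}\operatorname{sech}^4u$; 2. $\boldsymbol g=c\,\big(\cosh^2u\,dv^2-\sinh^4u\,du^2\big)$ for some constant $c>0$, with $K=-c^{-1}\operatorname{csch}^4u$; 3. $\boldsymbol g=u^2\,(dv^2-du^2)$, with $K=-u^{-4}$. -/

import Mathlib

open scoped Manifold ContDiff Topology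

noncomputable section

namespace DarbouxEmbedding

/-! ### Differential forms of degree one and two on open subsets of a normed space -/

section Forms

variable {E : Type*} [NormedAddCommGroup E] [NormedSpace ℝ E]

/-- A differential 1-form on (an open subset of) `E`. -/
abbrev OneForm (E : Type*) [NormedAddCommGroup E] [NormedSpace ℝ E] : Type _ := E → E →L[ℝ] ℝ

/-- A differential 2-form on (an open subset of) `E`, given by its values on pairs of vectors. -/
abbrev TwoForm (E : Type*) [NormedAddCommGroup E] [NormedSpace ℝ E] : Type _ := E → E → E → ℝ

/-- The wedge product `α ∧ β` of two 1-forms. -/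
def wedge (α β : OneForm E) : TwoForm E := fun x v w => α x v * β x w - α x w * β x v

/-- The exterior derivative `dγ` of a 1-form. -/
def extD (γ : OneForm E) : TwoForm E := fun x v w => fderiv ℝ γ x v w - fderiv ℝ γ x w v

/-- `extD` is Mathlib's exterior derivative in degree one. -/
theorem extD_eq_extDeriv (γ : OneForm E) (x v w : E) (h : DifferentiableAt ℝ γ x) :
    extD γ x v w =
      extDeriv (fun y => ContinuousAlternatingMap.ofSubsingleton ℝ E ℝ (0 : Fin 1) (γ y)) x
        ![v, w] := by
  have h' : DifferentiableAt ℝ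
      (fun y => ContinuousAlternatingMap.ofSubsingleton ℝ E ℝ (0 : Fin 1) (γ y)) x :=
    (ContinuousAlternatingMap.ofSubsingletonLIE (𝕜 := ℝ) (E := E) (F := ℝ)
      (0 : Fin 1)).toContinuousLinearEquiv.differentiableAt.comp x h
  have key : ∀ (a : E) (u : Fin 1 → E), fderiv ℝ
      (fun y => ContinuousAlternatingMap.ofSubsingleton ℝ E ℝ (0 : Fin 1) (γ y) u) x a
        = fderiv ℝ γ x a (u 0) := by
    intro a u
    have := (h.hasFDerivAt.clm_apply (hasFDerivAt_const (u 0) x)).fderiv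
    simpa using congrArg (fun L => L a) this
  rw [extDeriv_apply h']
  simp only [key]
  simp [extD, Fin.sum_univ_succ, Fin.removeNth, sub_eq_add_neg]

/-- The sections over `O` of the `C^∞(O)`-module of 1-forms generated by `S`: the degree one part
of the algebraic ideal generated by 1-forms `S` (and forms of higher degree). -/
def idealOne (O : Set E) (S : Set (OneForm E)) : Set (OneForm E) :=
  {α | ∃ (n : ℕ) (f : Fin n → E → ℝ) (σ : Fin n → OneForm E),
    (∀ i, ContDiffOn ℝ ∞ (f i) O ∧ σ i ∈ S) ∧
    ∀ x ∈ O, α x = ∑ i, f i x • σ i x}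

/-- The degree two part, over `O`, of the algebraic ideal generated by the 1-forms in `S` and the
2-forms in `T`: all `∑ αᵢ ∧ σᵢ + ∑ fⱼ Θⱼ` with `αᵢ`, `fⱼ` smooth on `O`, `σᵢ ∈ S`, `Θⱼ ∈ T`. -/
def idealTwo (O : Set E) (S : Set (OneForm E)) (T : Set (TwoForm E)) : Set (TwoForm E) :=
  {Ω | ∃ (m n : ℕ) (α σ : Fin m → OneForm E) (f : Fin n → E → ℝ) (Θ : Fin n → TwoForm E),
    (∀ i, ContDiffOn ℝ ∞ (α i) O ∧ σ i ∈ S) ∧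
    (∀ j, ContDiffOn ℝ ∞ (f j) O ∧ Θ j ∈ T) ∧
    ∀ x ∈ O, ∀ v w, Ω x v w = ∑ i, wedge (α i) (σ i) x v w + ∑ j, f j x * Θ j x v w}

/-- `Ω²(S)`: the 2-forms on `O` that are combinations, with smooth coefficients, of wedge
products of two members of `S`. -/
def wedgeSquare (O : Set E) (S : Set (OneForm E)) : Set (TwoForm E) :=
  {Ω | ∃ (n : ℕ) (f : Fin n → E → ℝ) (σ τ : Fin n → OneForm E),
    (∀ i, ContDiffOn ℝ ∞ (f i) O ∧ σ i ∈ S ∧ τ i ∈ S) ∧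
    ∀ x ∈ O, ∀ v w, Ω x v w = ∑ i, f i x * wedge (σ i) (τ i) x v w}

/-- The smooth sections over `O` of a family of subspaces `V x` of the cotangent spaces. -/
def sections (O : Set E) (V : E → Submodule ℝ (E →L[ℝ] ℝ)) : Set (OneForm E) :=
  {γ | ContDiffOn ℝ ∞ γ O ∧ ∀ x ∈ O, γ x ∈ V x}

/-- The derived flag of the Pfaffian system `V` over `O`, as a sequence of modules of 1-forms:
`V⁽⁰⁾` consists of the sections of `V`, and
`V⁽ᵏ⁺¹⁾ = {γ ∈ V⁽ᵏ⁾ : dγ ≡ 0 mod V⁽ᵏ⁾}`. -/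
def derivedFlag (O : Set E) (V : E → Submodule ℝ (E →L[ℝ] ℝ)) : ℕ → Set (OneForm E)
  | 0 => sections O V
  | k + 1 => {γ | γ ∈ derivedFlag O V k ∧ extD γ ∈ idealTwo O (derivedFlag O V k) ∅}

/-- The fibre at `x` of the final element `V^∞` of the derived flag of `V`. -/
def derivedLimit (O : Set E) (V : E → Submodule ℝ (E →L[ℝ] ℝ)) (x : E) :
    Submodule ℝ (E →L[ℝ] ℝ) :=
  Submodule.span ℝ {α | ∃ γ : OneForm E, (∀ k, γ ∈ derivedFlag O V k) ∧ γ x = α}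

/-- Darboux pairs of Pfaffian systems on `O`. -/
structure IsDarbouxPair (O : Set E) (V₁ V₂ : E → Submodule ℝ (E →L[ℝ] ℝ)) : Prop where
  span_left : ∀ x ∈ O, V₁ x ⊔ derivedLimit O V₂ x = ⊤
  span_right : ∀ x ∈ O, derivedLimit O V₁ x ⊔ V₂ x = ⊤
  disjoint : ∀ x ∈ O, derivedLimit O V₁ x ⊓ derivedLimit O V₂ x = ⊥
  closed : ∀ γ ∈ sections O (fun x => V₁ x ⊓ V₂ x),
    ∃ Ω₁ ∈ wedgeSquare O (sections O V₁), ∃ Ω₂ ∈ wedgeSquare O (sections O V₂),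
      ∀ x ∈ O, ∀ v w, extD γ x v w = Ω₁ x v w + Ω₂ x v w

/-- On the open set `O`, the forms `θ, σ₁, σ₂` are a smooth coframe, and the exterior differential
system generated algebraically by the 1-forms in `S` and the 2-forms in `T` is decomposable of type
`[p, q]` with respect to it: it is generated algebraically by `θ`, by the 2-forms `Ω₁ ⊆ Ω²(σ₁)`
and by the 2-forms `Ω₂ ⊆ Ω²(σ₂)`. -/
structure IsDecomposition (O : Set E) (S : Set (OneForm E)) (T : Set (TwoForm E))
    {r p q s t : ℕ} (θ : Fin r → OneForm E) (σ₁ : Fin p → OneForm E) (σ₂ : Fin q → OneForm E)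
    (Ω₁ : Fin s → TwoForm E) (Ω₂ : Fin t → TwoForm E) : Prop where
  two_le_p : 2 ≤ p
  two_le_q : 2 ≤ q
  one_le_s : 1 ≤ s
  one_le_t : 1 ≤ t
  smooth : (∀ i, ContDiffOn ℝ ∞ (θ i) O) ∧ (∀ i, ContDiffOn ℝ ∞ (σ₁ i) O) ∧
    (∀ i, ContDiffOn ℝ ∞ (σ₂ i) O)
  linearIndependent : ∀ x ∈ O, LinearIndependent ℝ
    (Sum.elim (fun i => θ i x) (Sum.elim (fun i => σ₁ i x) (fun i => σ₂ i x)))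
  span_eq_top : ∀ x ∈ O, Submodule.span ℝ (Set.range
    (Sum.elim (fun i => θ i x) (Sum.elim (fun i => σ₁ i x) (fun i => σ₂ i x)))) = ⊤
  left_mem : ∀ b, Ω₁ b ∈ wedgeSquare O (Set.range σ₁)
  right_mem : ∀ b, Ω₂ b ∈ wedgeSquare O (Set.range σ₂)
  generates_one : idealOne O S = idealOne O (Set.range θ)
  generates_two : idealTwo O S T = idealTwo O (Set.range θ) (Set.range Ω₁ ∪ Set.range Ω₂)

/-- The exterior differential system over `O` generated algebraically by the 1-forms in `S` and
the 2-forms in `T` is Pfaffian, i.e. generated differentially by its 1-forms. -/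
def IsPfaffian (O : Set E) (S : Set (OneForm E)) (T : Set (TwoForm E)) : Prop :=
  idealTwo O S T = idealTwo O S (extD '' S)

/-- Darboux integrability on the open set `N` of the exterior differential system generated
algebraically by the 1-forms in `S` and the 2-forms in `T`: about each point the system is
decomposable, both associated singular systems `{θ, σ₁, Ω₂}` and `{θ, σ₂, Ω₁}` are Pfaffian, and
their degree one parts form a Darboux pair. -/
def IsDarbouxIntegrableEDS (N : Set E) (S : Set (OneForm E)) (T : Set (TwoForm E)) : Prop :=
  ∀ z ∈ N, ∃ O : Set E, IsOpen O ∧ z ∈ O ∧ O ⊆ N ∧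
    ∃ (r p q s t : ℕ) (θ : Fin r → OneForm E) (σ₁ : Fin p → OneForm E) (σ₂ : Fin q → OneForm E)
      (Ω₁ : Fin s → TwoForm E) (Ω₂ : Fin t → TwoForm E),
      IsDecomposition O S T θ σ₁ σ₂ Ω₁ Ω₂ ∧
      IsPfaffian O (Set.range θ ∪ Set.range σ₁) (Set.range Ω₂) ∧
      IsPfaffian O (Set.range θ ∪ Set.range σ₂) (Set.range Ω₁) ∧
      IsDarbouxPair O
        (fun x => Submodule.span ℝ (Set.range (fun i => θ i x) ∪ Set.range (fun i => σ₁ i x)))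
        (fun x => Submodule.span ℝ (Set.range (fun i => θ i x) ∪ Set.range (fun i => σ₂ i x)))

end Forms

/-! ### The orthonormal frame bundle of Minkowski space `ℝ^{1,2}` -/

/-- The signs `⟨e₁,e₁⟩, ⟨e₂,e₂⟩, ⟨e₃,e₃⟩` of an orthonormal frame. -/
def sgn : Fin 3 → ℝ := ![1, -1, -1]

/-- The inner product `⟨v, ·⟩` of `ℝ^{1,2}`, `⟨v, w⟩ = v₁w₁ - v₂w₂ - v₃w₃`. -/
def mink (v : Fin 3 → ℝ) : (Fin 3 → ℝ) →L[ℝ] ℝ :=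
  ∑ i, (sgn i * v i) • ContinuousLinearMap.proj i

/-- `y ↦ (ρ y; e₁ y, e₂ y, e₃ y)` is a smooth local parametrization, by an open subset `W` of
`ℝ⁶`, of the 6-dimensional bundle of `SO(1,2)`-frames of `ℝ^{1,2}`. -/
structure IsFrameParametrization (W : Set (Fin 6 → ℝ)) (ρ : (Fin 6 → ℝ) → Fin 3 → ℝ)
    (e : Fin 3 → (Fin 6 → ℝ) → Fin 3 → ℝ) : Prop where
  isOpen : IsOpen W
  smooth_point : ContDiffOn ℝ ∞ ρ W
  smooth_frame : ∀ i, ContDiffOn ℝ ∞ (e i) W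
  orthonormal : ∀ y ∈ W, ∀ i j, mink (e i y) (e j y) = if i = j then sgn i else 0
  det_eq_one : ∀ y ∈ W, Matrix.det (Matrix.of fun i j => e j y i) = 1
  immersion : ∀ y ∈ W, ∀ w, fderiv ℝ ρ y w = 0 → (∀ i, fderiv ℝ (e i) y w = 0) → w = 0

/-- The canonical forms `ωⁱ` of the frame bundle, determined by `dρ = eᵢ ωⁱ`. -/
def canonicalForm (ρ : (Fin 6 → ℝ) → Fin 3 → ℝ) (e : Fin 3 → (Fin 6 → ℝ) → Fin 3 → ℝ)
    (i : Fin 3) : OneForm (Fin 6 → ℝ) :=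
  fun y => sgn i • (mink (e i y)).comp (fderiv ℝ ρ y)

/-- The connection forms `ωⁱⱼ` of the frame bundle, determined by `deⱼ = eᵢ ωⁱⱼ`. -/
def connectionForm (e : Fin 3 → (Fin 6 → ℝ) → Fin 3 → ℝ) (i j : Fin 3) : OneForm (Fin 6 → ℝ) :=
  fun y => sgn i • (mink (e i y)).comp (fderiv ℝ (e j) y)

/-- The coordinate plane. -/
abbrev Plane : Type := EuclideanSpace ℝ (Fin 2)

/-- Pullback of a 1-form from the coordinate plane to the product. -/
def pullLeft (α : OneForm Plane) : OneForm (Plane × (Fin 6 → ℝ)) :=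
  fun z => (α z.1).comp (ContinuousLinearMap.fst ℝ Plane (Fin 6 → ℝ))

/-- Pullback of a 1-form from the frame bundle to the product. -/
def pullRight (α : OneForm (Fin 6 → ℝ)) : OneForm (Plane × (Fin 6 → ℝ)) :=
  fun z => (α z.2).comp (ContinuousLinearMap.snd ℝ Plane (Fin 6 → ℝ))

/-- The 1-forms `θ₀ = ω³`, `θ₁ = ω¹ - η¹`, `θ₂ = ω² - η²`, `θ₃ = ω¹₂ - η¹₂` that generate the
isometric embedding system, for the coframing `η¹, η²` with connection form `η¹₂`. -/
def embeddingForms (η₁ η₂ η₁₂ : OneForm Plane) (ρ : (Fin 6 → ℝ) → Fin 3 → ℝ)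
    (e : Fin 3 → (Fin 6 → ℝ) → Fin 3 → ℝ) : Fin 4 → OneForm (Plane × (Fin 6 → ℝ)) :=
  ![pullRight (canonicalForm ρ e 2),
    pullRight (canonicalForm ρ e 0) - pullLeft η₁,
    pullRight (canonicalForm ρ e 1) - pullLeft η₂,
    pullRight (connectionForm e 0 1) - pullLeft η₁₂]

/-! ### Lorentzian surfaces -/

/-- On the open set `D`, `η¹, η²` is a smooth orthonormal coframing, `G = (η¹)² - (η²)²`, of the
metric with coordinate expression `G`, and `η¹₂` is its Levi-Civita connection form:
`dη¹ = -η¹₂ ∧ η²`, `dη² = -η¹₂ ∧ η¹`. -/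
structure IsOrthonormalCoframing (G : Plane → Plane → Plane → ℝ) (D : Set Plane)
    (η₁ η₂ η₁₂ : OneForm Plane) : Prop where
  isOpen : IsOpen D
  smooth₁ : ContDiffOn ℝ ∞ η₁ D
  smooth₂ : ContDiffOn ℝ ∞ η₂ D
  smooth₁₂ : ContDiffOn ℝ ∞ η₁₂ D
  metric_eq : ∀ x ∈ D, ∀ v w, G x v w = η₁ x v * η₁ x w - η₂ x v * η₂ x w
  structure₁ : ∀ x ∈ D, ∀ v w, extD η₁ x v w = - wedge η₁₂ η₂ x v w
  structure₂ : ∀ x ∈ D, ∀ v w, extD η₂ x v w = - wedge η₁₂ η₁ x v w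

/-- A smooth Lorentzian metric, of signature `(1,1)`, on a smooth surface. -/
structure LorentzianMetric (M : Type*) [TopologicalSpace M] [ChartedSpace Plane M]
    [IsManifold 𝓘(ℝ, Plane) ∞ M] where
  /-- The scalar product on the tangent spaces. -/
  inner (p : M) : TangentSpace 𝓘(ℝ, Plane) p →L[ℝ] TangentSpace 𝓘(ℝ, Plane) p →L[ℝ] ℝ
  symm (p : M) (v w : TangentSpace 𝓘(ℝ, Plane) p) : inner p v w = inner p w v
  exists_timelike (p : M) : ∃ v, 0 < inner p v v
  exists_spacelike (p : M) : ∃ v, inner p v v < 0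
  contMDiff : ContMDiff 𝓘(ℝ, Plane) (𝓘(ℝ, Plane).prod 𝓘(ℝ, Plane →L[ℝ] Plane →L[ℝ] ℝ)) ∞
    (fun p => Bundle.TotalSpace.mk' (Plane →L[ℝ] Plane →L[ℝ] ℝ)
      (E := fun p : M => TangentSpace 𝓘(ℝ, Plane) p →L[ℝ] TangentSpace 𝓘(ℝ, Plane) p →L[ℝ] ℝ)
      p (inner p))

namespace LorentzianMetric

variable {M : Type*} [TopologicalSpace M] [ChartedSpace Plane M] [IsManifold 𝓘(ℝ, Plane) ∞ M]

/-- The expression of the metric in the local coordinates `φ`. -/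
def inChart (g : LorentzianMetric M) (φ : OpenPartialHomeomorph M Plane) :
    Plane → Plane → Plane → ℝ :=
  fun x v w => g.inner (φ.symm x)
    (mfderiv 𝓘(ℝ, Plane) 𝓘(ℝ, Plane) φ.symm x v) (mfderiv 𝓘(ℝ, Plane) 𝓘(ℝ, Plane) φ.symm x w)

/-- `K` is the Gauss curvature of the Lorentzian surface: `dη¹₂ = -K η¹ ∧ η²` for the connection
form of every local orthonormal coframing. -/
def IsGaussCurvature (g : LorentzianMetric M) (K : M → ℝ) : Prop :=
  ∀ φ ∈ IsManifold.maximalAtlas 𝓘(ℝ, Plane) ∞ M, ∀ D ⊆ φ.target, ∀ η₁ η₂ η₁₂ : OneForm Plane,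
    IsOrthonormalCoframing (g.inChart φ) D η₁ η₂ η₁₂ →
    ∀ x ∈ D, ∀ v w, extD η₁₂ x v w = - K (φ.symm x) * wedge η₁ η₂ x v w

/-- The metric is (hyperbolic) Darboux integrable: its isometric embedding system into `ℝ^{1,2}`,
the exterior differential system on (surface) × (frame bundle of `ℝ^{1,2}`) generated by
`θ₀, …, θ₃` and their exterior derivatives, is Darboux integrable. The system is written in
arbitrary local coordinates of the surface and of the frame bundle of `ℝ^{1,2}`, for an arbitrary
local orthonormal coframing of the surface (that is, pulled back by an arbitrary local section of
the orthonormal frame bundle of the surface). -/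
def IsDarbouxIntegrable (g : LorentzianMetric M) : Prop :=
  ∀ φ ∈ IsManifold.maximalAtlas 𝓘(ℝ, Plane) ∞ M, ∀ D ⊆ φ.target, ∀ η₁ η₂ η₁₂ : OneForm Plane,
    IsOrthonormalCoframing (g.inChart φ) D η₁ η₂ η₁₂ →
    ∀ W ρ e, IsFrameParametrization W ρ e →
      IsDarbouxIntegrableEDS (D ×ˢ W)
        (Set.range (embeddingForms η₁ η₂ η₁₂ ρ e))
        (Set.range fun a => extD (embeddingForms η₁ η₂ η₁₂ ρ e a))

/-- The expression of a vector field in the local coordinates `φ`. -/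
def fieldInChart (V : ∀ p : M, TangentSpace 𝓘(ℝ, Plane) p) (φ : OpenPartialHomeomorph M Plane) :
    Plane → Plane :=
  fun x => mfderiv 𝓘(ℝ, Plane) 𝓘(ℝ, Plane) φ (φ.symm x) (V (φ.symm x))

/-- `V` is a smooth Killing field: `L_V g = 0`, where in local coordinates
`(L_V g)(a, b) = V(g(a, b)) + g(D_a V, b) + g(a, D_b V)` for constant vectors `a, b`. -/
structure IsKilling (g : LorentzianMetric M) (V : ∀ p : M, TangentSpace 𝓘(ℝ, Plane) p) :
    Prop where
  contMDiff : ContMDiff 𝓘(ℝ, Plane) 𝓘(ℝ, Plane).tangent ∞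
    (fun p => (⟨p, V p⟩ : TangentBundle 𝓘(ℝ, Plane) M))
  lie_eq_zero : ∀ φ ∈ IsManifold.maximalAtlas 𝓘(ℝ, Plane) ∞ M, ∀ x ∈ φ.target, ∀ a b : Plane,
    fderiv ℝ (fun y => g.inChart φ y a b) x (fieldInChart V φ x)
      + g.inChart φ x (fderiv ℝ (fieldInChart V φ) x a) b
      + g.inChart φ x a (fderiv ℝ (fieldInChart V φ) x b) = 0

end LorentzianMetric

end DarbouxEmbedding

end

/-! A timelike Killing field X turns the metric into a warped product. Both X^♭/|X|² and the unit
conormal of the orbits of X are closed: they are invariant under X, their values on X are constant,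
and the surface has dimension two. Their primitives v and s are coordinates in which g = F(s)² dv² -
ds² (`exists_adapted_map`, `LorentzianMetric.exists_warped_chart`). There K = F''/F, and K < 0 is
written as K = -k².

The isometric embedding system lives in dimension 8. Its four generators annihilate a distribution
of rank 4, on which dθ₁ and dθ₂ vanish and dθ₀, dθ₃ span a pencil. A decomposition must have p = q =
2, so the product of the two forms σ̂ is a decomposable member of this pencil. The Plücker relation
leaves two such members up to scale, labelled by κ = ±k, and the kernel of each is an explicit
characteristic plane (`IsDecomposition.exists_characteristic`). By continuity the sign is locally
constant. Thus V̂ annihilates one characteristic plane field, and V̂^∞ annihilates all of its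
iterated brackets. As V̌ has rank at most 6, the condition V̂^∞ + V̌ = T* gives V̂^∞ rank at least
2.

In left invariant components these brackets are computed in the isometry algebra of ℝ^{1,2}
(`lieBracket_lift`). The two characteristic fields and three of their brackets already cut the rank
of V̂^∞ down to at most 3. The relations imposed by further brackets are compatible with rank 2 only
if k'F' = -2k³F (`curvature_equation`).

Together with F'' = -k²F this equation has the first integrals k = lF'² and F'²(l²F² + C) = 1
(`exists_first_integrals`). The three normal forms correspond to the sign of C: sinh u, cosh u or u
itself is taken proportional to F, and v is rescaled (`normal_form_identities`). -/

noncomputable section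

namespace DarbouxEmbedding

/-! ### A global parametrization of the frame bundle -/

/-- The components of an element of the Lie algebra of the isometry group of `ℝ^{1,2}`, in the
order `ω¹, ω², ω³, ω¹₂, ω³₁, ω³₂`. -/
abbrev Motion : Type := Fin 6 → ℝ

/-- The columns `e₁, e₂, e₃` of the product of the boosts of rapidity `y₃`, `y₄` in the planes
`12`, `13` and of the rotation by `y₅` in the plane `23`. -/
def frame : Fin 3 → (Fin 6 → ℝ) → Fin 3 → ℝ :=
  ![fun y => ![Real.cosh (y 3) * Real.cosh (y 4), Real.sinh (y 3) * Real.cosh (y 4),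
      Real.sinh (y 4)],
    fun y => ![Real.cos (y 5) * Real.sinh (y 3) + Real.sin (y 5) * (Real.cosh (y 3) * Real.sinh (y 4)),
      Real.cos (y 5) * Real.cosh (y 3) + Real.sin (y 5) * (Real.sinh (y 3) * Real.sinh (y 4)),
      Real.sin (y 5) * Real.cosh (y 4)],
    fun y => ![-Real.sin (y 5) * Real.sinh (y 3) + Real.cos (y 5) * (Real.cosh (y 3) * Real.sinh (y 4)),
      -Real.sin (y 5) * Real.cosh (y 3) + Real.cos (y 5) * (Real.sinh (y 3) * Real.sinh (y 4)),
      Real.cos (y 5) * Real.cosh (y 4)]]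

/-- The base point of the frame. -/
def point : (Fin 6 → ℝ) → Fin 3 → ℝ := fun y => ![y 0, y 1, y 2]

/-- The matrix of forms `(ωⁱ, ωⁱⱼ)` evaluated on a vector with components `x`: the row `0` is zero
and the column `0` is `ωⁱ`. -/
def hat (x : Motion) : Matrix (Fin 3) (Fin 4) ℝ :=
  !![x 0, 0, x 3, x 4; x 1, x 3, 0, -x 5; x 2, x 4, x 5, 0]

/-- The base point and the frame as a family of vector valued functions. -/
def framing : Fin 4 → (Fin 6 → ℝ) → Fin 3 → ℝ := Fin.cons point frame

/-- The left invariant vector field with components `x`. -/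
def leftInv (x : Motion) (y : Fin 6 → ℝ) : Fin 6 → ℝ :=
  ![x 0 * frame 0 y 0 + x 1 * frame 1 y 0 + x 2 * frame 2 y 0,
    x 0 * frame 0 y 1 + x 1 * frame 1 y 1 + x 2 * frame 2 y 1,
    x 0 * frame 0 y 2 + x 1 * frame 1 y 2 + x 2 * frame 2 y 2,
    (Real.cos (y 5) * x 3 - Real.sin (y 5) * x 4) / Real.cosh (y 4),
    Real.sin (y 5) * x 3 + Real.cos (y 5) * x 4,
    x 5 + (Real.cos (y 5) * x 3 - Real.sin (y 5) * x 4) * Real.sinh (y 4) / Real.cosh (y 4)]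

theorem contDiff_frame (i : Fin 3) : ContDiff ℝ ∞ (frame i) := by
  rw [contDiff_pi]
  intro j
  fin_cases i <;> fin_cases j <;> simp [frame] <;> fun_prop

theorem contDiff_point : ContDiff ℝ ∞ point := by
  rw [contDiff_pi]
  intro j
  fin_cases j <;> simp [point] <;> fun_prop

theorem contDiff_framing (a : Fin 4) : ContDiff ℝ ∞ (framing a) := by
  refine Fin.cases ?_ (fun i => ?_) a
  · exact contDiff_point
  · exact contDiff_frame i

theorem contDiff_leftInv : ContDiff ℝ ∞ (fun q : Motion × (Fin 6 → ℝ) => leftInv q.1 q.2) := by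
  have hf : ∀ i j, ContDiff ℝ ∞ (fun q : Motion × (Fin 6 → ℝ) => frame i q.2 j) := fun i j =>
    (contDiff_pi.1 (contDiff_frame i) j).comp contDiff_snd
  have h1 : ∀ i, ContDiff ℝ ∞ (fun q : Motion × (Fin 6 → ℝ) => q.1 i) := fun i => by fun_prop
  have h2 : ∀ i, ContDiff ℝ ∞ (fun q : Motion × (Fin 6 → ℝ) => q.2 i) := fun i => by fun_prop
  have hc : ∀ q : Motion × (Fin 6 → ℝ), Real.cosh (q.2 4) ≠ 0 := fun q => (Real.cosh_pos _).ne'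
  rw [contDiff_pi]
  intro j
  fin_cases j <;> simp [leftInv]
  · exact (((h1 0).mul (hf 0 0)).add ((h1 1).mul (hf 1 0))).add ((h1 2).mul (hf 2 0))
  · exact (((h1 0).mul (hf 0 1)).add ((h1 1).mul (hf 1 1))).add ((h1 2).mul (hf 2 1))
  · exact (((h1 0).mul (hf 0 2)).add ((h1 1).mul (hf 1 2))).add ((h1 2).mul (hf 2 2))
  · exact ContDiff.div (by fun_prop) (by fun_prop) hc
  · fun_prop
  · exact (h1 5).add (ContDiff.div (by fun_prop) (by fun_prop) hc)

theorem frame_orthonormal (y : Fin 6 → ℝ) (i j : Fin 3) :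
    mink (frame i y) (frame j y) = if i = j then sgn i else 0 := by
  have h1 := Real.cosh_sq (y 3)
  have h2 := Real.cosh_sq (y 4)
  have h3 := Real.sin_sq_add_cos_sq (y 5)
  fin_cases i <;> fin_cases j <;>
    simp [mink, frame, sgn, Fin.sum_univ_three] <;> grind

theorem frame_det (y : Fin 6 → ℝ) : Matrix.det (Matrix.of fun i j => frame j y i) = 1 := by
  have h1 := Real.cosh_sq (y 3)
  have h2 := Real.cosh_sq (y 4)
  have h3 := Real.sin_sq_add_cos_sq (y 5)
  rw [Matrix.det_fin_three]
  simp [frame]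
  grind


theorem hasDerivAt_frame_line (i : Fin 3) (y w : Fin 6 → ℝ) :
    HasDerivAt (fun t : ℝ => frame i (y + t • w)) (fderiv ℝ (frame i) y w) 0 := by
  have h1 : HasDerivAt (fun t : ℝ => y + t • w) w 0 := by
    simpa using ((hasDerivAt_id (0 : ℝ)).smul_const w).const_add y
  have h2 : HasFDerivAt (frame i) (fderiv ℝ (frame i) y) (y + (0 : ℝ) • w) := by
    simpa using ((contDiff_frame i).differentiable (by simp) y).hasFDerivAt
  exact h2.comp_hasDerivAt (0 : ℝ) h1

/-- The components `ω¹₂, ω³₁, ω³₂` of a tangent vector of the frame bundle. -/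
def rotationPart (y w : Fin 6 → ℝ) : Motion :=
  ![0, 0, 0, Real.cos (y 5) * (Real.cosh (y 4) * w 3) + Real.sin (y 5) * w 4,
    -Real.sin (y 5) * (Real.cosh (y 4) * w 3) + Real.cos (y 5) * w 4,
    w 5 - Real.sinh (y 4) * w 3]

/-- These are the equations deⱼ = eᵢ ωⁱⱼ. Differentiation along the line through y in the direction
w turns each of the nine entries into a derivative in one variable. -/
theorem fderiv_frame (j : Fin 3) (y w : Fin 6 → ℝ) :
    fderiv ℝ (frame j) y w = ∑ i, hat (rotationPart y w) i j.succ • frame i y := by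
  have h := hasDerivAt_pi.1 (hasDerivAt_frame_line j y w)
  have hl : ∀ m : Fin 6, HasDerivAt (fun t : ℝ => (y + t • w) m) (w m) 0 := fun m => by
    simpa using ((hasDerivAt_id (0 : ℝ)).mul_const (w m)).const_add (y m)
  have e : ∀ m : Fin 6, (y + (0 : ℝ) • w) m = y m := fun m => by simp
  have h1 := Real.cosh_sq (y 3)
  have h2 := Real.cosh_sq (y 4)
  have h3 := Real.sin_sq_add_cos_sq (y 5)
  have ca := (hl 3).cosh
  have sa := (hl 3).sinh
  have cb := (hl 4).cosh
  have sb := (hl 4).sinh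
  have cc := (hl 5).cos
  have sc := (hl 5).sin
  rw [e] at ca sa cb sb cc sc
  ext m
  refine (h m).unique ?_
  fin_cases j <;> fin_cases m
  · convert! ca.mul cb using 1
    simp [Fin.sum_univ_three, hat, rotationPart, frame]; grind
  · convert! sa.mul cb using 1
    simp [Fin.sum_univ_three, hat, rotationPart, frame]; grind
  · convert! sb using 1
    simp [Fin.sum_univ_three, hat, rotationPart, frame]; grind
  · convert! (cc.mul sa).add (sc.mul (ca.mul sb)) using 1
    simp [Fin.sum_univ_three, hat, rotationPart, frame]; grind
  · convert! (cc.mul ca).add (sc.mul (sa.mul sb)) using 1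
    simp [Fin.sum_univ_three, hat, rotationPart, frame]; grind
  · convert! sc.mul cb using 1
    simp [Fin.sum_univ_three, hat, rotationPart, frame]; grind
  · convert! (sc.neg.mul sa).add (cc.mul (ca.mul sb)) using 1
    simp [Fin.sum_univ_three, hat, rotationPart, frame]; grind
  · convert! (sc.neg.mul ca).add (cc.mul (sa.mul sb)) using 1
    simp [Fin.sum_univ_three, hat, rotationPart, frame]; grind
  · convert! cc.mul cb using 1
    simp [Fin.sum_univ_three, hat, rotationPart, frame]; grind

theorem fderiv_point (y w : Fin 6 → ℝ) : fderiv ℝ point y w = ![w 0, w 1, w 2] := by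
  have h : point = fun y => (ContinuousLinearMap.pi
      ![ContinuousLinearMap.proj 0, ContinuousLinearMap.proj 1, ContinuousLinearMap.proj 2] :
      (Fin 6 → ℝ) →L[ℝ] (Fin 3 → ℝ)) y := by
    ext y i
    fin_cases i <;> simp [point]
  rw [h, ContinuousLinearMap.fderiv]
  ext i
  fin_cases i <;> simp

/-- A linear combination of the frame vectors vanishes only if its coefficients do. -/
theorem frame_coeff_eq (y : Fin 6 → ℝ) (x x' : Fin 3 → ℝ)
    (h : ∑ i, x i • frame i y = ∑ i, x' i • frame i y) : x = x' := by
  have key : ∀ x : Fin 3 → ℝ, ∀ j, mink (frame j y) (∑ i, x i • frame i y) = x j * sgn j := by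
    intro x j
    simp only [map_sum, map_smul, frame_orthonormal, smul_eq_mul]
    simp
  ext j
  have := congrArg (mink (frame j y)) h
  rw [key, key] at this
  refine mul_right_cancel₀ ?_ this
  fin_cases j <;> simp [sgn]

/-- Tangent vectors of the frame bundle are detected by dρ and deⱼ. Besides the immersion property,
this permits identities between vector fields to be checked on the functions `framing a`. -/
theorem fderiv_framing_injective (y w : Fin 6 → ℝ) (h : ∀ a, fderiv ℝ (framing a) y w = 0) :
    w = 0 := by
  have hp : fderiv ℝ point y w = 0 := h 0
  have hf : ∀ j : Fin 3, (fun i => hat (rotationPart y w) i j.succ) = 0 := fun j => by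
    have : fderiv ℝ (frame j) y w = 0 := h j.succ
    rw [fderiv_frame] at this
    exact frame_coeff_eq y _ 0 (by simpa using this)
  rw [fderiv_point] at hp
  have h0 := congrFun hp 0
  have h1 := congrFun hp 1
  have h2 := congrFun hp 2
  have h3 := congrFun (hf 1) 0
  have h4 := congrFun (hf 2) 0
  have h5 := congrFun (hf 1) 2
  simp [hat, rotationPart] at h0 h1 h2 h3 h4 h5
  have hs := Real.sin_sq_add_cos_sq (y 5)
  have hc := Real.cosh_pos (y 4)
  have w4 : w 4 = 0 := by grind
  have w3' : Real.cosh (y 4) * w 3 = 0 := by grind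
  have w3 : w 3 = 0 := by simpa [hc.ne'] using w3'
  have w5 : w 5 = 0 := by grind
  ext i
  fin_cases i <;> simp [*]

/-- The formulas for `leftInv` were obtained by solving these equations; the values of ωⁱ and ωⁱⱼ on
left invariant fields are read off from them. -/
theorem fderiv_framing_leftInv (a : Fin 4) (x : Motion) (y : Fin 6 → ℝ) :
    fderiv ℝ (framing a) y (leftInv x y) = ∑ i, hat x i a • frame i y := by
  have hs := Real.sin_sq_add_cos_sq (y 5)
  have hc := Real.cosh_pos (y 4)
  refine Fin.cases ?_ (fun j => ?_) a
  · have h : fderiv ℝ (framing 0) y (leftInv x y) = fderiv ℝ point y (leftInv x y) := rfl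
    rw [h, fderiv_point]
    ext m
    fin_cases m <;> simp [leftInv, Fin.sum_univ_three, hat]
  · have h : fderiv ℝ (framing j.succ) y (leftInv x y) = fderiv ℝ (frame j) y (leftInv x y) := rfl
    have h3 : rotationPart y (leftInv x y) = ![0, 0, 0, x 3, x 4, x 5] := by
      ext m
      fin_cases m <;> simp [rotationPart, leftInv] <;> field_simp <;> grind
    rw [h, fderiv_frame, h3]
    refine Finset.sum_congr rfl fun i _ => ?_
    fin_cases i <;> fin_cases j <;> simp [hat]

/-- The Darboux hypothesis is applied to this single parametrization. -/
theorem isFrameParametrization : IsFrameParametrization Set.univ point frame where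
  isOpen := isOpen_univ
  smooth_point := contDiff_point.contDiffOn
  smooth_frame i := (contDiff_frame i).contDiffOn
  orthonormal y _ i j := frame_orthonormal y i j
  det_eq_one y _ := frame_det y
  immersion y _ w h1 h2 := fderiv_framing_injective y w fun a => by
    refine Fin.cases ?_ (fun i => ?_) a
    · exact h1
    · exact h2 i

theorem canonicalForm_leftInv (i : Fin 3) (x : Motion) (y : Fin 6 → ℝ) :
    canonicalForm point frame i y (leftInv x y) = hat x i 0 := by
  have h : fderiv ℝ point y (leftInv x y) = ∑ i, hat x i 0 • frame i y :=
    fderiv_framing_leftInv 0 x y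
  simp only [canonicalForm, smul_apply, ContinuousLinearMap.comp_apply, h,
    map_sum, map_smul, frame_orthonormal, smul_eq_mul]
  fin_cases i <;> simp [sgn]

theorem connectionForm_leftInv (i j : Fin 3) (x : Motion) (y : Fin 6 → ℝ) :
    connectionForm frame i j y (leftInv x y) = hat x i j.succ := by
  have h : fderiv ℝ (frame j) y (leftInv x y) = ∑ i, hat x i j.succ • frame i y :=
    fderiv_framing_leftInv j.succ x y
  simp only [connectionForm, smul_apply, ContinuousLinearMap.comp_apply, h,
    map_sum, map_smul, frame_orthonormal, smul_eq_mul]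
  fin_cases i <;> simp [sgn]

theorem leftInv_add (x x' : Motion) (y : Fin 6 → ℝ) :
    leftInv (x + x') y = leftInv x y + leftInv x' y := by
  ext m
  fin_cases m <;> simp [leftInv] <;> ring

theorem leftInv_smul (c : ℝ) (x : Motion) (y : Fin 6 → ℝ) :
    leftInv (c • x) y = c • leftInv x y := by
  ext m
  fin_cases m <;> simp [leftInv] <;> ring

theorem leftInv_surjective (y w : Fin 6 → ℝ) : ∃ x, leftInv x y = w := by
  let L : Motion →ₗ[ℝ] (Fin 6 → ℝ) :=
    { toFun := fun x => leftInv x y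
      map_add' := fun x x' => leftInv_add x x' y
      map_smul' := fun c x => leftInv_smul c x y }
  have hL : Function.Injective L := by
    rw [injective_iff_map_eq_zero]
    intro x hx
    have h : ∀ a, (fun i => hat x i a) = 0 := fun a => by
      refine frame_coeff_eq y _ 0 ?_
      have := fderiv_framing_leftInv a x y
      have h0 : leftInv x y = 0 := hx
      rw [h0, map_zero] at this
      simpa using this.symm
    have h0 := congrFun (h 0) 0
    have h1 := congrFun (h 0) 1
    have h2 := congrFun (h 0) 2
    have h3 := congrFun (h 2) 0
    have h4 := congrFun (h 3) 0
    have h5 := congrFun (h 2) 2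
    simp [hat] at h0 h1 h2 h3 h4 h5
    ext m
    fin_cases m <;> simp [*]
  exact LinearMap.injective_iff_surjective.1 hL w

/-! ### Vector fields on the product of the plane and the frame bundle -/

/-- The product of the coordinate plane and of the frame bundle. -/
abbrev Total : Type := Plane × (Fin 6 → ℝ)

/-- The Lie bracket of the isometry algebra of `ℝ^{1,2}`. -/
def motionBracket (x x' : Motion) : Motion :=
  ![x 3 * x' 1 + x 4 * x' 2 - (x' 3 * x 1 + x' 4 * x 2),
    x 3 * x' 0 - x 5 * x' 2 - (x' 3 * x 0 - x' 5 * x 2),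
    x 4 * x' 0 + x 5 * x' 1 - (x' 4 * x 0 + x' 5 * x 1),
    x 4 * x' 5 - x 5 * x' 4, x 5 * x' 3 - x 3 * x' 5, x 4 * x' 3 - x 3 * x' 4]

/-- The vector field with constant part `b` along the plane and with components `x`, depending on
the first coordinate of the plane, along the frame bundle. -/
def lift (b : Plane) (x : ℝ → Motion) : Total → Total := fun z => (b, leftInv (x (z.1 0)) z.2)

theorem contDiffOn_lift (b : Plane) {x : ℝ → Motion} {I : Set ℝ} (hx : ContDiffOn ℝ ∞ x I) :
    ContDiffOn ℝ ∞ (lift b x) {z | z.1 0 ∈ I} := by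
  have h0 : ContDiff ℝ ∞ (fun z : Total => z.1 0) := by fun_prop
  have h1 : ContDiffOn ℝ ∞ (fun z : Total => (x (z.1 0), z.2)) {z | z.1 0 ∈ I} :=
    (hx.comp h0.contDiffOn (fun z hz => hz)).prodMk contDiff_snd.contDiffOn
  exact contDiffOn_const.prodMk (contDiff_leftInv.comp_contDiffOn h1)

theorem differentiableAt_lift (b : Plane) {x : ℝ → Motion} {z : Total}
    (hx : DifferentiableAt ℝ x (z.1 0)) : DifferentiableAt ℝ (lift b x) z := by
  have h0 : Differentiable ℝ (fun z : Total => z.1 0) := by fun_prop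
  have h1 : DifferentiableAt ℝ (fun z : Total => (x (z.1 0), z.2)) z :=
    (DifferentiableAt.comp (f := fun z : Total => z.1 0) z hx (h0 z)).prodMk
      differentiableAt_snd
  have h2 := (contDiff_leftInv.differentiable (by simp) (x (z.1 0), z.2)).comp z h1
  exact (differentiableAt_const b).prodMk h2

theorem hasDerivAt_hat {x : ℝ → Motion} {x' : Motion} {s : ℝ} (hx : HasDerivAt x x' s) (i : Fin 3)
    (a : Fin 4) : HasDerivAt (fun s => hat (x s) i a) (hat x' i a) s := by
  have h := hasDerivAt_pi.1 hx
  fin_cases i <;> fin_cases a <;> simp [hat] <;>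
    first
    | exact h _
    | exact (h _).neg
    | exact hasDerivAt_const _ _

/-- With the missing zero row restored, `hat x` is a 4 × 4 matrix of an affine motion, and this is
the commutator of two such matrices. -/
theorem hat_motionBracket (x x' : Motion) (k : Fin 3) (a : Fin 4) :
    hat (motionBracket x x') k a =
      ∑ i, hat x' i a * hat x k i.succ - ∑ i, hat x i a * hat x' k i.succ := by
  fin_cases k <;> fin_cases a <;> simp [hat, motionBracket, Fin.sum_univ_three] <;> ring

theorem hat_add (x x' : Motion) : hat (x + x') = hat x + hat x' := by
  ext i a
  fin_cases i <;> fin_cases a <;> simp [hat]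
  ring

theorem hat_smul (c : ℝ) (x : Motion) : hat (c • x) = c • hat x := by
  ext i a
  fin_cases i <;> fin_cases a <;> simp [hat]

theorem hat_sub (x x' : Motion) : hat (x - x') = hat x - hat x' := by
  rw [sub_eq_add_neg, ← neg_one_smul ℝ x', hat_add, hat_smul]
  simp [sub_eq_add_neg]

theorem fderiv_framing_lift (a : Fin 4) (b : Plane) (x : ℝ → Motion) (z : Total) :
    fderiv ℝ (fun z : Total => framing a z.2) z (lift b x z) =
      ∑ i, hat (x (z.1 0)) i a • frame i z.2 := by
  have h : HasFDerivAt (fun z : Total => framing a z.2)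
      ((fderiv ℝ (framing a) z.2).comp (ContinuousLinearMap.snd ℝ Plane (Fin 6 → ℝ))) z :=
    (((contDiff_framing a).differentiable (by simp) z.2).hasFDerivAt).comp z hasFDerivAt_snd
  rw [h.fderiv]
  exact fderiv_framing_leftInv a _ _

/-- Product rule: the coefficients vary only with the first plane coordinate, at rate `b 0`, and the
frame vectors vary by the equations deᵢ = eₖ ωᵏᵢ. -/
theorem fderiv_fderiv_framing_lift (a : Fin 4) (b : Plane) {x x' : ℝ → Motion} {z : Total}
    (hx' : DifferentiableAt ℝ x' (z.1 0)) :
    fderiv ℝ (fun z : Total => ∑ i, hat (x' (z.1 0)) i a • frame i z.2) z (lift b x z) =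
      ∑ k, (b 0 * hat (deriv x' (z.1 0)) k a
        + ∑ i, hat (x' (z.1 0)) i a * hat (x (z.1 0)) k i.succ) • frame k z.2 := by
  have h0 : HasFDerivAt (fun z : Total => z.1 0)
      ((EuclideanSpace.proj (0 : Fin 2) : Plane →L[ℝ] ℝ).comp
        (ContinuousLinearMap.fst ℝ Plane (Fin 6 → ℝ))) z :=
    ((EuclideanSpace.proj (0 : Fin 2) : Plane →L[ℝ] ℝ).comp
        (ContinuousLinearMap.fst ℝ Plane (Fin 6 → ℝ))).hasFDerivAt
  have h1 : ∀ i : Fin 3, HasFDerivAt (fun z : Total => hat (x' (z.1 0)) i a)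
      (hat (deriv x' (z.1 0)) i a • ((EuclideanSpace.proj (0 : Fin 2) : Plane →L[ℝ] ℝ).comp
        (ContinuousLinearMap.fst ℝ Plane (Fin 6 → ℝ)))) z := fun i =>
    HasDerivAt.comp_hasFDerivAt (h₂ := fun s => hat (x' s) i a) z
      (hasDerivAt_hat hx'.hasDerivAt i a) h0
  have h2 : ∀ i : Fin 3, HasFDerivAt (fun z : Total => frame i z.2)
      ((fderiv ℝ (frame i) z.2).comp (ContinuousLinearMap.snd ℝ Plane (Fin 6 → ℝ))) z := fun i =>
    (((contDiff_frame i).differentiable (by simp) z.2).hasFDerivAt).comp z hasFDerivAt_snd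
  have h3 := HasFDerivAt.fun_sum (u := Finset.univ) fun i _ => (h1 i).fun_smul (h2 i)
  have h4 : ∀ i, fderiv ℝ (frame i) z.2 (leftInv (x (z.1 0)) z.2) =
      ∑ k, hat (x (z.1 0)) k i.succ • frame k z.2 := fun i => fderiv_framing_leftInv i.succ _ _
  rw [h3.fderiv]
  simp only [sum_apply, add_apply, smul_apply,
    ContinuousLinearMap.comp_apply, ContinuousLinearMap.smulRight_apply, lift,
    ContinuousLinearMap.coe_fst', ContinuousLinearMap.coe_snd', h4, Finset.sum_add_distrib,
    add_smul, Finset.sum_smul, Finset.smul_sum, smul_smul, smul_eq_mul]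
  rw [add_comm]
  congr 1
  · refine Finset.sum_congr rfl fun i _ => ?_
    rw [mul_comm]; rfl
  · exact Finset.sum_comm

/-- The bracket of two lifted vector fields. -/
theorem lieBracket_lift (b b' : Plane) {x x' : ℝ → Motion} {z : Total}
    (hx : DifferentiableAt ℝ x (z.1 0)) (hx' : DifferentiableAt ℝ x' (z.1 0)) :
    VectorField.lieBracket ℝ (lift b x) (lift b' x') z =
      lift 0 (fun s => motionBracket (x s) (x' s) + b 0 • deriv x' s - b' 0 • deriv x s) z := by
  have hd := differentiableAt_lift b hx
  have hd' := differentiableAt_lift b' hx'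
  have hfst : ∀ (b : Plane) {x : ℝ → Motion} (_ : DifferentiableAt ℝ (lift b x) z) (u : Total),
      (fderiv ℝ (lift b x) z u).1 = 0 := by
    intro b x h u
    have h1 : HasFDerivAt (fun z => (lift b x z).1)
        ((ContinuousLinearMap.fst ℝ Plane (Fin 6 → ℝ)).comp (fderiv ℝ (lift b x) z)) z :=
      hasFDerivAt_fst.comp z h.hasFDerivAt
    have h2 := h1.unique (hasFDerivAt_const b z)
    exact congrArg (fun L => L u) h2
  have h1 : (VectorField.lieBracket ℝ (lift b x) (lift b' x') z).1 = 0 := by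
    rw [VectorField.lieBracket, Prod.fst_sub, hfst b' hd', hfst b hd, sub_zero]
  refine Prod.ext h1 ?_
  rw [← sub_eq_zero]
  -- The plane components are constant, so the bracket is vertical. A vertical vector is determined
  -- by its action on ρ and eⱼ, where the bracket acts as the commutator of the two known
  -- derivations.
  refine fderiv_framing_injective z.2 _ fun a => ?_
  have hF : ContDiff ℝ ∞ (fun z : Total => framing a z.2) :=
    (contDiff_framing a).comp contDiff_snd
  have hD : ∀ u : Total, fderiv ℝ (fun z : Total => framing a z.2) z u
      = fderiv ℝ (framing a) z.2 u.2 := by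
    intro u
    have h : HasFDerivAt (fun z : Total => framing a z.2)
        ((fderiv ℝ (framing a) z.2).comp (ContinuousLinearMap.snd ℝ Plane (Fin 6 → ℝ))) z :=
      (((contDiff_framing a).differentiable (by simp) z.2).hasFDerivAt).comp z hasFDerivAt_snd
    rw [h.fderiv]; rfl
  have h2 := VectorField.fderiv_apply_lieBracket (𝕜 := ℝ) hF.contDiffAt (n := ∞)
    (by rw [minSmoothness_of_isRCLikeNormedField]; exact WithTop.coe_le_coe.2 (le_top : (2 : ℕ∞) ≤ ⊤)) hd' hd
  simp only [fderiv_framing_lift] at h2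
  rw [fderiv_fderiv_framing_lift a b hx', fderiv_fderiv_framing_lift a b' hx, hD] at h2
  rw [map_sub, h2, sub_eq_zero, lift, fderiv_framing_leftInv, ← Finset.sum_sub_distrib]
  refine Finset.sum_congr rfl fun k _ => ?_
  rw [← sub_smul, hat_sub, hat_add, hat_smul, hat_smul]
  congr 1
  simp only [Matrix.sub_apply, Matrix.add_apply, Matrix.smul_apply, hat_motionBracket, smul_eq_mul]
  ring

theorem lift_zero_add (x x' : ℝ → Motion) (z : Total) :
    lift 0 (fun s => x s + x' s) z = lift 0 x z + lift 0 x' z := by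
  simp [lift, leftInv_add]

theorem lift_zero_smul (c : ℝ → ℝ) (x : ℝ → Motion) (z : Total) :
    lift 0 (fun s => c s • x s) z = c (z.1 0) • lift 0 x z := by
  simp [lift, leftInv_smul]

/-! ### Vector fields annihilated by a derived system -/

section Annihilators

variable {E : Type*} [NormedAddCommGroup E] [NormedSpace ℝ E]

theorem derivedFlag_succ_subset (O : Set E) (V : E → Submodule ℝ (E →L[ℝ] ℝ)) (k : ℕ) :
    derivedFlag O V (k + 1) ⊆ derivedFlag O V k := fun _ h => h.1

theorem derivedFlag_antitone (O : Set E) (V : E → Submodule ℝ (E →L[ℝ] ℝ)) :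
    Antitone (derivedFlag O V) := antitone_nat_of_succ_le fun k => derivedFlag_succ_subset O V k

theorem contDiffOn_of_mem_derivedFlag {O : Set E} {V : E → Submodule ℝ (E →L[ℝ] ℝ)} {k : ℕ}
    {γ : OneForm E} (h : γ ∈ derivedFlag O V k) : ContDiffOn ℝ ∞ γ O :=
  (derivedFlag_antitone O V (Nat.zero_le k) h : γ ∈ sections O V).1

/-- Cartan's formula for the exterior derivative of a 1-form on two vector fields on which the
1-form vanishes. -/
theorem extD_eq_neg_lieBracket {γ : OneForm E} {X Y : E → E} {x : E}
    (hγ : DifferentiableAt ℝ γ x) (hX : DifferentiableAt ℝ X x) (hY : DifferentiableAt ℝ Y x)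
    (h1 : ∀ᶠ y in 𝓝 x, γ y (X y) = 0) (h2 : ∀ᶠ y in 𝓝 x, γ y (Y y) = 0) :
    extD γ x (X x) (Y x) = - γ x (VectorField.lieBracket ℝ X Y x) := by
  have aux : ∀ Z : E → E, DifferentiableAt ℝ Z x → (∀ᶠ y in 𝓝 x, γ y (Z y) = 0) → ∀ u,
      fderiv ℝ γ x u (Z x) = - γ x (fderiv ℝ Z x u) := by
    intro Z hZ h u
    have h3 := hγ.hasFDerivAt.clm_apply hZ.hasFDerivAt
    have h4 : HasFDerivAt (fun y => γ y (Z y)) (0 : E →L[ℝ] ℝ) x :=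
      (hasFDerivAt_const (0 : ℝ) x).congr_of_eventuallyEq h
    have h5 := congrArg (fun L => L u) (h3.unique h4)
    simp at h5
    linarith
  rw [extD, aux Y hY h2, aux X hX h1, VectorField.lieBracket, map_sub]
  ring

/-- The bracket of two vector fields annihilated by `V⁽ᵏ⁾` is annihilated by `V⁽ᵏ⁺¹⁾`. -/
theorem derivedFlag_lieBracket_eq_zero {O O' : Set E} (hO : O' ⊆ O) (hO' : IsOpen O')
    {V : E → Submodule ℝ (E →L[ℝ] ℝ)} {k : ℕ} {X Y : E → E}
    (hX : ∀ x ∈ O', DifferentiableAt ℝ X x) (hY : ∀ x ∈ O', DifferentiableAt ℝ Y x)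
    (hXk : ∀ γ ∈ derivedFlag O V k, ∀ x ∈ O', γ x (X x) = 0)
    (hYk : ∀ γ ∈ derivedFlag O V k, ∀ x ∈ O', γ x (Y x) = 0) :
    ∀ γ ∈ derivedFlag O V (k + 1), ∀ x ∈ O', γ x (VectorField.lieBracket ℝ X Y x) = 0 := by
  intro γ hγ x hx
  have hγk : γ ∈ derivedFlag O V k := hγ.1
  have hd : DifferentiableAt ℝ γ x :=
    (((contDiffOn_of_mem_derivedFlag hγ).mono hO).contDiffAt (hO'.mem_nhds hx)).differentiableAt
      (by simp)
  have h := extD_eq_neg_lieBracket hd (hX x hx) (hY x hx)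
    (Filter.eventually_of_mem (hO'.mem_nhds hx) (hXk γ hγk))
    (Filter.eventually_of_mem (hO'.mem_nhds hx) (hYk γ hγk))
  -- Membership in the next derived system writes dγ as a sum of products, each having a factor in
  -- V⁽ᵏ⁾, and that factor vanishes on both X and Y.
  obtain ⟨m, n, α, σ, f, Θ, hα, hf, hsum⟩ := hγ.2
  have h0 : extD γ x (X x) (Y x) = 0 := by
    rw [hsum x (hO hx)]
    have e1 : ∀ i, wedge (α i) (σ i) x (X x) (Y x) = 0 := fun i => by
      simp [wedge, hXk _ (hα i).2 x hx, hYk _ (hα i).2 x hx]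
    have e2 : ∀ j, f j x * Θ j x (X x) (Y x) = 0 := fun j => ((hf j).2).elim
    simp [e1, e2]
  rw [h0] at h
  linarith

end Annihilators

/-- The values on `O` of the vector field with components `x` are annihilated by the final element
of the derived flag of `V`, because they are annihilated by some element of the derived flag. -/
structure IsCharacteristic (O O' : Set Total) (V : Total → Submodule ℝ (Total →L[ℝ] ℝ)) (I : Set ℝ)
    (b : Plane) (x : ℝ → Motion) : Prop where
  smooth : ContDiffOn ℝ ∞ x I
  annihilated : ∃ k, ∀ γ ∈ derivedFlag O V k, ∀ z ∈ O', γ z (lift b x z) = 0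

namespace IsCharacteristic

variable {O O' : Set Total} {V : Total → Submodule ℝ (Total →L[ℝ] ℝ)} {I : Set ℝ} {b b' : Plane}
  {x x' : ℝ → Motion}

theorem congr (h : IsCharacteristic O O' V I b x) (hI : ∀ z ∈ O', z.1 0 ∈ I)
    (hx : ∀ s ∈ I, x' s = x s) : IsCharacteristic O O' V I b x' := by
  refine ⟨h.smooth.congr hx, ?_⟩
  obtain ⟨k, hk⟩ := h.annihilated
  refine ⟨k, fun γ hγ z hz => ?_⟩
  have := hk γ hγ z hz
  simpa only [lift, hx _ (hI z hz)] using this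

theorem add (h : IsCharacteristic O O' V I 0 x) (h' : IsCharacteristic O O' V I 0 x') :
    IsCharacteristic O O' V I 0 (fun s => x s + x' s) := by
  refine ⟨h.smooth.add h'.smooth, ?_⟩
  obtain ⟨k, hk⟩ := h.annihilated
  obtain ⟨k', hk'⟩ := h'.annihilated
  refine ⟨max k k', fun γ hγ z hz => ?_⟩
  rw [lift_zero_add, map_add,
    hk γ (derivedFlag_antitone O V (le_max_left k k') hγ) z hz,
    hk' γ (derivedFlag_antitone O V (le_max_right k k') hγ) z hz, add_zero]

theorem smul (h : IsCharacteristic O O' V I 0 x) {c : ℝ → ℝ} (hc : ContDiffOn ℝ ∞ c I) :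
    IsCharacteristic O O' V I 0 (fun s => c s • x s) := by
  refine ⟨hc.smul h.smooth, ?_⟩
  obtain ⟨k, hk⟩ := h.annihilated
  refine ⟨k, fun γ hγ z hz => ?_⟩
  rw [lift_zero_smul, map_smul, hk γ hγ z hz, smul_zero]

/-- Bracketing costs one step of the derived flag, hence the level `max k k' + 1`. Since only
finitely many brackets are taken, the final element of the flag annihilates all of them. -/
theorem bracket (h : IsCharacteristic O O' V I b x) (h' : IsCharacteristic O O' V I b' x')
    (hO : O' ⊆ O) (hO' : IsOpen O') (hIo : IsOpen I) (hI : ∀ z ∈ O', z.1 0 ∈ I) :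
    IsCharacteristic O O' V I 0
      (fun s => motionBracket (x s) (x' s) + b 0 • deriv x' s - b' 0 • deriv x s) := by
  have hd : ∀ {x : ℝ → Motion}, ContDiffOn ℝ ∞ x I → ContDiffOn ℝ ∞ (deriv x) I := fun hx =>
    hx.deriv_of_isOpen hIo (by simp)
  have hda : ∀ {x : ℝ → Motion}, ContDiffOn ℝ ∞ x I → ∀ z ∈ O', DifferentiableAt ℝ x (z.1 0) :=
    fun hx z hz => (hx.contDiffAt (hIo.mem_nhds (hI z hz))).differentiableAt (by simp)
  refine ⟨?_, ?_⟩
  · have hb : ContDiffOn ℝ ∞ (fun s => motionBracket (x s) (x' s)) I := by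
      have e : ∀ i, ContDiffOn ℝ ∞ (fun s => x s i) I := contDiffOn_pi.1 h.smooth
      have e' : ∀ i, ContDiffOn ℝ ∞ (fun s => x' s i) I := contDiffOn_pi.1 h'.smooth
      have h0 := e 0; have h1 := e 1; have h2 := e 2; have h3 := e 3; have h4 := e 4
      have h5 := e 5
      have h0' := e' 0; have h1' := e' 1; have h2' := e' 2; have h3' := e' 3; have h4' := e' 4
      have h5' := e' 5
      rw [contDiffOn_pi]
      intro i
      fin_cases i <;> simp [motionBracket] <;> fun_prop
    exact (hb.add ((hd h'.smooth).const_smul (b 0))).sub ((hd h.smooth).const_smul (b' 0))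
  · obtain ⟨k, hk⟩ := h.annihilated
    obtain ⟨k', hk'⟩ := h'.annihilated
    refine ⟨max k k' + 1, fun γ hγ z hz => ?_⟩
    rw [← lieBracket_lift b b' (hda h.smooth z hz) (hda h'.smooth z hz)]
    exact derivedFlag_lieBracket_eq_zero hO hO'
      (fun z hz => differentiableAt_lift b (hda h.smooth z hz))
      (fun z hz => differentiableAt_lift b' (hda h'.smooth z hz))
      (fun γ hγ => hk γ (derivedFlag_antitone O V (le_max_left k k') hγ))
      (fun γ hγ => hk' γ (derivedFlag_antitone O V (le_max_right k k') hγ)) γ hγ z hz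

/-- The final element of the derived flag annihilates characteristic vector fields. -/
theorem apply_eq_zero (h : IsCharacteristic O O' V I b x) {z : Total} (hz : z ∈ O')
    {γ : Total →L[ℝ] ℝ} (hγ : γ ∈ derivedLimit O V z) : γ (lift b x z) = 0 := by
  obtain ⟨k, hk⟩ := h.annihilated
  induction hγ using Submodule.span_induction with
  | mem γ h =>
    obtain ⟨δ, hδ, rfl⟩ := h
    exact hk δ (hδ k) z hz
  | zero => rfl
  | add γ γ' _ _ h1 h2 => rw [add_apply, h1, h2, add_zero]
  | smul c γ _ h1 => rw [smul_apply, h1, smul_zero]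

end IsCharacteristic

/-! ### The Lie algebra generated by a characteristic distribution -/

theorem hasDerivAt_vec {x₀ x₁ x₂ x₃ x₄ x₅ : ℝ → ℝ} {d₀ d₁ d₂ d₃ d₄ d₅ s : ℝ}
    (h₀ : HasDerivAt x₀ d₀ s) (h₁ : HasDerivAt x₁ d₁ s) (h₂ : HasDerivAt x₂ d₂ s)
    (h₃ : HasDerivAt x₃ d₃ s) (h₄ : HasDerivAt x₄ d₄ s) (h₅ : HasDerivAt x₅ d₅ s) :
    HasDerivAt (fun s => (![x₀ s, x₁ s, x₂ s, x₃ s, x₄ s, x₅ s] : Motion))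
      ![d₀, d₁, d₂, d₃, d₄, d₅] s := by
  rw [hasDerivAt_pi]
  intro i
  fin_cases i <;> simp <;> assumption

/-- The components of the first of the two vector fields that span the characteristic
distribution, for the metric `f(s)² dv² - ds²`. -/
def charFieldV (f κ : ℝ → ℝ) : ℝ → Motion := fun s => ![f s, 0, 0, deriv f s, 0, -(κ s * f s)]

/-- The components of the second of the two vector fields that span the characteristic
distribution, for the metric `f(s)² dv² - ds²`. -/
def charFieldS (κ : ℝ → ℝ) : ℝ → Motion := fun s => ![0, 1, 0, 0, κ s, 0]

/-- The first coordinate direction of the plane. -/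
abbrev dirS : Plane := EuclideanSpace.single 0 1

/-- The second coordinate direction of the plane. -/
abbrev dirV : Plane := EuclideanSpace.single 1 1

theorem linear_eq_sum (γ : Total →L[ℝ] ℝ) (y : Fin 6 → ℝ) (x : Motion) :
    γ (0, leftInv x y) = x 0 * γ (0, leftInv (Pi.single 0 1) y)
      + x 1 * γ (0, leftInv (Pi.single 1 1) y) + x 2 * γ (0, leftInv (Pi.single 2 1) y)
      + x 3 * γ (0, leftInv (Pi.single 3 1) y) + x 4 * γ (0, leftInv (Pi.single 4 1) y)
      + x 5 * γ (0, leftInv (Pi.single 5 1) y) := by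
  let L : Motion →ₗ[ℝ] ℝ :=
    { toFun := fun x => γ (0, leftInv x y)
      map_add' := fun x x' => by
        rw [leftInv_add, ← map_add]; simp
      map_smul' := fun c x => by
        rw [leftInv_smul, RingHom.id_apply, ← map_smul]; simp }
  have h : L x = ∑ i, x i • L (Pi.single i 1) := by
    rw [LinearMap.pi_apply_eq_sum_univ L x]
    refine Finset.sum_congr rfl fun i _ => ?_
    congr 2
    ext j
    simp [Pi.single_apply, eq_comm]
  simp only [Fin.sum_univ_six, smul_eq_mul] at h
  exact h

/-- If a rank two Pfaffian system annihilates the characteristic distribution and all its iterated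
brackets, then the curvature satisfies a first order equation. -/
theorem curvature_equation {O O' : Set Total} {V : Total → Submodule ℝ (Total →L[ℝ] ℝ)}
    {I : Set ℝ} {f κ : ℝ → ℝ} (hO : O' ⊆ O) (hO' : IsOpen O') (hIo : IsOpen I)
    (hI : ∀ z ∈ O', z.1 0 ∈ I) (hf : ContDiffOn ℝ ∞ f I) (hκ : ContDiffOn ℝ ∞ κ I)
    (hf0 : ∀ s ∈ I, f s ≠ 0) (hκ0 : ∀ s ∈ I, κ s ≠ 0)
    (hf2 : ∀ s ∈ I, deriv (deriv f) s = -(κ s ^ 2 * f s))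
    (hV : IsCharacteristic O O' V I dirV (charFieldV f κ))
    (hS : IsCharacteristic O O' V I dirS (charFieldS κ)) {z : Total} (hz : z ∈ O')
    (hrank : 2 ≤ Module.finrank ℝ (derivedLimit O V z)) :
    deriv κ (z.1 0) * deriv f (z.1 0) = -2 * κ (z.1 0) ^ 3 * f (z.1 0) := by
  have hder : ∀ {g : ℝ → ℝ}, ContDiffOn ℝ ∞ g I → ContDiffOn ℝ ∞ (deriv g) I := fun hg =>
    hg.deriv_of_isOpen hIo (by simp)
  have hda : ∀ {g : ℝ → ℝ}, ContDiffOn ℝ ∞ g I → ∀ s ∈ I, HasDerivAt g (deriv g s) s :=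
    fun hg s hs => ((hg.contDiffAt (hIo.mem_nhds hs)).differentiableAt (by simp)).hasDerivAt
  have hadV : ∀ {x x' : ℝ → Motion}, IsCharacteristic O O' V I 0 x →
      (∀ s ∈ I, x' s = (f s)⁻¹ • motionBracket (charFieldV f κ s) (x s)) →
      IsCharacteristic O O' V I 0 x' := by
    intro x x' h h'
    refine ((hV.bracket h hO hO' hIo hI).smul (hf.inv hf0)).congr hI fun s hs => ?_
    rw [h' s hs]
    simp
  have hadS : ∀ {x x' : ℝ → Motion}, IsCharacteristic O O' V I 0 x →
      (∀ s ∈ I, x' s = motionBracket (charFieldS κ s) (x s) + deriv x s) →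
      IsCharacteristic O O' V I 0 x' := by
    intro x x' h h'
    refine (hS.bracket h hO hO' hIo hI).congr hI fun s hs => ?_
    rw [h' s hs]
    simp
  -- These are the coefficients occurring in the brackets below. The claim is equivalent to m = 0,
  -- that is, to a h = -κ².
  set a : ℝ → ℝ := fun s => deriv κ s / (2 * κ s) with ha
  set h : ℝ → ℝ := fun s => deriv f s / f s with hh
  set m : ℝ → ℝ := fun s => (a s * h s + κ s ^ 2) / (2 * κ s) with hm
  have hκ2 : ∀ s ∈ I, 2 * κ s ≠ 0 := fun s hs => mul_ne_zero two_ne_zero (hκ0 s hs)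
  have hκ2s : ContDiffOn ℝ ∞ (fun s => 2 * κ s) I := contDiffOn_const.mul hκ
  have has : ContDiffOn ℝ ∞ a I := (hder hκ).div hκ2s hκ2
  have hhs : ContDiffOn ℝ ∞ h I := (hder hf).div hf hf0
  have hms : ContDiffOn ℝ ∞ m I := ((has.mul hhs).add (hκ.pow 2)).div hκ2s hκ2
  set n : ℝ → ℝ := fun s => (deriv a s + κ s ^ 2 - a s ^ 2) / (2 * κ s) with hn
  have hns : ContDiffOn ℝ ∞ n I := (((hder has).add (hκ.pow 2)).sub (has.pow 2)).div hκ2s hκ2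
  have ra : ∀ s ∈ I, deriv κ s = 2 * κ s * a s := fun s hs => by
    have := hκ0 s hs
    simp only [ha]; field_simp
  have rh : ∀ s ∈ I, deriv f s = h s * f s := fun s hs => by
    have := hf0 s hs
    simp only [hh]; field_simp
  have rm : ∀ s ∈ I, 2 * κ s * m s = a s * h s + κ s ^ 2 := fun s hs => by
    have := hκ0 s hs
    simp only [hm]; field_simp
  have rn : ∀ s ∈ I, deriv a s = 2 * κ s * n s - κ s ^ 2 + a s ^ 2 := fun s hs => by
    have := hκ0 s hs
    simp only [hn]; field_simp; ring
  clear_value n m h a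
  -- The bracket of the two characteristic fields, divided by 2κf. From here on all fields are
  -- vertical.
  have cc : IsCharacteristic O O' V I 0 (fun s => ![0, 0, 1, -κ s, 0, -a s]) := by
    refine ((hS.bracket hV hO hO' hIo hI).smul ((hκ2s.mul hf).inv fun s hs =>
      mul_ne_zero (hκ2 s hs) (hf0 s hs))).congr hI fun s hs => ?_
    have e : deriv (charFieldV f κ) s = _ := (hasDerivAt_vec (hda hf s hs) (hasDerivAt_const s 0)
      (hasDerivAt_const s 0) (hda (hder hf) s hs) (hasDerivAt_const s 0)
      ((hda hκ s hs).mul (hda hf s hs)).neg).deriv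
    have h1 := hκ0 s hs
    have h2 := hf0 s hs
    have h3 := ra s hs
    have h4 := hf2 s hs
    rw [e]
    ext i
    fin_cases i <;> simp [motionBracket, charFieldV, charFieldS, h3, h4] <;> field_simp <;> ring
  -- Bracketing `cc` with the two characteristic fields produces `c1` and `c2`. The translation
  -- parts of `c2`, `c1`, `cc` are e₁, e₂, e₃, so on the limit system the translation values of a
  -- covector are expressed by its rotation values.
  have c1 : IsCharacteristic O O' V I 0 (fun s => ![0, 1, 0, 0, m s, 0]) := by
    refine ((hadV cc fun s hs => rfl).smul (hκ2s.inv hκ2)).congr hI fun s hs => ?_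
    have h1 := hκ0 s hs
    have h2 := hf0 s hs
    have h3 := rh s hs
    have h4 := rm s hs
    ext i
    fin_cases i <;> simp [motionBracket, charFieldV, h3] <;> field_simp <;>
      first | ring1 | linear_combination h4
  have c2 : IsCharacteristic O O' V I 0 (fun s => ![1, 0, 0, -a s, 0, -n s]) := by
    refine (((hadS cc fun s hs => rfl).add (cc.smul has.neg)).smul (hκ2s.inv hκ2)).congr hI
      fun s hs => ?_
    have e : deriv (fun s => (![0, 0, 1, -κ s, 0, -a s] : Motion)) s = _ :=
      (hasDerivAt_vec (hasDerivAt_const s 0) (hasDerivAt_const s 0)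
      (hasDerivAt_const s 1) (hda hκ s hs).neg (hasDerivAt_const s 0) (hda has s hs).neg).deriv
    have h1 := hκ0 s hs
    have h3 := ra s hs
    have h4 := rn s hs
    rw [e]
    ext i
    fin_cases i <;> simp [motionBracket, charFieldS, h3, h4] <;> field_simp <;> ring
  -- The next generation of brackets. Multiples of `c2` and `cc` have been added to `w1` so that it
  -- is a pure rotation; the translation parts of `w2`, `w4`, `w5` are removed pointwise later.
  have w1 : IsCharacteristic O O' V I 0 (fun s => ![0, 0, 0, 2 * κ s * (m s - κ s), 0,
      h s * (n s - m s) - a s * (m s + κ s)]) := by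
    refine (((hadV c1 fun s hs => rfl).add (c2.smul hhs.neg)).add (cc.smul (hms.add hκ))).congr hI
      fun s hs => ?_
    have h2 := hf0 s hs
    have h3 := rh s hs
    have h4 := rm s hs
    ext i
    fin_cases i <;> simp [motionBracket, charFieldV, h3] <;> field_simp <;>
      first | ring1 | linear_combination h4
  have w2 : IsCharacteristic O O' V I 0
      (fun s => ![0, a s + h s, 0, 0, n s * h s + κ s * a s, 0]) := by
    refine hadV c2 fun s hs => ?_
    have h2 := hf0 s hs
    have h3 := rh s hs
    ext i
    fin_cases i <;> simp [motionBracket, charFieldV, h3] <;> field_simp <;> ring1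
  have w4 : IsCharacteristic O O' V I 0 (fun s => ![a s, 0, n s + κ s,
      -(deriv a s + κ s * n s), 0, -(deriv n s + κ s * a s)]) := by
    refine hadS c2 fun s hs => ?_
    have e : deriv (fun s => (![1, 0, 0, -a s, 0, -n s] : Motion)) s = _ :=
      (hasDerivAt_vec (hasDerivAt_const _ 1) (hasDerivAt_const _ 0)
      (hasDerivAt_const _ 0) (hda has _ hs).neg (hasDerivAt_const _ 0) (hda hns _ hs).neg).deriv
    rw [e]
    ext i
    fin_cases i <;> simp [motionBracket, charFieldS] <;> ring1
  have w5 : IsCharacteristic O O' V I 0 (fun s => ![0, -(2 * κ s * (m s - κ s)), 0, 0,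
      -(h s * (h s * (n s - m s) - a s * (m s + κ s))) - κ s * (2 * κ s * (m s - κ s)), 0]) := by
    refine hadV w1 fun s hs => ?_
    have h2 := hf0 s hs
    have h3 := rh s hs
    ext i
    fin_cases i <;> simp [motionBracket, charFieldV, h3] <;> field_simp <;> ring1
  have hs := hI z hz
  have k0 := hκ0 _ hs
  have f0 := hf0 _ hs
  have ra := ra _ hs
  have rh := rh _ hs
  have rm := rm _ hs
  have rn := rn _ hs
  let l : Fin 6 → (Total →L[ℝ] ℝ) → ℝ := fun i γ => γ (0, leftInv (Pi.single i 1) z.2)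
  have lin : ∀ {x : ℝ → Motion}, IsCharacteristic O O' V I 0 x → ∀ γ ∈ derivedLimit O V z,
      x (z.1 0) 0 * l 0 γ + x (z.1 0) 1 * l 1 γ + x (z.1 0) 2 * l 2 γ + x (z.1 0) 3 * l 3 γ
        + x (z.1 0) 4 * l 4 γ + x (z.1 0) 5 * l 5 γ = 0 := fun hx γ hγ => by
    rw [← linear_eq_sum]
    exact hx.apply_eq_zero hz hγ
  have Ec := lin cc
  have E1 := lin c1
  have E2 := lin c2
  have F1 := lin w1
  have F2 := lin w2
  have F4 := lin w4
  have F5 := lin w5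
  simp at Ec E1 E2 F1 F2 F4 F5
  -- a covector is determined by its values on the rotations
  have hzero : ∀ γ ∈ derivedLimit O V z, l 3 γ = 0 → l 4 γ = 0 → l 5 γ = 0 → γ = 0 := by
    intro γ hγ h3 h4 h5
    have h0 := E2 γ hγ
    have h1 := E1 γ hγ
    have h2 := Ec γ hγ
    rw [h3, h5] at h0 h2
    rw [h4] at h1
    have hL : ∀ w, γ (0, w) = 0 := by
      intro w
      obtain ⟨x, rfl⟩ := leftInv_surjective z.2 w
      rw [linear_eq_sum]
      change x 0 * l 0 γ + x 1 * l 1 γ + x 2 * l 2 γ + x 3 * l 3 γ + x 4 * l 4 γ + x 5 * l 5 γ = 0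
      rw [h3, h4, h5]
      linear_combination x 0 * h0 + x 1 * h1 + x 2 * h2
    have hV1 := hV.apply_eq_zero hz hγ
    have hS1 := hS.apply_eq_zero hz hγ
    have split : ∀ (u : Plane) (w : Fin 6 → ℝ), γ (u, w) = γ (u, 0) := fun u w => by
      have : ((u, w) : Total) = (u, 0) + (0, w) := by simp
      rw [this, map_add, hL, add_zero]
    rw [lift, split] at hV1 hS1
    ext u
    · have hu : ((u, 0) : Total) = u 0 • (dirS, 0) + u 1 • (dirV, 0) := by
        refine Prod.ext ?_ (by simp)
        ext i
        fin_cases i <;> simp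
      change γ (u, 0) = 0
      rw [hu, map_add, map_smul, map_smul, hV1, hS1]
      simp
    · exact hL _
  -- If l₄ vanishes on the limit system, then (l₃, l₅) is injective on it. By the rank assumption it
  -- is an isomorphism onto ℝ², so no nontrivial linear relation between l₃ and l₅ can hold.
  have hpair : (∀ γ ∈ derivedLimit O V z, l 4 γ = 0) → ∀ p q : ℝ,
      (∀ γ ∈ derivedLimit O V z, p * l 3 γ + q * l 5 γ = 0) → p = 0 ∧ q = 0 := by
    intro h4 p q hpq
    let Λ : derivedLimit O V z →ₗ[ℝ] (Fin 2 → ℝ) :=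
      { toFun := fun γ => ![l 3 γ, l 5 γ]
        map_add' := fun γ γ' => by ext i; fin_cases i <;> simp [l]
        map_smul' := fun c γ => by ext i; fin_cases i <;> simp [l] }
    have hinj : Function.Injective Λ := by
      rw [injective_iff_map_eq_zero]
      intro γ hγ
      exact Subtype.ext (hzero γ γ.2 (congrFun hγ 0) (h4 γ γ.2) (congrFun hγ 1))
    have hle := LinearMap.finrank_le_finrank_of_injective hinj
    rw [Module.finrank_fin_fun] at hle
    have hdim : Module.finrank ℝ (derivedLimit O V z) = Module.finrank ℝ (Fin 2 → ℝ) := by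
      rw [Module.finrank_fin_fun]; exact le_antisymm hle hrank
    have hsurj : Function.Surjective Λ := by
      have : FiniteDimensional ℝ (Total →L[ℝ] ℝ) := inferInstance
      have : FiniteDimensional ℝ (derivedLimit O V z) := inferInstance
      have := @LinearMap.injective_iff_surjective_of_finrank_eq_finrank ℝ (derivedLimit O V z) _ _ _
        (Fin 2 → ℝ) _ _ _ _ hdim Λ
      exact this.1 hinj
    obtain ⟨γ, hγ⟩ := hsurj ![1, 0]
    obtain ⟨γ', hγ'⟩ := hsurj ![0, 1]
    have g0 : l 3 γ = 1 := congrFun hγ 0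
    have g1 : l 5 γ = 0 := congrFun hγ 1
    have g0' : l 3 γ' = 0 := congrFun hγ' 0
    have g1' : l 5 γ' = 1 := congrFun hγ' 1
    have p1 := hpq γ γ.2
    have p2 := hpq γ' γ'.2
    rw [g0, g1] at p1
    rw [g0', g1'] at p2
    exact ⟨by linarith, by linarith⟩
  rw [rn] at F4
  rw [ra, rh]
  generalize deriv n (z.1 0) = n' at *
  generalize a (z.1 0) = a at *
  generalize h (z.1 0) = h at *
  generalize m (z.1 0) = m at *
  generalize n (z.1 0) = n at *
  generalize κ (z.1 0) = k at *
  have G1 := fun (h4 : ∀ γ ∈ derivedLimit O V z, l 4 γ = 0) => hpair h4 _ _ F1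
  -- With translations eliminated, `w2` constrains only l₄, while `w1` and `w4` relate l₃ and l₅.
  have G2 : ∀ γ ∈ derivedLimit O V z, (h * (n - m) + a * (k - m)) * l 4 γ = 0 := fun γ hγ => by
    linear_combination F2 γ hγ - (a + h) * E1 γ hγ
  have G4 := fun (h4 : ∀ γ ∈ derivedLimit O V z, l 4 γ = 0) =>
    hpair h4 (-2 * k * (n - k)) (2 * a * n - n') fun γ hγ => by
      linear_combination F4 γ hγ - a * E2 γ hγ - (n + k) * Ec γ hγ
  -- If this factor were nonzero, l₄ would vanish; the relations from `w1` and `w4` would then give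
  -- m = n = κ and a = 0, which makes the factor zero after all.
  have J2 : h * (n - m) + a * (k - m) = 0 := by
    by_contra hne
    have h4 : ∀ γ ∈ derivedLimit O V z, l 4 γ = 0 := fun γ hγ =>
      (mul_eq_zero.1 (G2 γ hγ)).resolve_left hne
    obtain ⟨p, q⟩ := G1 h4
    obtain ⟨p', -⟩ := G4 h4
    have hmk : m = k := by
      rcases mul_eq_zero.1 p with h | h
      · exact absurd h (by simpa using k0)
      · linarith
    have hnk : n = k := by
      rcases mul_eq_zero.1 p' with h | h
      · exact absurd h (by simpa using k0)
      · linarith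
    rw [hmk, hnk] at q
    have ha : a = 0 := by
      have : k * a = 0 := by linear_combination (-1 / 2) * q
      exact (mul_eq_zero.1 this).resolve_left k0
    apply hne
    rw [hmk, hnk, ha]; ring
  -- Modulo `J2` and `rm` the relation from `w5` is 2κm² l₄ = 0. If m ≠ 0, then l₄ = 0, hence m = κ
  -- and a = 0, and 2κm = ah + κ² gives κ = 0.
  have hm : m = 0 := by
    by_contra hne
    have h4 : ∀ γ ∈ derivedLimit O V z, l 4 γ = 0 := fun γ hγ => by
      have : (2 * k * m ^ 2) * l 4 γ = 0 := by
        linear_combination F5 γ hγ + 2 * k * (m - k) * E1 γ hγ + (h * l 4 γ) * J2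
          + 2 * k * l 4 γ * rm
      exact (mul_eq_zero.1 this).resolve_left
        (mul_ne_zero (mul_ne_zero two_ne_zero k0) (pow_ne_zero 2 hne))
    obtain ⟨p, q⟩ := G1 h4
    have hmk : m = k := by
      rcases mul_eq_zero.1 p with h | h
      · exact absurd h (by simpa using k0)
      · linarith
    have ha : a = 0 := by
      have : k * a = 0 := by linear_combination (1 / 2) * J2 - (1 / 2) * q
      exact (mul_eq_zero.1 this).resolve_left k0
    rw [hmk, ha] at rm
    exact k0 (pow_eq_zero_iff two_ne_zero |>.1 (by linear_combination rm))
  rw [hm] at rm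
  linear_combination -2 * k * f (z.1 0) * rm

/-! ### Decompositions of the isometric embedding system -/

section Coframe

variable {E : Type*} [NormedAddCommGroup E] [NormedSpace ℝ E]

theorem card_coframe [FiniteDimensional ℝ E] {ι : Type*} [Fintype ι] {φ : ι → E →L[ℝ] ℝ}
    (hli : LinearIndependent ℝ φ) (hspan : Submodule.span ℝ (Set.range φ) = ⊤) :
    Module.finrank ℝ E = Fintype.card ι := by
  have h1 := finrank_span_eq_card hli
  rw [hspan, finrank_top] at h1
  rw [← h1, ← Subspace.dual_finrank_eq (K := ℝ) (V := E)]
  exact (LinearMap.toContinuousLinearMap (𝕜 := ℝ) (E := E) (F' := ℝ)).finrank_eq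

/-- A spanning family of covectors separates vectors, and the dimensions agree. This supplies dual
vectors for the coframe of a decomposition. -/
theorem coframe_surjective [FiniteDimensional ℝ E] {ι : Type*} [Fintype ι] {φ : ι → E →L[ℝ] ℝ}
    (hli : LinearIndependent ℝ φ) (hspan : Submodule.span ℝ (Set.range φ) = ⊤) (c : ι → ℝ) :
    ∃ v, ∀ i, φ i v = c i := by
  let L : E →ₗ[ℝ] (ι → ℝ) := LinearMap.pi fun i => (φ i : E →ₗ[ℝ] ℝ)
  have hinj : Function.Injective L := by
    rw [injective_iff_map_eq_zero]
    intro v hv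
    have hv' : ∀ i, φ i v = 0 := fun i => congrFun hv i
    refine (SeparatingDual.eq_zero_iff_forall_dual_eq_zero (R := ℝ) v).2 fun g => ?_
    have hg : g ∈ Submodule.span ℝ (Set.range φ) := by rw [hspan]; trivial
    induction hg using Submodule.span_induction with
    | mem γ h => obtain ⟨i, rfl⟩ := h; exact hv' i
    | zero => rfl
    | add γ γ' _ _ h1 h2 => rw [add_apply, h1, h2, add_zero]
    | smul c γ _ h1 => rw [smul_apply, h1, smul_zero]
  have hdim : Module.finrank ℝ E = Module.finrank ℝ (ι → ℝ) := by
    rw [card_coframe hli hspan, Module.finrank_fintype_fun_eq_card]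
  obtain ⟨v, hv⟩ := (LinearMap.injective_iff_surjective_of_finrank_eq_finrank hdim).1 hinj c
  exact ⟨v, fun i => congrFun hv i⟩

theorem mem_idealOne {O : Set E} {S : Set (OneForm E)} {α : OneForm E} (h : α ∈ S) :
    α ∈ idealOne O S :=
  ⟨1, fun _ _ => 1, fun _ => α, fun _ => ⟨contDiffOn_const, h⟩, fun x _ => by simp⟩

theorem mem_idealTwo {O : Set E} {S : Set (OneForm E)} {T : Set (TwoForm E)} {Ω : TwoForm E}
    (h : Ω ∈ T) : Ω ∈ idealTwo O S T :=
  ⟨0, 1, fun _ _ => 0, fun _ _ => 0, fun _ _ => 1, fun _ => Ω, fun i => i.elim0,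
    fun _ => ⟨contDiffOn_const, h⟩, fun x _ v w => by simp⟩

theorem span_of_mem_idealOne {O : Set E} {S : Set (OneForm E)} {α : OneForm E}
    (h : α ∈ idealOne O S) {x : E} (hx : x ∈ O) :
    α x ∈ Submodule.span ℝ ((fun σ => σ x) '' S) := by
  obtain ⟨n, f, σ, hσ, hsum⟩ := h
  rw [hsum x hx]
  exact Submodule.sum_mem _ fun i _ => Submodule.smul_mem _ _
    (Submodule.subset_span ⟨σ i, (hσ i).2, rfl⟩)

theorem span_eq_of_idealOne_eq {O : Set E} {m n : ℕ} {θ : Fin m → OneForm E} {θ' : Fin n → OneForm E}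
    (h : idealOne O (Set.range θ) = idealOne O (Set.range θ')) {x : E} (hx : x ∈ O) :
    Submodule.span ℝ (Set.range fun i => θ i x) = Submodule.span ℝ (Set.range fun i => θ' i x) := by
  have aux : ∀ {m n : ℕ} {θ : Fin m → OneForm E} {θ' : Fin n → OneForm E},
      idealOne O (Set.range θ) = idealOne O (Set.range θ') →
      Submodule.span ℝ (Set.range fun i => θ i x) ≤
        Submodule.span ℝ (Set.range fun i => θ' i x) := by
    intro m n θ θ' h
    rw [Submodule.span_le]
    rintro _ ⟨i, rfl⟩
    have := span_of_mem_idealOne (h ▸ mem_idealOne (O := O) (Set.mem_range_self i)) hx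
    rwa [← Set.range_comp] at this
  exact le_antisymm (aux h) (aux h.symm)

/-- On vectors annihilated by the 1-forms in `S`, a member of the ideal generated by `S` and `T`
is a combination of members of `T`. -/
theorem combination_of_mem_idealTwo {O : Set E} {S : Set (OneForm E)} {T : Set (TwoForm E)}
    {Ω : TwoForm E} (h : Ω ∈ idealTwo O S T) {x : E} (hx : x ∈ O) :
    ∃ (n : ℕ) (c : Fin n → ℝ) (Θ : Fin n → TwoForm E), (∀ j, Θ j ∈ T) ∧
      ∀ v w, (∀ σ ∈ S, σ x v = 0) → (∀ σ ∈ S, σ x w = 0) → Ω x v w = ∑ j, c j * Θ j x v w := by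
  obtain ⟨m, n, α, σ, f, Θ, hα, hf, hsum⟩ := h
  refine ⟨n, fun j => f j x, Θ, fun j => (hf j).2, fun v w hv hw => ?_⟩
  rw [hsum x hx]
  have e1 : ∀ i, wedge (α i) (σ i) x v w = 0 := fun i => by
    simp [wedge, hv _ (hα i).2, hw _ (hα i).2]
  simp [e1]

/-- Two 1-forms have only one independent wedge product; this is where the value 2 of p and q
matters. -/
theorem multiple_of_mem_wedgeSquare {O : Set E} {σ : Fin 2 → OneForm E} {Ω : TwoForm E}
    (h : Ω ∈ wedgeSquare O (Set.range σ)) {x : E} (hx : x ∈ O) :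
    ∃ g : ℝ, ∀ v w, Ω x v w = g * wedge (σ 0) (σ 1) x v w := by
  obtain ⟨n, f, τ, τ', hτ, hsum⟩ := h
  have key : ∀ i, ∃ g : ℝ, ∀ v w, f i x * wedge (τ i) (τ' i) x v w
      = g * wedge (σ 0) (σ 1) x v w := by
    intro i
    obtain ⟨-, ⟨a, ha⟩, ⟨b, hb⟩⟩ := hτ i
    rw [← ha, ← hb]
    fin_cases a <;> fin_cases b
    · exact ⟨0, fun v w => by simp [wedge]; ring_nf; simp⟩
    · exact ⟨f i x, fun v w => rfl⟩
    · exact ⟨-f i x, fun v w => by simp [wedge]; ring⟩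
    · exact ⟨0, fun v w => by simp [wedge]; ring_nf; simp⟩
  choose g hg using key
  refine ⟨∑ i, g i, fun v w => ?_⟩
  rw [hsum x hx, Finset.sum_mul]
  exact Finset.sum_congr rfl fun i _ => hg i v w

theorem extD_combination (γ : OneForm E) (x : E) (a b c d : ℝ) (v₁ v₂ v₃ v₄ w : E) :
    extD γ x (a • v₁ + b • v₂ + c • v₃ + d • v₄) w =
      a * extD γ x v₁ w + b * extD γ x v₂ w + c * extD γ x v₃ w + d * extD γ x v₄ w := by
  simp [extD]
  ring

theorem extD_swap (γ : OneForm E) (x v w : E) : extD γ x v w = - extD γ x w v := by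
  simp [extD]

theorem extD_self (γ : OneForm E) (x v : E) : extD γ x v v = 0 := by
  simp [extD]

end Coframe

/-- The forms `f(s) dv`, `ds` and `f'(s) dv` of the metric `f(s)² dv² - ds²`. -/
def etaV (f : ℝ → ℝ) : OneForm Plane := fun x => f (x 0) • EuclideanSpace.proj (1 : Fin 2)

/-- The form `ds`. -/
def etaS : OneForm Plane := fun _ => EuclideanSpace.proj (0 : Fin 2)

/-- The generators of the isometric embedding system of the metric `f(s)² dv² - ds²`. -/
def warpedForms (f : ℝ → ℝ) : Fin 4 → OneForm Total :=
  embeddingForms (etaV f) etaS (etaV (deriv f)) point frame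

theorem warpedForms_lift (f : ℝ → ℝ) (a : Fin 4) (b : Plane) (x : ℝ → Motion) (z : Total) :
    warpedForms f a z (lift b x z) = ![x (z.1 0) 2, x (z.1 0) 0 - f (z.1 0) * b 1,
      x (z.1 0) 1 - b 0, x (z.1 0) 3 - deriv f (z.1 0) * b 1] a := by
  have h1 := fun i => canonicalForm_leftInv i (x (z.1 0)) z.2
  have h2 := connectionForm_leftInv 0 1 (x (z.1 0)) z.2
  fin_cases a <;> simp [warpedForms, embeddingForms, pullRight, pullLeft, lift, h1, h2, hat, etaV,
    etaS]

theorem contDiff_mink {v : (Fin 6 → ℝ) → Fin 3 → ℝ} (hv : ContDiff ℝ ∞ v) :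
    ContDiff ℝ ∞ (fun y => mink (v y)) := by
  have h : ∀ i, ContDiff ℝ ∞ (fun y => v y i) := contDiff_pi.1 hv
  unfold mink
  exact ContDiff.sum fun i _ => (contDiff_const.mul (h i)).smul contDiff_const

theorem contDiff_canonicalForm (i : Fin 3) : ContDiff ℝ ∞ (canonicalForm point frame i) :=
  ((contDiff_mink (contDiff_frame i)).clm_comp
    (contDiff_point.fderiv_right (m := ∞) (by simp))).const_smul _

theorem contDiff_connectionForm (i j : Fin 3) : ContDiff ℝ ∞ (connectionForm frame i j) :=
  ((contDiff_mink (contDiff_frame i)).clm_comp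
    ((contDiff_frame j).fderiv_right (m := ∞) (by simp))).const_smul _

theorem contDiffOn_etaV {f : ℝ → ℝ} {I : Set ℝ} (hf : ContDiffOn ℝ ∞ f I) {D : Set Plane}
    (hD : ∀ x ∈ D, x 0 ∈ I) : ContDiffOn ℝ ∞ (etaV f) D := by
  have h0 : ContDiff ℝ ∞ (fun x : Plane => x 0) := by fun_prop
  exact (hf.comp h0.contDiffOn hD).smul contDiffOn_const

theorem contDiffOn_warpedForms {f : ℝ → ℝ} {I : Set ℝ} (hI : IsOpen I) (hf : ContDiffOn ℝ ∞ f I)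
    (a : Fin 4) : ContDiffOn ℝ ∞ (warpedForms f a) {z | z.1 0 ∈ I} := by
  have hr : ∀ {α : OneForm (Fin 6 → ℝ)}, ContDiff ℝ ∞ α →
      ContDiffOn ℝ ∞ (pullRight α) {z | z.1 0 ∈ I} := fun hα =>
    ((hα.comp contDiff_snd).clm_comp contDiff_const).contDiffOn
  have hl : ∀ {α : OneForm Plane}, ContDiffOn ℝ ∞ α {x | x 0 ∈ I} →
      ContDiffOn ℝ ∞ (pullLeft α) {z | z.1 0 ∈ I} := fun hα =>
    (hα.comp contDiff_fst.contDiffOn (fun z hz => hz)).clm_comp contDiffOn_const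
  fin_cases a
  · exact hr (contDiff_canonicalForm 2)
  · exact (hr (contDiff_canonicalForm 0)).sub (hl (contDiffOn_etaV hf fun x hx => hx))
  · exact (hr (contDiff_canonicalForm 1)).sub (hl contDiffOn_const)
  · exact (hr (contDiff_connectionForm 0 1)).sub
      (hl (contDiffOn_etaV (hf.deriv_of_isOpen hI (by simp)) fun x hx => hx))

theorem linearIndependent_warpedForms (f : ℝ → ℝ) (z : Total) :
    LinearIndependent ℝ (fun a => warpedForms f a z) := by
  rw [Fintype.linearIndependent_iff]
  intro c hc
  have h : ∀ x : Motion, ∑ a, c a * warpedForms f a z (lift 0 (fun _ => x) z) = 0 := fun x => by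
    have := congrArg (fun L : Total →L[ℝ] ℝ => L (lift 0 (fun _ => x) z)) hc
    simpa using this
  simp only [warpedForms_lift, Fin.sum_univ_four] at h
  -- Each of these four left invariant vectors is seen by exactly one generator.
  have h0 := h ![0, 0, 1, 0, 0, 0]
  have h1 := h ![1, 0, 0, 0, 0, 0]
  have h2 := h ![0, 1, 0, 0, 0, 0]
  have h3 := h ![0, 0, 0, 1, 0, 0]
  simp at h0 h1 h2 h3
  intro a
  fin_cases a <;> assumption

/-- A basis of the vectors annihilated by the 1-forms of the system: the horizontal lifts of the
coordinate directions. -/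
def horizontalV (f : ℝ → ℝ) : Total → Total :=
  lift dirV fun s => ![f s, 0, 0, deriv f s, 0, 0]

/-- The horizontal lift of the first coordinate direction. -/
def horizontalS : Total → Total := lift dirS fun _ => ![0, 1, 0, 0, 0, 0]

/-- The left invariant vector field that boosts the plane `13`. -/
def vertical₁ : Total → Total := lift 0 fun _ => ![0, 0, 0, 0, 1, 0]

/-- The left invariant vector field that rotates the plane `23`. -/
def vertical₂ : Total → Total := lift 0 fun _ => ![0, 0, 0, 0, 0, 1]

/-- The four equations determine ω¹, ω², ω³, ω¹₂ from the plane component; only ω³₁ and ω³₂ remain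
free. -/
theorem exists_combination_of_annihilated {f : ℝ → ℝ} {z v : Total}
    (hv : ∀ a, warpedForms f a z v = 0) :
    ∃ b₁ b₂ p q : ℝ, v = b₁ • horizontalV f z + b₂ • horizontalS z + p • vertical₁ z
      + q • vertical₂ z := by
  obtain ⟨b, w⟩ := v
  obtain ⟨x, rfl⟩ := leftInv_surjective z.2 w
  have h : ∀ a, warpedForms f a z (lift b (fun _ => x) z) = 0 := hv
  simp only [warpedForms_lift] at h
  have h0 := h 0
  have h1 := h 1
  have h2 := h 2
  have h3 := h 3
  simp at h0 h1 h2 h3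
  refine ⟨b 1, b 0, x 4, x 5, ?_⟩
  simp only [horizontalV, horizontalS, vertical₁, vertical₂, lift, Prod.smul_mk, Prod.mk_add_mk,
    ← leftInv_smul, ← leftInv_add]
  refine Prod.ext ?_ ?_
  · ext i
    fin_cases i <;> simp
  · refine congrArg (fun x => leftInv x z.2) ?_
    ext i
    fin_cases i <;> simp <;> linarith

theorem warpedForms_horizontal (f : ℝ → ℝ) (z : Total) (a : Fin 4) :
    warpedForms f a z (horizontalV f z) = 0 ∧ warpedForms f a z (horizontalS z) = 0 ∧
      warpedForms f a z (vertical₁ z) = 0 ∧ warpedForms f a z (vertical₂ z) = 0 := by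
  simp only [horizontalV, horizontalS, vertical₁, vertical₂, warpedForms_lift]
  fin_cases a <;> simp

/-- The exterior derivative of a generator on two lifted vector fields annihilated by it. -/
theorem extD_warpedForms_lift {f : ℝ → ℝ} {I : Set ℝ} (hI : IsOpen I) (hf : ContDiffOn ℝ ∞ f I)
    {z : Total} (hz : z.1 0 ∈ I) (a : Fin 4) (b b' : Plane) {x x' : ℝ → Motion}
    (hx : ContDiffOn ℝ ∞ x I) (hx' : ContDiffOn ℝ ∞ x' I)
    (h : ∀ z, warpedForms f a z (lift b x z) = 0) (h' : ∀ z, warpedForms f a z (lift b' x' z) = 0) :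
    extD (warpedForms f a) z (lift b x z) (lift b' x' z) = - warpedForms f a z (lift 0
      (fun s => motionBracket (x s) (x' s) + b 0 • deriv x' s - b' 0 • deriv x s) z) := by
  have h0 : Continuous (fun z : Total => z.1 0) := by fun_prop
  have hd : ∀ {x : ℝ → Motion}, ContDiffOn ℝ ∞ x I → DifferentiableAt ℝ x (z.1 0) := fun hx =>
    (hx.contDiffAt (hI.mem_nhds hz)).differentiableAt (by simp)
  rw [← lieBracket_lift b b' (hd hx) (hd hx')]
  exact extD_eq_neg_lieBracket
    (((contDiffOn_warpedForms hI hf a).contDiffAt ((hI.preimage h0).mem_nhds hz)).differentiableAt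
      (by simp))
    (differentiableAt_lift b (hd hx)) (differentiableAt_lift b' (hd hx'))
    (Filter.Eventually.of_forall h) (Filter.Eventually.of_forall h')

/-- The exterior derivatives of the generators on the vectors that they annihilate. -/
theorem extD_warpedForms_basis {f : ℝ → ℝ} {I : Set ℝ} (hI : IsOpen I) (hf : ContDiffOn ℝ ∞ f I)
    {z : Total} (hz : z.1 0 ∈ I) (a : Fin 4) :
    extD (warpedForms f a) z (horizontalV f z) (horizontalS z)
        = ![0, 0, 0, deriv (deriv f) (z.1 0)] a ∧
      extD (warpedForms f a) z (horizontalV f z) (vertical₁ z) = ![f (z.1 0), 0, 0, 0] a ∧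
      extD (warpedForms f a) z (horizontalV f z) (vertical₂ z) = 0 ∧
      extD (warpedForms f a) z (horizontalS z) (vertical₁ z) = 0 ∧
      extD (warpedForms f a) z (horizontalS z) (vertical₂ z) = ![1, 0, 0, 0] a ∧
      extD (warpedForms f a) z (vertical₁ z) (vertical₂ z) = ![0, 0, 0, -1] a := by
  have hf' : ContDiffOn ℝ ∞ (deriv f) I := hf.deriv_of_isOpen hI (by simp)
  have hV : ContDiffOn ℝ ∞ (fun s => (![f s, 0, 0, deriv f s, 0, 0] : Motion)) I := by
    rw [contDiffOn_pi]
    intro i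
    fin_cases i <;> simp <;> first | exact contDiffOn_const | assumption
  have hda : ∀ {g : ℝ → ℝ}, ContDiffOn ℝ ∞ g I → HasDerivAt g (deriv g (z.1 0)) (z.1 0) :=
    fun hg => ((hg.contDiffAt (hI.mem_nhds hz)).differentiableAt (by simp)).hasDerivAt
  have e : deriv (fun s => (![f s, 0, 0, deriv f s, 0, 0] : Motion)) (z.1 0) = _ :=
    (hasDerivAt_vec (hda hf) (hasDerivAt_const _ 0) (hasDerivAt_const _ 0) (hda hf')
      (hasDerivAt_const _ 0) (hasDerivAt_const _ 0)).deriv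
  have w1 := fun z => (warpedForms_horizontal f z a).1
  have w2 := fun z => (warpedForms_horizontal f z a).2.1
  have w3 := fun z => (warpedForms_horizontal f z a).2.2.1
  have w4 := fun z => (warpedForms_horizontal f z a).2.2.2
  refine ⟨?_, ?_, ?_, ?_, ?_, ?_⟩
  · refine (extD_warpedForms_lift hI hf hz a dirV dirS hV contDiffOn_const w1 w2).trans ?_
    rw [warpedForms_lift, e]
    fin_cases a <;> simp [motionBracket]
  · refine (extD_warpedForms_lift hI hf hz a dirV 0 hV contDiffOn_const w1 w3).trans ?_
    rw [warpedForms_lift]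
    fin_cases a <;> simp [motionBracket]
  · refine (extD_warpedForms_lift hI hf hz a dirV 0 hV contDiffOn_const w1 w4).trans ?_
    rw [warpedForms_lift]
    fin_cases a <;> simp [motionBracket]
  · refine (extD_warpedForms_lift hI hf hz a dirS 0 contDiffOn_const contDiffOn_const w2 w3).trans ?_
    rw [warpedForms_lift]
    fin_cases a <;> simp [motionBracket]
  · refine (extD_warpedForms_lift hI hf hz a dirS 0 contDiffOn_const contDiffOn_const w2 w4).trans ?_
    rw [warpedForms_lift]
    fin_cases a <;> simp [motionBracket]
  · refine (extD_warpedForms_lift hI hf hz a 0 0 contDiffOn_const contDiffOn_const w3 w4).trans ?_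
    rw [warpedForms_lift]
    fin_cases a <;> simp [motionBracket]

/-- The vectors annihilated by the 1-forms of the system. -/
def Annihilated (f : ℝ → ℝ) (z v : Total) : Prop := ∀ a, warpedForms f a z v = 0

/-- On annihilated vectors, the exterior derivatives of the generators are combinations of two of
them. -/
theorem extD_warpedForms_eq_zero {f : ℝ → ℝ} {I : Set ℝ} (hI : IsOpen I) (hf : ContDiffOn ℝ ∞ f I)
    {z : Total} (hz : z.1 0 ∈ I) {a : Fin 4} (ha : a = 1 ∨ a = 2) {v w : Total}
    (hv : Annihilated f z v) (hw : Annihilated f z w) : extD (warpedForms f a) z v w = 0 := by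
  obtain ⟨h1, h2, h3, h4, h5, h6⟩ := extD_warpedForms_basis hI hf hz a
  obtain ⟨b₁, b₂, p, q, rfl⟩ := exists_combination_of_annihilated hv
  obtain ⟨b₁', b₂', p', q', rfl⟩ := exists_combination_of_annihilated hw
  have s1 := extD_swap (warpedForms f a) z (horizontalV f z) (horizontalS z)
  have s2 := extD_swap (warpedForms f a) z (horizontalV f z) (vertical₁ z)
  have s3 := extD_swap (warpedForms f a) z (horizontalV f z) (vertical₂ z)
  have s4 := extD_swap (warpedForms f a) z (horizontalS z) (vertical₁ z)
  have s5 := extD_swap (warpedForms f a) z (horizontalS z) (vertical₂ z)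
  have s6 := extD_swap (warpedForms f a) z (vertical₁ z) (vertical₂ z)
  have key : ∀ u ∈ ({horizontalV f z, horizontalS z, vertical₁ z, vertical₂ z} : Set Total),
      extD (warpedForms f a) z (b₁' • horizontalV f z + b₂' • horizontalS z + p' • vertical₁ z
      + q' • vertical₂ z) u = 0 := by
    rintro u (rfl | rfl | rfl | rfl) <;> rw [extD_combination] <;>
      rcases ha with rfl | rfl <;> simp_all [extD_self]
  rw [extD_combination, extD_swap, key _ (by simp), extD_swap _ _ (horizontalS z),
    key _ (by simp), extD_swap _ _ (vertical₁ z), key _ (by simp), extD_swap _ _ (vertical₂ z),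
    key _ (by simp)]
  simp

theorem finrank_total : Module.finrank ℝ Total = 8 := by
  rw [Module.finrank_prod, finrank_euclideanSpace_fin, Module.finrank_fin_fun]

section Decomposition

variable {f : ℝ → ℝ} {I : Set ℝ} {O : Set Total} {r p q s t : ℕ} {θ : Fin r → OneForm Total}
  {σ₁ : Fin p → OneForm Total} {σ₂ : Fin q → OneForm Total} {Ω₁ : Fin s → TwoForm Total}
  {Ω₂ : Fin t → TwoForm Total}

theorem IsDecomposition.span_theta
    (hd : IsDecomposition O (Set.range (warpedForms f)) (Set.range fun a => extD (warpedForms f a))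
      θ σ₁ σ₂ Ω₁ Ω₂) {z : Total} (hz : z ∈ O) :
    Submodule.span ℝ (Set.range fun a => warpedForms f a z) =
      Submodule.span ℝ (Set.range fun i => θ i z) :=
  span_eq_of_idealOne_eq hd.generates_one hz

/-- The θ span the same rank 4 space as the generators, so p + q = 8 - 4, and both are at least 2.
-/
theorem IsDecomposition.dimensions
    (hd : IsDecomposition O (Set.range (warpedForms f)) (Set.range fun a => extD (warpedForms f a))
      θ σ₁ σ₂ Ω₁ Ω₂) {z : Total} (hz : z ∈ O) : r = 4 ∧ p = 2 ∧ q = 2 := by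
  have h8 := card_coframe (hd.linearIndependent z hz) (hd.span_eq_top z hz)
  rw [finrank_total] at h8
  simp only [Fintype.card_sum, Fintype.card_fin] at h8
  have hθ : LinearIndependent ℝ (fun i => θ i z) :=
    (hd.linearIndependent z hz).comp Sum.inl Sum.inl_injective
  have h1 := finrank_span_eq_card hθ
  have h2 := finrank_span_eq_card (linearIndependent_warpedForms f z)
  rw [hd.span_theta hz, h1] at h2
  simp only [Fintype.card_fin] at h2
  have := hd.two_le_p
  have := hd.two_le_q
  omega

theorem IsDecomposition.annihilated_iff
    (hd : IsDecomposition O (Set.range (warpedForms f)) (Set.range fun a => extD (warpedForms f a))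
      θ σ₁ σ₂ Ω₁ Ω₂) {z : Total} (hz : z ∈ O) (v : Total) :
    Annihilated f z v ↔ ∀ i, θ i z v = 0 := by
  have aux : ∀ {m n : ℕ} {φ : Fin m → Total →L[ℝ] ℝ} {ψ : Fin n → Total →L[ℝ] ℝ},
      Submodule.span ℝ (Set.range φ) = Submodule.span ℝ (Set.range ψ) →
      (∀ i, φ i v = 0) → ∀ i, ψ i v = 0 := by
    intro m n φ ψ h hφ i
    have hi : ψ i ∈ Submodule.span ℝ (Set.range φ) := h ▸ Submodule.subset_span ⟨i, rfl⟩
    generalize ψ i = γ at hi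
    induction hi using Submodule.span_induction with
    | mem γ h => obtain ⟨j, rfl⟩ := h; exact hφ j
    | zero => rfl
    | add γ γ' _ _ h1 h2 => rw [add_apply, h1, h2, add_zero]
    | smul c γ _ h1 => rw [smul_apply, h1, smul_zero]
  exact ⟨aux (hd.span_theta hz), aux (hd.span_theta hz).symm⟩

/-- On annihilated vectors, the members of degree two of the system form a pencil. -/
theorem exists_pencil (hI : IsOpen I) (hf : ContDiffOn ℝ ∞ f I) {z : Total} (hz : z ∈ O)
    (hzI : z.1 0 ∈ I) {Ω : TwoForm Total}
    (h : Ω ∈ idealTwo O (Set.range (warpedForms f)) (Set.range fun a => extD (warpedForms f a))) :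
    ∃ x y : ℝ, ∀ v w, Annihilated f z v → Annihilated f z w →
      Ω z v w = x * extD (warpedForms f 0) z v w + y * extD (warpedForms f 3) z v w := by
  obtain ⟨n, c, Θ, hΘ, hc⟩ := combination_of_mem_idealTwo h hz
  choose a ha using hΘ
  refine ⟨∑ j, c j * (if a j = 0 then 1 else 0), ∑ j, c j * (if a j = 3 then 1 else 0),
    fun v w hv hw => ?_⟩
  rw [hc v w (Set.forall_mem_range.2 hv) (Set.forall_mem_range.2 hw), Finset.sum_mul,
    Finset.sum_mul, ← Finset.sum_add_distrib]
  refine Finset.sum_congr rfl fun j _ => ?_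
  rw [← ha j]
  change c j * extD (warpedForms f (a j)) z v w = _
  have h1 : ∀ b : Fin 4, b = 0 ∨ b = 3 ∨ (b = 1 ∨ b = 2) := by decide
  rcases h1 (a j) with h2 | h2 | h2
  · simp [h2]
  · simp [h2]
  · rw [extD_warpedForms_eq_zero hI hf hzI h2 hv hw]
    rcases h2 with h2 | h2 <;> simp [h2]

end Decomposition

section PairDecomposition

variable {f : ℝ → ℝ} {I : Set ℝ} {O : Set Total} {r s t : ℕ} {θ : Fin r → OneForm Total}
  {σ₁ σ₂ : Fin 2 → OneForm Total} {Ω₁ : Fin s → TwoForm Total} {Ω₂ : Fin t → TwoForm Total}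

theorem IsDecomposition.exists_dual
    (hd : IsDecomposition O (Set.range (warpedForms f)) (Set.range fun a => extD (warpedForms f a))
      θ σ₁ σ₂ Ω₁ Ω₂) {z : Total} (hz : z ∈ O) (c₀ c₁ : ℝ) :
    ∃ v, Annihilated f z v ∧ σ₁ 0 z v = c₀ ∧ σ₁ 1 z v = c₁ ∧ ∀ i, σ₂ i z v = 0 := by
  obtain ⟨v, hv⟩ := coframe_surjective (hd.linearIndependent z hz) (hd.span_eq_top z hz)
    (Sum.elim (fun _ => 0) (Sum.elim ![c₀, c₁] fun _ => 0))
  exact ⟨v, (hd.annihilated_iff hz v).2 fun i => hv (Sum.inl i), hv (Sum.inr (Sum.inl 0)),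
    hv (Sum.inr (Sum.inl 1)), fun i => hv (Sum.inr (Sum.inr i))⟩

/-- The wedge product of the two 1-forms of the first factor is a member of the pencil. -/
theorem IsDecomposition.wedge_eq_pencil (hI : IsOpen I) (hf : ContDiffOn ℝ ∞ f I)
    (hd : IsDecomposition O (Set.range (warpedForms f)) (Set.range fun a => extD (warpedForms f a))
      θ σ₁ σ₂ Ω₁ Ω₂) {z : Total} (hz : z ∈ O) (hzI : z.1 0 ∈ I) (hf0 : f (z.1 0) ≠ 0) :
    ∃ x y : ℝ, ∀ v w, Annihilated f z v → Annihilated f z w →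
      wedge (σ₁ 0) (σ₁ 1) z v w =
        x * extD (warpedForms f 0) z v w + y * extD (warpedForms f 3) z v w := by
  have hw := warpedForms_horizontal f z
  choose g hg using fun b => multiple_of_mem_wedgeSquare (hd.left_mem b) hz
  by_cases hex : ∃ b, g b ≠ 0
  · obtain ⟨b, hb⟩ := hex
    have hmem : Ω₁ b ∈ idealTwo O (Set.range (warpedForms f))
        (Set.range fun a => extD (warpedForms f a)) := by
      rw [hd.generates_two]
      exact mem_idealTwo (Or.inl ⟨b, rfl⟩)
    obtain ⟨x, y, hxy⟩ := exists_pencil hI hf hz hzI hmem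
    refine ⟨(g b)⁻¹ * x, (g b)⁻¹ * y, fun v w hv hw => ?_⟩
    have := hxy v w hv hw
    rw [hg] at this
    field_simp
    linear_combination this
  -- If every Ω₁ vanishes at z, the vector v dual to `σ₁ 0` lies in the kernel of all the dθ on
  -- annihilated vectors, because the Ω₂ do not see it. Pairing dθ₀ and dθ₃ with the two vertical
  -- fields shows that all four components of v are zero, contrary to `σ₁ 0 z v = 1`.
  · exfalso
    push Not at hex
    choose g' hg' using fun b => multiple_of_mem_wedgeSquare (hd.right_mem b) hz
    obtain ⟨v, hv, h0, -, h2⟩ := hd.exists_dual hz 1 0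
    have hzero : ∀ a w, Annihilated f z w → extD (warpedForms f a) z v w = 0 := by
      intro a w hw
      have hmem : extD (warpedForms f a) ∈ idealTwo O (Set.range θ)
          (Set.range Ω₁ ∪ Set.range Ω₂) := by
        rw [← hd.generates_two]
        exact mem_idealTwo ⟨a, rfl⟩
      obtain ⟨n, c, Θ, hΘ, hc⟩ := combination_of_mem_idealTwo hmem hz
      rw [hc v w (Set.forall_mem_range.2 ((hd.annihilated_iff hz v).1 hv))
        (Set.forall_mem_range.2 ((hd.annihilated_iff hz w).1 hw))]
      refine Finset.sum_eq_zero fun j _ => ?_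
      rcases hΘ j with ⟨b, hb⟩ | ⟨b, hb⟩
      · rw [← hb, hg, hex]; ring
      · rw [← hb, hg', wedge, h2, h2]; ring
    obtain ⟨b₁, b₂, p, q, rfl⟩ := exists_combination_of_annihilated hv
    have e0p := hzero 0 _ fun a => (hw a).2.2.1
    have e0q := hzero 0 _ fun a => (hw a).2.2.2
    have e3p := hzero 3 _ fun a => (hw a).2.2.1
    have e3q := hzero 3 _ fun a => (hw a).2.2.2
    obtain ⟨-, a2, a3, a4, a5, a6⟩ := extD_warpedForms_basis hI hf hzI 0
    obtain ⟨-, c2, c3, c4, c5, c6⟩ := extD_warpedForms_basis hI hf hzI 3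
    have a6' := extD_swap (warpedForms f 0) z (vertical₂ z) (vertical₁ z)
    have c6' := extD_swap (warpedForms f 3) z (vertical₂ z) (vertical₁ z)
    rw [extD_combination] at e0p e0q e3p e3q
    simp [a2, a3, a4, a5, a6, c2, c3, c4, c5, c6, a6', c6', extD_self, hf0] at e0p e0q e3p e3q
    rw [e0p, e0q, e3p, e3q] at h0
    simp at h0

/-- The first factor of a decomposition annihilates one of the two characteristic distributions. -/
theorem IsDecomposition.exists_characteristic (hI : IsOpen I) (hf : ContDiffOn ℝ ∞ f I)
    (hd : IsDecomposition O (Set.range (warpedForms f)) (Set.range fun a => extD (warpedForms f a))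
      θ σ₁ σ₂ Ω₁ Ω₂) {z : Total} (hz : z ∈ O) (hzI : z.1 0 ∈ I) (hf0 : f (z.1 0) ≠ 0) {k : ℝ}
    (hk : deriv (deriv f) (z.1 0) = -(k ^ 2 * f (z.1 0))) :
    ∃ κ, (κ = k ∨ κ = -k) ∧ ∀ i, σ₁ i z (horizontalV f z - (κ * f (z.1 0)) • vertical₂ z) = 0 ∧
      σ₁ i z (horizontalS z + κ • vertical₁ z) = 0 := by
  have hw := warpedForms_horizontal f z
  have w1 : Annihilated f z _ := fun a => (hw a).1
  have w2 : Annihilated f z _ := fun a => (hw a).2.1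
  have w3 : Annihilated f z _ := fun a => (hw a).2.2.1
  have w4 : Annihilated f z _ := fun a => (hw a).2.2.2
  obtain ⟨x, y, hxy⟩ := hd.wedge_eq_pencil hI hf hz hzI hf0
  obtain ⟨a1, a2, a3, a4, a5, a6⟩ := extD_warpedForms_basis hI hf hzI 0
  obtain ⟨c1, c2, c3, c4, c5, c6⟩ := extD_warpedForms_basis hI hf hzI 3
  have b1 := hxy _ _ w1 w2
  have b2 := hxy _ _ w1 w3
  have b3 := hxy _ _ w1 w4
  have b4 := hxy _ _ w2 w3
  have b5 := hxy _ _ w2 w4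
  have b6 := hxy _ _ w3 w4
  rw [a1, c1] at b1
  rw [a2, c2] at b2
  rw [a3, c3] at b3
  rw [a4, c4] at b4
  rw [a5, c5] at b5
  rw [a6, c6] at b6
  simp [wedge, hk] at b1 b2 b3 b4 b5 b6
  obtain ⟨t₀, ht₀, t00, t01, -⟩ := hd.exists_dual hz 1 0
  obtain ⟨t₁, ht₁, t10, t11, -⟩ := hd.exists_dual hz 0 1
  obtain ⟨p₁, p₂, p₃, p₄, rfl⟩ := exists_combination_of_annihilated ht₀
  obtain ⟨q₁, q₂, q₃, q₄, rfl⟩ := exists_combination_of_annihilated ht₁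
  simp at t00 t01 t10 t11
  have red : ∀ (i : Fin 2) (κ : ℝ),
      σ₁ i z (horizontalV f z) - κ * f (z.1 0) * σ₁ i z (vertical₂ z) = 0 ∧
        σ₁ i z (horizontalS z) + κ * σ₁ i z (vertical₁ z) = 0 →
      σ₁ i z (horizontalV f z - (κ * f (z.1 0)) • vertical₂ z) = 0 ∧
        σ₁ i z (horizontalS z + κ • vertical₁ z) = 0 := fun i κ h => by
    simpa only [map_sub, map_add, map_smul, smul_eq_mul] using h
  suffices hsuff : ∃ κ, (κ = k ∨ κ = -k) ∧
      (σ₁ 0 z (horizontalV f z) - κ * f (z.1 0) * σ₁ 0 z (vertical₂ z) = 0 ∧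
        σ₁ 0 z (horizontalS z) + κ * σ₁ 0 z (vertical₁ z) = 0) ∧
      (σ₁ 1 z (horizontalV f z) - κ * f (z.1 0) * σ₁ 1 z (vertical₂ z) = 0 ∧
        σ₁ 1 z (horizontalS z) + κ * σ₁ 1 z (vertical₁ z) = 0) by
    obtain ⟨κ, hκ, h0, h1⟩ := hsuff
    exact ⟨κ, hκ, fun i => by fin_cases i; exacts [red 0 κ h0, red 1 κ h1]⟩
  clear red
  generalize σ₁ 0 z (horizontalV f z) = A₁ at *
  generalize σ₁ 0 z (horizontalS z) = A₂ at *
  generalize σ₁ 0 z (vertical₁ z) = A₃ at *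
  generalize σ₁ 0 z (vertical₂ z) = A₄ at *
  generalize σ₁ 1 z (horizontalV f z) = B₁ at *
  generalize σ₁ 1 z (horizontalS z) = B₂ at *
  generalize σ₁ 1 z (vertical₁ z) = B₃ at *
  generalize σ₁ 1 z (vertical₂ z) = B₄ at *
  -- The Plücker relation among the six 2 × 2 minors of (A, B): the form x dθ₀ + y dθ₃ is
  -- decomposable only if x² = k²y².
  have hx : x ^ 2 = k ^ 2 * y ^ 2 := by
    refine mul_right_cancel₀ hf0 ?_
    have e₁ : (A₁ * B₂ - A₂ * B₁) * (A₃ * B₄ - A₄ * B₃) = y ^ 2 * k ^ 2 * f (z.1 0) := by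
      rw [b1, b6]; ring
    have e₂ : (A₁ * B₃ - A₃ * B₁) * (A₂ * B₄ - A₄ * B₂) = x ^ 2 * f (z.1 0) := by
      rw [b2, b5]; ring
    have e₃ : (A₁ * B₄ - A₄ * B₁) * (A₂ * B₃ - A₃ * B₂) = 0 := by
      rw [b3, b4]; ring
    linear_combination e₁ - e₂ + e₃
  obtain ⟨κ, hκ, hxκ⟩ : ∃ κ, (κ = k ∨ κ = -k) ∧ x = κ * y := by
    have : (x - k * y) * (x - -k * y) = 0 := by linear_combination hx
    rcases mul_eq_zero.1 this with h | h
    · exact ⟨k, Or.inl rfl, by linear_combination h⟩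
    · exact ⟨-k, Or.inr rfl, by linear_combination h⟩
  have hκ2 : κ ^ 2 = k ^ 2 := by rcases hκ with rfl | rfl <;> ring
  refine ⟨κ, hκ, ?_⟩
  generalize f (z.1 0) = F at *
  -- The two proposed vectors lie in the kernel of `wedge (σ₁ 0) (σ₁ 1)`: their minors against the
  -- whole basis vanish. Contraction with the vectors dual to σ₁ then shows that σ₁ itself vanishes
  -- on them.
  have m₁ : (A₁ - κ * F * A₄) * B₁ - A₁ * (B₁ - κ * F * B₄) = 0 := by
    linear_combination κ * F * b3
  have m₂ : (A₁ - κ * F * A₄) * B₂ - A₂ * (B₁ - κ * F * B₄) = 0 := by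
    linear_combination b1 + κ * F * b5 + κ * F * hxκ + y * F * hκ2
  have m₃ : (A₁ - κ * F * A₄) * B₃ - A₃ * (B₁ - κ * F * B₄) = 0 := by
    linear_combination b2 + κ * F * b6 + F * hxκ
  have m₄ : (A₁ - κ * F * A₄) * B₄ - A₄ * (B₁ - κ * F * B₄) = 0 := by
    linear_combination b3
  have n₁ : (A₂ + κ * A₃) * B₁ - A₁ * (B₂ + κ * B₃) = 0 := by
    linear_combination -b1 - κ * b2 - κ * F * hxκ - y * F * hκ2
  have n₂ : (A₂ + κ * A₃) * B₂ - A₂ * (B₂ + κ * B₃) = 0 := by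
    linear_combination -κ * b4
  have n₃ : (A₂ + κ * A₃) * B₃ - A₃ * (B₂ + κ * B₃) = 0 := by
    linear_combination b4
  have n₄ : (A₂ + κ * A₃) * B₄ - A₄ * (B₂ + κ * B₃) = 0 := by
    linear_combination b5 + κ * b6 + hxκ
  have a₁ : A₁ - κ * F * A₄ = 0 := by
    linear_combination q₁ * m₁ + q₂ * m₂ + q₃ * m₃ + q₄ * m₄ - (A₁ - κ * F * A₄) * t11
      + (B₁ - κ * F * B₄) * t10
  have a₂ : B₁ - κ * F * B₄ = 0 := by
    linear_combination -(p₁ * m₁ + p₂ * m₂ + p₃ * m₃ + p₄ * m₄) + (A₁ - κ * F * A₄) * t01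
      - (B₁ - κ * F * B₄) * t00
  have a₃ : A₂ + κ * A₃ = 0 := by
    linear_combination q₁ * n₁ + q₂ * n₂ + q₃ * n₃ + q₄ * n₄ - (A₂ + κ * A₃) * t11
      + (B₂ + κ * B₃) * t10
  have a₄ : B₂ + κ * B₃ = 0 := by
    linear_combination -(p₁ * n₁ + p₂ * n₂ + p₃ * n₃ + p₄ * n₄) + (A₂ + κ * A₃) * t01
      - (B₂ + κ * B₃) * t00
  exact ⟨⟨a₁, a₃⟩, a₂, a₄⟩

/-- The first factor of a decomposition does not annihilate both characteristic distributions. -/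
theorem IsDecomposition.not_both
    (hd : IsDecomposition O (Set.range (warpedForms f)) (Set.range fun a => extD (warpedForms f a))
      θ σ₁ σ₂ Ω₁ Ω₂) {z : Total} (hz : z ∈ O) (hf0 : f (z.1 0) ≠ 0) {k : ℝ} (hk : k ≠ 0)
    (h : ∀ κ, κ = k ∨ κ = -k → σ₁ 0 z (horizontalV f z - (κ * f (z.1 0)) • vertical₂ z) = 0 ∧
      σ₁ 0 z (horizontalS z + κ • vertical₁ z) = 0) : False := by
  obtain ⟨t₀, ht₀, t00, -⟩ := hd.exists_dual hz 1 0
  obtain ⟨p₁, p₂, p₃, p₄, rfl⟩ := exists_combination_of_annihilated ht₀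
  -- For k ≠ 0 the two characteristic planes together span all annihilated vectors, including one on
  -- which `σ₁ 0` equals 1.
  obtain ⟨e₁, e₂⟩ := h k (Or.inl rfl)
  obtain ⟨e₃, e₄⟩ := h (-k) (Or.inr rfl)
  simp at e₁ e₂ e₃ e₄ t00
  have h4 : σ₁ 0 z (vertical₂ z) = 0 := by
    have : (k * f (z.1 0)) * σ₁ 0 z (vertical₂ z) = 0 := by linear_combination (e₃ - e₁) / 2
    exact (mul_eq_zero.1 this).resolve_left (mul_ne_zero hk hf0)
  have h3 : σ₁ 0 z (vertical₁ z) = 0 := by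
    have : k * σ₁ 0 z (vertical₁ z) = 0 := by linear_combination (e₂ - e₄) / 2
    exact (mul_eq_zero.1 this).resolve_left hk
  rw [h4] at e₁ t00
  rw [h3] at e₂ t00
  have h1 : σ₁ 0 z (horizontalV f z) = 0 := by linear_combination e₁
  have h2 : σ₁ 0 z (horizontalS z) = 0 := by linear_combination e₂
  rw [h1, h2] at t00
  simp at t00

end PairDecomposition

/-! ### Darboux integrability implies the curvature equation -/

theorem lift_charFieldV (f κ : ℝ → ℝ) (z : Total) : lift dirV (charFieldV f κ) z =
    horizontalV f z - (κ (z.1 0) * f (z.1 0)) • vertical₂ z := by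
  rw [sub_eq_add_neg, ← neg_smul]
  simp only [horizontalV, vertical₂, lift, Prod.smul_mk, Prod.mk_add_mk, ← leftInv_smul,
    ← leftInv_add, charFieldV]
  refine Prod.ext (by simp) (congrArg (fun x => leftInv x z.2) ?_)
  ext i
  fin_cases i <;> simp

theorem lift_charFieldS (κ : ℝ → ℝ) (z : Total) : lift dirS (charFieldS κ) z =
    horizontalS z + κ (z.1 0) • vertical₁ z := by
  simp only [horizontalS, vertical₁, lift, Prod.smul_mk, Prod.mk_add_mk, ← leftInv_smul,
    ← leftInv_add, charFieldS]
  refine Prod.ext (by simp) (congrArg (fun x => leftInv x z.2) ?_)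
  ext i
  fin_cases i <;> simp

theorem contDiffOn_charFieldV {f κ : ℝ → ℝ} {I : Set ℝ} (hI : IsOpen I) (hf : ContDiffOn ℝ ∞ f I)
    (hκ : ContDiffOn ℝ ∞ κ I) : ContDiffOn ℝ ∞ (charFieldV f κ) I := by
  have hf' : ContDiffOn ℝ ∞ (deriv f) I := hf.deriv_of_isOpen hI (by simp)
  rw [contDiffOn_pi]
  intro i
  fin_cases i <;> simp [charFieldV] <;>
    first | exact contDiffOn_const | assumption | exact (hκ.mul hf).neg

theorem contDiffOn_charFieldS {κ : ℝ → ℝ} {I : Set ℝ} (hκ : ContDiffOn ℝ ∞ κ I) :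
    ContDiffOn ℝ ∞ (charFieldS κ) I := by
  rw [contDiffOn_pi]
  intro i
  fin_cases i <;> simp [charFieldS] <;> first | exact contDiffOn_const | assumption

/-- If the isometric embedding system of `f(s)² dv² - ds²` is Darboux integrable, then its
curvature `-k²` satisfies a first order equation. -/
theorem curvature_equation_of_darboux {f k : ℝ → ℝ} {I : Set ℝ} {D : Set Plane} (hI : IsOpen I)
    (hDI : ∀ x ∈ D, x 0 ∈ I) (hf : ContDiffOn ℝ ∞ f I) (hk : ContDiffOn ℝ ∞ k I)
    (hf0 : ∀ s ∈ I, f s ≠ 0) (hk0 : ∀ s ∈ I, k s ≠ 0)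
    (hf2 : ∀ s ∈ I, deriv (deriv f) s = -(k s ^ 2 * f s))
    (h : IsDarbouxIntegrableEDS (D ×ˢ Set.univ) (Set.range (warpedForms f))
      (Set.range fun a => extD (warpedForms f a))) {x : Plane} (hx : x ∈ D) :
    deriv k (x 0) * deriv f (x 0) = -2 * k (x 0) ^ 3 * f (x 0) := by
  obtain ⟨O, hO, hzO, hON, r, p, q, s, t, θ, σ₁, σ₂, Ω₁, Ω₂, hd, -, -, hpair⟩ :=
    h (x, 0) ⟨hx, trivial⟩
  have hOI : ∀ z ∈ O, z.1 0 ∈ I := fun z hz => hDI _ (hON hz).1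
  obtain ⟨rfl, rfl, rfl⟩ := hd.dimensions hzO
  -- The limit system and ⟨θ, σ₂⟩ together span the cotangent space of dimension 8, and the latter
  -- has rank at most 4 + 2.
  have hrank : 2 ≤ Module.finrank ℝ (derivedLimit O
      (fun x => Submodule.span ℝ (Set.range (fun i => θ i x) ∪ Set.range (fun i => σ₁ i x)))
      (x, 0)) := by
    have h1 := hpair.span_right (x, 0) hzO
    have h2 := Submodule.finrank_add_le_finrank_add_finrank (derivedLimit O
      (fun x => Submodule.span ℝ (Set.range (fun i => θ i x) ∪ Set.range (fun i => σ₁ i x)))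
      (x, 0)) (Submodule.span ℝ (Set.range (fun i => θ i (x, 0)) ∪ Set.range fun i => σ₂ i (x, 0)))
    have h3 : Module.finrank ℝ (Submodule.span ℝ
        (Set.range (fun i => θ i (x, 0)) ∪ Set.range fun i => σ₂ i (x, 0))) ≤ 6 := by
      rw [Submodule.span_union]
      refine (Submodule.finrank_add_le_finrank_add_finrank _ _).trans ?_
      have h4 := finrank_range_le_card (R := ℝ) (fun i => θ i (x, 0))
      have h5 := finrank_range_le_card (R := ℝ) (fun i => σ₂ i (x, 0))
      simp only [Fintype.card_fin, Set.finrank] at h4 h5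
      omega
    rw [h1, finrank_top] at h2
    have h6 : Module.finrank ℝ (Total →L[ℝ] ℝ) = 8 := by
      rw [← finrank_total, ← Subspace.dual_finrank_eq (K := ℝ) (V := Total)]
      exact (LinearMap.toContinuousLinearMap (𝕜 := ℝ) (E := Total) (F' := ℝ)).finrank_eq.symm
    replace h2 := h6.symm.trans_le h2
    omega
  -- Here κ stands for whichever of k and -k labels the plane annihilated by σ₁ at the base point.
  -- The equation is odd in κ, so either choice yields it for k.
  have main : ∀ κ : ℝ → ℝ, ContDiffOn ℝ ∞ κ I → (∀ s, κ s = k s ∨ κ s = -k s) →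
      (∀ i, σ₁ i (x, 0) (lift dirV (charFieldV f κ) (x, 0)) = 0 ∧
        σ₁ i (x, 0) (lift dirS (charFieldS κ) (x, 0)) = 0) →
      deriv κ (x 0) * deriv f (x 0) = -2 * κ (x 0) ^ 3 * f (x 0) := by
    intro κ hκ hκk hz
    have hκ2 : ∀ s, κ s ^ 2 = k s ^ 2 := fun s => by
      rcases hκk s with h | h <;> rw [h]; ring
    have hκ0 : ∀ s ∈ I, κ s ≠ 0 := fun s hs h => by
      have := hκ2 s
      rw [h] at this
      exact hk0 s hs (pow_eq_zero_iff two_ne_zero |>.1 (by linear_combination -this))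
    have hκf : ∀ s ∈ I, deriv (deriv f) s = -(κ s ^ 2 * f s) := fun s hs => by
      rw [hf2 s hs, hκ2]
    -- the opposite characteristic distribution is not annihilated nearby
    let ψ : Total → ℝ × ℝ := fun z => (σ₁ 0 z (lift dirV (charFieldV f (fun s => -κ s)) z),
      σ₁ 0 z (lift dirS (charFieldS (fun s => -κ s)) z))
    have hψ0 : ψ (x, 0) ≠ 0 := by
      intro h0
      refine hd.not_both hzO (hf0 _ (hDI x hx)) (hκ0 _ (hDI x hx)) ?_
      rintro _ (rfl | rfl)
      · have := hz 0
        rwa [lift_charFieldV, lift_charFieldS] at this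
      · have h1 : σ₁ 0 (x, 0) (lift dirV (charFieldV f (fun s => -κ s)) (x, 0)) = 0 :=
          congrArg Prod.fst h0
        have h2 : σ₁ 0 (x, 0) (lift dirS (charFieldS (fun s => -κ s)) (x, 0)) = 0 :=
          congrArg Prod.snd h0
        rw [lift_charFieldV] at h1
        rw [lift_charFieldS] at h2
        exact ⟨h1, h2⟩
    have hψ : ContinuousAt ψ (x, 0) := by
      have h1 : ContinuousOn (σ₁ 0) O := (hd.smooth.2.1 0).continuousOn
      have h2 : ContinuousOn (lift dirV (charFieldV f (fun s => -κ s))) O :=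
        ((contDiffOn_lift dirV (contDiffOn_charFieldV hI hf hκ.neg)).mono hOI).continuousOn
      have h3 : ContinuousOn (lift dirS (charFieldS (fun s => -κ s))) O :=
        ((contDiffOn_lift dirS (contDiffOn_charFieldS hκ.neg)).mono hOI).continuousOn
      exact ((h1.clm_apply h2).prodMk (h1.clm_apply h3)).continuousAt (hO.mem_nhds hzO)
    obtain ⟨O', hO'sub, hO', hzO'⟩ := mem_nhds_iff.1
      ((hψ.eventually_ne hψ0).and (hO.mem_nhds hzO))
    have hO'O : O' ⊆ O := fun z hz => (hO'sub hz).2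
    -- On O' the plane of the opposite sign is excluded, so the pointwise choice of sign is constant
    -- there.
    have hann : ∀ z ∈ O', ∀ i, σ₁ i z (lift dirV (charFieldV f κ) z) = 0 ∧
        σ₁ i z (lift dirS (charFieldS κ) z) = 0 := by
      intro z hz i
      have hzI := hOI z (hO'O hz)
      obtain ⟨c, hc, hc'⟩ := hd.exists_characteristic hI hf (hO'O hz) hzI (hf0 _ hzI)
        (hκf _ hzI)
      rcases hc with rfl | rfl
      · have := hc' i
        rwa [lift_charFieldV, lift_charFieldS]
      · exfalso
        refine (hO'sub hz).1 (Prod.ext ?_ ?_)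
        · have := (hc' 0).1
          simp only [ψ]
          rwa [lift_charFieldV]
        · have := (hc' 0).2
          simp only [ψ]
          rwa [lift_charFieldS]
    have hspan : ∀ {z v : Total} {γ : Total →L[ℝ] ℝ}, z ∈ O → Annihilated f z v →
        (∀ i, σ₁ i z v = 0) →
        γ ∈ Submodule.span ℝ (Set.range (fun i => θ i z) ∪ Set.range (fun i => σ₁ i z)) →
        γ v = 0 := by
      intro z v γ hz hv hσ hγ
      induction hγ using Submodule.span_induction with
      | mem γ h =>
        rcases h with ⟨i, rfl⟩ | ⟨i, rfl⟩
        · exact (hd.annihilated_iff hz v).1 hv i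
        · exact hσ i
      | zero => rfl
      | add γ γ' _ _ h1 h2 => rw [add_apply, h1, h2, add_zero]
      | smul c γ _ h1 => rw [smul_apply, h1, smul_zero]
    refine curvature_equation (z := (x, 0)) hO'O hO' hI (fun z hz => hOI z (hO'O hz)) hf hκ hf0 hκ0
      hκf ⟨contDiffOn_charFieldV hI hf hκ, 0, fun γ hγ z hz => ?_⟩
      ⟨contDiffOn_charFieldS hκ, 0, fun γ hγ z hz => ?_⟩ hzO' hrank
    · refine hspan (hO'O hz) (fun a => ?_) (fun i => (hann z hz i).1) (hγ.2 z (hO'O hz))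
      rw [warpedForms_lift]
      fin_cases a <;> simp [charFieldV]
    · refine hspan (hO'O hz) (fun a => ?_) (fun i => (hann z hz i).2) (hγ.2 z (hO'O hz))
      rw [warpedForms_lift]
      fin_cases a <;> simp [charFieldS]
  obtain ⟨c, hc, hc'⟩ := hd.exists_characteristic hI hf hzO (hDI x hx) (hf0 _ (hDI x hx))
    (hf2 _ (hDI x hx))
  rcases hc with rfl | rfl
  · refine main k hk (fun s => Or.inl rfl) fun i => ?_
    rw [lift_charFieldV, lift_charFieldS]
    exact hc' i
  · have := main (fun s => -k s) hk.neg (fun s => Or.inr rfl) fun i => by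
      rw [lift_charFieldV, lift_charFieldS]
      exact hc' i
    rw [show deriv (fun s => -k s) (x 0) = -deriv k (x 0) from deriv.fun_neg] at this
    linear_combination -this

/-! ### Change of coordinates for metrics and vector fields -/

/-- The inverse function theorem with two restrictions. Keeping the derivative invertible on the
whole source makes the inverse smooth on the whole target. Making the target a ball lets functions
invariant in one direction be reduced to one variable. -/
theorem exists_localDiffeo {N : Set Plane} (hN : IsOpen N) {Ψ : Plane → Plane}
    (hΨ : ContDiffOn ℝ ∞ Ψ N) {x₀ : Plane} (hx₀ : x₀ ∈ N) {L : Plane ≃L[ℝ] Plane}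
    (hL : HasFDerivAt Ψ (L : Plane →L[ℝ] Plane) x₀) {T : Set Plane} (hT : T ∈ 𝓝 (Ψ x₀)) :
    ∃ r > 0, ∃ e : OpenPartialHomeomorph Plane Plane, ⇑e = Ψ ∧ x₀ ∈ e.source ∧ e.source ⊆ N ∧
      e.target = Metric.ball (Ψ x₀) r ∧ Metric.ball (Ψ x₀) r ⊆ T ∧
      (∀ x ∈ e.source, ∃ L' : Plane ≃L[ℝ] Plane, HasFDerivAt Ψ (L' : Plane →L[ℝ] Plane) x) ∧
      ContDiffOn ℝ ∞ e.symm e.target := by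
  have hat : ∀ x ∈ N, ContDiffAt ℝ ∞ Ψ x := fun x hx => hΨ.contDiffAt (hN.mem_nhds hx)
  set S : Set Plane :=
    N ∩ fderiv ℝ Ψ ⁻¹' Set.range ((↑) : (Plane ≃L[ℝ] Plane) → Plane →L[ℝ] Plane) with hS
  have hSo : IsOpen S := (hΨ.continuousOn_fderiv_of_isOpen hN (by simp)).isOpen_inter_preimage hN
    (ContinuousLinearEquiv.isOpen)
  set e₀ := (hat x₀ hx₀).toOpenPartialHomeomorph Ψ hL (by simp) with he₀
  have hx₀e : x₀ ∈ e₀.source := (hat x₀ hx₀).mem_toOpenPartialHomeomorph_source hL (by simp)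
  have hcoe : ⇑e₀ = Ψ := rfl
  clear_value e₀
  set e₁ := e₀.restrOpen S hSo with he₁
  have hx₀S : x₀ ∈ S := ⟨hx₀, L, hL.fderiv.symm⟩
  have hx₀1 : x₀ ∈ e₁.source := ⟨hx₀e, hx₀S⟩
  have hcoe1 : ⇑e₁ = Ψ := hcoe
  have hs1 : e₁.source ⊆ S := fun x hx => hx.2
  clear_value e₁
  have htn : e₁.target ∩ T ∈ 𝓝 (Ψ x₀) :=
    Filter.inter_mem (e₁.open_target.mem_nhds (hcoe1 ▸ e₁.map_source hx₀1)) hT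
  obtain ⟨r, hr, hball⟩ := Metric.mem_nhds_iff.1 htn
  set e₂ := (e₁.symm.restrOpen (Metric.ball (Ψ x₀) r) Metric.isOpen_ball).symm with he₂
  have hcoe2 : ⇑e₂ = Ψ := hcoe1
  have ht2 : e₂.target = Metric.ball (Ψ x₀) r :=
    Set.inter_eq_right.2 (hball.trans Set.inter_subset_left)
  have hs2 : e₂.source ⊆ e₁.source := fun x hx => by
    have h := e₂.map_source hx
    have h1 : e₁.symm (e₂ x) ∈ e₁.source := e₁.map_target (by rw [ht2] at h; exact (hball h).1)
    rwa [show e₁.symm (e₂ x) = x from e₂.left_inv hx] at h1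
  have hx2 : x₀ ∈ e₂.source := by
    have h : Ψ x₀ ∈ e₂.target := ht2 ▸ Metric.mem_ball_self hr
    have h1 := e₂.map_target h
    have h2 : e₂.symm (Ψ x₀) = e₁.symm (e₁ x₀) := by rw [hcoe1]; rfl
    rwa [h2, e₁.left_inv hx₀1] at h1
  clear_value e₂
  have hinv : ∀ x ∈ e₂.source, ∃ L' : Plane ≃L[ℝ] Plane,
      HasFDerivAt Ψ (L' : Plane →L[ℝ] Plane) x := fun x hx => by
    obtain ⟨hxN, L', hL'⟩ := hs1 (hs2 hx)
    exact ⟨L', hL' ▸ ((hat x hxN).differentiableAt (by simp)).hasFDerivAt⟩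
  refine ⟨r, hr, e₂, hcoe2, hx2, fun x hx => (hs1 (hs2 hx)).1, ht2,
    hball.trans Set.inter_subset_right, hinv, fun y hy => ?_⟩
  obtain ⟨L', hL'⟩ := hinv _ (e₂.map_target hy)
  exact (e₂.contDiffAt_symm hy (by rw [hcoe2]; exact hL')
    (by rw [hcoe2]; exact hat _ (hs1 (hs2 (e₂.map_target hy))).1)).contDiffWithinAt

theorem mfderiv_symm_apply_mfderiv {M : Type*} [TopologicalSpace M]
    [ChartedSpace Plane M] {φ : OpenPartialHomeomorph M Plane}
    (hφ : φ ∈ IsManifold.maximalAtlas 𝓘(ℝ, Plane) ∞ M) {x : Plane} (hx : x ∈ φ.target)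
    (v : TangentSpace 𝓘(ℝ, Plane) (φ.symm x)) :
    mfderiv 𝓘(ℝ, Plane) 𝓘(ℝ, Plane) φ.symm x
      (mfderiv 𝓘(ℝ, Plane) 𝓘(ℝ, Plane) φ (φ.symm x) v) = v := by
  have hd : φ.MDifferentiable 𝓘(ℝ, Plane) 𝓘(ℝ, Plane) :=
    ⟨(contMDiffOn_of_mem_maximalAtlas hφ).mdifferentiableOn (by simp),
      (contMDiffOn_symm_of_mem_maximalAtlas hφ).mdifferentiableOn (by simp)⟩
  have h := hd.symm_comp_deriv (φ.map_target hx)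
  rw [φ.right_inv hx] at h
  exact congrArg (fun A : Plane →L[ℝ] Plane => A v) h

section Charts

variable {M : Type*} [TopologicalSpace M] [ChartedSpace Plane M] [IsManifold 𝓘(ℝ, Plane) ∞ M]

open IsManifold

/-- All tangent spaces are copies of `Plane`, so vectors at two equal base points can be compared
there without transport. -/
theorem LorentzianMetric.inner_mfderiv_congr (g : LorentzianMetric M) {σ τ : Plane → M} {x y : Plane}
    (h : σ x = τ y) (v w v' w' : Plane)
    (hv : (mfderiv 𝓘(ℝ, Plane) 𝓘(ℝ, Plane) σ x v : Plane) =
      mfderiv 𝓘(ℝ, Plane) 𝓘(ℝ, Plane) τ y v')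
    (hw : (mfderiv 𝓘(ℝ, Plane) 𝓘(ℝ, Plane) σ x w : Plane) =
      mfderiv 𝓘(ℝ, Plane) 𝓘(ℝ, Plane) τ y w') :
    g.inner (σ x) (mfderiv 𝓘(ℝ, Plane) 𝓘(ℝ, Plane) σ x v)
      (mfderiv 𝓘(ℝ, Plane) 𝓘(ℝ, Plane) σ x w) =
    g.inner (τ y) (mfderiv 𝓘(ℝ, Plane) 𝓘(ℝ, Plane) τ y v')
      (mfderiv 𝓘(ℝ, Plane) 𝓘(ℝ, Plane) τ y w') := by
  have key : ∀ (p q : M) (hpq : p = q) (a b : TangentSpace 𝓘(ℝ, Plane) p)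
      (a' b' : TangentSpace 𝓘(ℝ, Plane) q), (a : Plane) = a' → (b : Plane) = b' →
      g.inner p a b = g.inner q a' b' := by
    intro p q hpq a b a' b' ha hb
    subst hpq
    obtain rfl : a = a' := ha
    obtain rfl : b = b' := hb
    rfl
  exact key _ _ h _ _ _ _ hv hw

/-- Composition of a chart with a local diffeomorphism of the plane. -/
theorem exists_chart_of_localDiffeo (g : LorentzianMetric M) {φ : OpenPartialHomeomorph M Plane}
    (hφ : φ ∈ maximalAtlas 𝓘(ℝ, Plane) ∞ M) {p : M} (hp : p ∈ φ.source)
    {N : Set Plane} (hN : IsOpen N) {Ψ : Plane → Plane}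
    (hΨ : ContDiffOn ℝ ∞ Ψ N) (hx₀ : φ p ∈ N) {L : Plane ≃L[ℝ] Plane}
    (hL : HasFDerivAt Ψ (L : Plane →L[ℝ] Plane) (φ p)) {T : Set Plane}
    (hT : T ∈ 𝓝 (Ψ (φ p))) :
    ∃ r > 0, ∃ φ' ∈ maximalAtlas 𝓘(ℝ, Plane) ∞ M, p ∈ φ'.source ∧ φ' p = Ψ (φ p) ∧
      φ'.target = Metric.ball (Ψ (φ p)) r ∧ Metric.ball (Ψ (φ p)) r ⊆ T ∧
      ∀ y ∈ φ'.target, ∃ x ∈ N ∩ φ.target, Ψ x = y ∧ φ'.symm y = φ.symm x ∧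
        ∃ L' : Plane ≃L[ℝ] Plane, HasFDerivAt Ψ (L' : Plane →L[ℝ] Plane) x ∧
        (∀ V : ∀ p : M, TangentSpace 𝓘(ℝ, Plane) p, LorentzianMetric.fieldInChart V φ' y =
          L' (LorentzianMetric.fieldInChart V φ x)) ∧
        ∀ v w, g.inChart φ' y (L' v) (L' w) = g.inChart φ x v w := by
  obtain ⟨r, hr, e, hcoe, hpe, heN, het, hball, hinv, hsm⟩ :=
    exists_localDiffeo (hN.inter φ.open_target) (hΨ.mono Set.inter_subset_left)
      ⟨hx₀, φ.map_source hp⟩ hL hT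
  set φ' := φ.trans e with hφ'
  have hsrc : φ'.source = φ.source ∩ φ ⁻¹' e.source := by simp [hφ']
  have htgt : φ'.target = e.target := by
    rw [hφ', OpenPartialHomeomorph.trans_target]
    exact Set.inter_eq_left.2 fun y hy => (heN (e.map_target hy)).2
  have hmem : φ' ∈ maximalAtlas 𝓘(ℝ, Plane) ∞ M := by
    refine φ'.mem_maximalAtlas_of_contMDiffOn ?_ ?_
    · have h1 := contMDiffOn_of_mem_maximalAtlas hφ
      have h2 : ContMDiffOn 𝓘(ℝ, Plane) 𝓘(ℝ, Plane) ∞ e e.source := by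
        rw [contMDiffOn_iff_contDiffOn, hcoe]
        exact hΨ.mono fun x hx => (heN hx).1
      rw [hsrc]
      exact h2.comp (h1.mono Set.inter_subset_left) fun x hx => hx.2
    · have h1 := contMDiffOn_symm_of_mem_maximalAtlas hφ
      have h2 : ContMDiffOn 𝓘(ℝ, Plane) 𝓘(ℝ, Plane) ∞ e.symm e.target :=
        contMDiffOn_iff_contDiffOn.2 hsm
      rw [htgt]
      exact h1.comp h2 fun y hy => (heN (e.map_target hy)).2
  refine ⟨r, hr, φ', hmem, by rw [hsrc]; exact ⟨hp, hpe⟩, by simp [hφ', hcoe], htgt.trans het,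
    hball, fun y hy => ?_⟩
  rw [htgt] at hy
  have hx := e.map_target hy
  obtain ⟨L', hL'⟩ := hinv _ hx
  have hΨx : Ψ (e.symm y) = y := by rw [← hcoe]; exact e.right_inv hy
  refine ⟨e.symm y, heN hx, hΨx, rfl, L', hL', fun V => ?_, fun v w => ?_⟩
  · have hd : MDifferentiableAt 𝓘(ℝ, Plane) 𝓘(ℝ, Plane) φ (φ.symm (e.symm y)) :=
      ((contMDiffOn_of_mem_maximalAtlas hφ).contMDiffAt
        (φ.open_source.mem_nhds (φ.map_target (heN hx).2))).mdifferentiableAt (by simp)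
    have hcoe' : ⇑φ' = Ψ ∘ φ := by rw [hφ', OpenPartialHomeomorph.coe_trans, hcoe]
    have hL'' := hL'
    rw [← φ.right_inv (heN hx).2] at hL''
    have hchain : mfderiv 𝓘(ℝ, Plane) 𝓘(ℝ, Plane) (Ψ ∘ φ) (φ.symm (e.symm y)) =
        (mfderiv 𝓘(ℝ, Plane) 𝓘(ℝ, Plane) Ψ (φ (φ.symm (e.symm y)))).comp
          (mfderiv 𝓘(ℝ, Plane) 𝓘(ℝ, Plane) φ (φ.symm (e.symm y))) :=
      mfderiv_comp _ hL''.hasMFDerivAt.mdifferentiableAt hd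
    rw [hL''.hasMFDerivAt.mfderiv, ← hcoe'] at hchain
    exact congrArg (fun A : Plane →L[ℝ] Plane => A (V (φ.symm (e.symm y)))) hchain
  have hd : MDifferentiableAt 𝓘(ℝ, Plane) 𝓘(ℝ, Plane) φ'.symm y :=
    ((contMDiffOn_symm_of_mem_maximalAtlas hmem).contMDiffAt
      (φ'.open_target.mem_nhds (by rw [htgt]; exact hy))).mdifferentiableAt (by simp)
  -- The chain rule for this identity shows that the differential of `φ'.symm` applied to `L' u` is
  -- that of `φ.symm` applied to u, which transfers the metric.
  have heq : (φ'.symm ∘ Ψ) =ᶠ[𝓝 (e.symm y)] φ.symm := by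
    filter_upwards [e.open_source.mem_nhds hx] with z hz
    show φ.symm (e.symm (Ψ z)) = _
    rw [← hcoe, e.left_inv hz]
  have hchain : mfderiv 𝓘(ℝ, Plane) 𝓘(ℝ, Plane) (φ'.symm ∘ Ψ) (e.symm y) =
      (mfderiv 𝓘(ℝ, Plane) 𝓘(ℝ, Plane) φ'.symm (Ψ (e.symm y))).comp
        (mfderiv 𝓘(ℝ, Plane) 𝓘(ℝ, Plane) Ψ (e.symm y)) :=
    mfderiv_comp _ (by rw [hΨx]; exact hd) hL'.hasMFDerivAt.mdifferentiableAt
  have hm : ∀ u : Plane, (mfderiv 𝓘(ℝ, Plane) 𝓘(ℝ, Plane) φ'.symm y (L' u) : Plane) =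
      mfderiv 𝓘(ℝ, Plane) 𝓘(ℝ, Plane) φ.symm (e.symm y) u := by
    intro u
    rw [hL'.hasMFDerivAt.mfderiv, hΨx] at hchain
    have h3 := heq.mfderiv_eq (I := 𝓘(ℝ, Plane)) (I' := 𝓘(ℝ, Plane))
    have h4 := congrArg (fun A : Plane →L[ℝ] Plane => A u) hchain
    have h5 := congrArg (fun A : Plane →L[ℝ] Plane => A u) h3
    exact h4.symm.trans h5
  exact g.inner_mfderiv_congr (σ := φ'.symm) (τ := φ.symm) (x := y) (y := e.symm y) rfl _ _ _ _
    (hm v) (hm w)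

theorem contMDiffOn_mfderiv_symm {φ : OpenPartialHomeomorph M Plane}
    (hφ : φ ∈ maximalAtlas 𝓘(ℝ, Plane) ∞ M) (a : Plane) :
    ContMDiffOn 𝓘(ℝ, Plane) 𝓘(ℝ, Plane).tangent ∞
      (fun y => (⟨φ.symm y, mfderiv 𝓘(ℝ, Plane) 𝓘(ℝ, Plane) φ.symm y a⟩ :
        TangentBundle 𝓘(ℝ, Plane) M)) φ.target := by
  have h1 := (contMDiffOn_symm_of_mem_maximalAtlas hφ).contMDiffOn_tangentMapWithin
    (m := ∞) (by simp) φ.open_target.uniqueMDiffOn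
  have h2 : ContMDiffOn 𝓘(ℝ, Plane) 𝓘(ℝ, Plane).tangent ∞
      (fun y => (⟨y, a⟩ : TangentBundle 𝓘(ℝ, Plane) Plane)) φ.target :=
    contMDiffOn_vectorSpace_iff_contDiffOn.2 contDiffOn_const
  refine (h1.comp h2 fun y hy => hy).congr fun y hy => ?_
  simp only [Function.comp, tangentMapWithin]
  rw [mfderivWithin_of_isOpen φ.open_target hy]

theorem LorentzianMetric.contDiffOn_inChart (g : LorentzianMetric M)
    {φ : OpenPartialHomeomorph M Plane} (hφ : φ ∈ maximalAtlas 𝓘(ℝ, Plane) ∞ M) (a b : Plane) :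
    ContDiffOn ℝ ∞ (fun y => g.inChart φ y a b) φ.target := by
  rw [← contMDiffOn_iff_contDiffOn]
  intro x hx
  have hb := contMDiffOn_symm_of_mem_maximalAtlas hφ x hx
  have : ContMDiffWithinAt 𝓘(ℝ, Plane) (𝓘(ℝ, Plane).prod 𝓘(ℝ)) ∞
      (fun m ↦ Bundle.TotalSpace.mk' ℝ (E := Bundle.Trivial M ℝ) (φ.symm m)
        (g.inChart φ m a b)) φ.target x := by
    apply ContMDiffWithinAt.clm_bundle_apply₂ (F₁ := Plane) (F₂ := Plane)
    · exact ContMDiffAt.comp_contMDiffWithinAt x g.contMDiff.contMDiffAt hb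
    · exact contMDiffOn_mfderiv_symm hφ a x hx
    · exact contMDiffOn_mfderiv_symm hφ b x hx
  simp only [Bundle.contMDiffWithinAt_totalSpace] at this
  exact this.2

theorem LorentzianMetric.contDiffOn_fieldInChart {V : ∀ p : M, TangentSpace 𝓘(ℝ, Plane) p}
    (hV : ContMDiff 𝓘(ℝ, Plane) 𝓘(ℝ, Plane).tangent ∞
      (fun p => (⟨p, V p⟩ : TangentBundle 𝓘(ℝ, Plane) M)))
    {φ : OpenPartialHomeomorph M Plane} (hφ : φ ∈ maximalAtlas 𝓘(ℝ, Plane) ∞ M) :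
    ContDiffOn ℝ ∞ (fieldInChart V φ) φ.target := by
  have h1 := (contMDiffOn_of_mem_maximalAtlas hφ).contMDiffOn_tangentMapWithin
    (m := ∞) (by simp) φ.open_source.uniqueMDiffOn
  have h2 := hV.comp_contMDiffOn (contMDiffOn_symm_of_mem_maximalAtlas hφ)
  have h3 := h1.comp h2 fun y hy => φ.map_target hy
  refine contMDiffOn_vectorSpace_iff_contDiffOn.1 (h3.congr fun y hy => ?_)
  simp only [Function.comp, tangentMapWithin]
  rw [mfderivWithin_of_isOpen φ.open_source (φ.map_target hy)]
  rw [φ.right_inv hy]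
  rfl

namespace LorentzianMetric

variable (g : LorentzianMetric M) {φ : OpenPartialHomeomorph M Plane}

theorem inChart_comm (x v w : Plane) : g.inChart φ x v w = g.inChart φ x w v := g.symm _ _ _

theorem exists_inChart_eq_bilin (x : Plane) : ∃ B : Plane →L[ℝ] Plane →L[ℝ] ℝ,
    ∀ v w, g.inChart φ x v w = B v w := by
  let A : Plane →L[ℝ] Plane := mfderiv 𝓘(ℝ, Plane) 𝓘(ℝ, Plane) φ.symm x
  let G : Plane →L[ℝ] Plane →L[ℝ] ℝ := g.inner (φ.symm x)
  exact ⟨G.bilinearComp A A, fun v w => rfl⟩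

theorem exists_inChart_neg (hφ : φ ∈ maximalAtlas 𝓘(ℝ, Plane) ∞ M) {x : Plane}
    (hx : x ∈ φ.target) : ∃ v, g.inChart φ x v v < 0 := by
  obtain ⟨v, hv⟩ := g.exists_spacelike (φ.symm x)
  exact ⟨mfderiv 𝓘(ℝ, Plane) 𝓘(ℝ, Plane) φ (φ.symm x) v, by
    simp only [inChart]
    rwa [mfderiv_symm_apply_mfderiv hφ hx]⟩

theorem inChart_fieldInChart_pos {V : ∀ p : M, TangentSpace 𝓘(ℝ, Plane) p}
    (hV : ∀ p, 0 < g.inner p (V p) (V p)) (hφ : φ ∈ maximalAtlas 𝓘(ℝ, Plane) ∞ M) {x : Plane}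
    (hx : x ∈ φ.target) : 0 < g.inChart φ x (fieldInChart V φ x) (fieldInChart V φ x) := by
  simp only [inChart, fieldInChart]
  rw [mfderiv_symm_apply_mfderiv hφ hx]
  exact hV _

end LorentzianMetric

end Charts

/-! ### Coordinates adapted to a timelike Killing field -/

/-- The 1-form `P dx₀ + Q dx₁` on the plane. -/
def formOf (P Q : Plane → ℝ) : OneForm Plane :=
  fun x => P x • EuclideanSpace.proj (0 : Fin 2) + Q x • EuclideanSpace.proj (1 : Fin 2)

theorem formOf_apply (P Q : Plane → ℝ) (x v : Plane) :
    formOf P Q x v = P x * v 0 + Q x * v 1 := by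
  simp [formOf]

theorem eq_dirS_add_dirV (v : Plane) : v = v 0 • dirS + v 1 • dirV := by
  ext i; fin_cases i <;> simp [dirS, dirV]

theorem map_eq_dirS_add_dirV (l : Plane →L[ℝ] ℝ) (v : Plane) :
    l v = v 0 * l dirS + v 1 * l dirV := by
  conv_lhs => rw [eq_dirS_add_dirV v]
  simp only [map_add, map_smul, smul_eq_mul]

theorem exists_primitive_of_closed {s : Set Plane} (hs : Convex ℝ s) (hso : IsOpen s)
    {P Q : Plane → ℝ} (hP : ContDiffOn ℝ ∞ P s) (hQ : ContDiffOn ℝ ∞ Q s)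
    (hc : ∀ x ∈ s, fderiv ℝ Q x dirS = fderiv ℝ P x dirV) :
    ∃ h : Plane → ℝ, ContDiffOn ℝ ∞ h s ∧ ∀ x ∈ s, HasFDerivAt h (formOf P Q x) x := by
  have hω : ContDiffOn ℝ ∞ (formOf P Q) s :=
    (hP.smul contDiffOn_const).add (hQ.smul contDiffOn_const)
  have hd : DifferentiableOn ℝ (formOf P Q) s := hω.differentiableOn (by simp)
  obtain ⟨h, hh⟩ := hs.exists_forall_hasFDerivAt_of_fderiv_symmetric hso hd (by
    intro x hx v w
    have hPx := ((hP.contDiffAt (hso.mem_nhds hx)).differentiableAt (by simp)).hasFDerivAt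
    have hQx := ((hQ.contDiffAt (hso.mem_nhds hx)).differentiableAt (by simp)).hasFDerivAt
    have hf : HasFDerivAt (formOf P Q) _ x := (hPx.smul_const
      (EuclideanSpace.proj (0 : Fin 2) : Plane →L[ℝ] ℝ)).add
        (hQx.smul_const (EuclideanSpace.proj (1 : Fin 2) : Plane →L[ℝ] ℝ))
    rw [hf.fderiv]
    have h1 := hc x hx
    simp only [add_apply, ContinuousLinearMap.smulRight_apply,
      smul_apply, PiLp.proj_apply, smul_eq_mul]
    rw [map_eq_dirS_add_dirV (fderiv ℝ P x) v, map_eq_dirS_add_dirV (fderiv ℝ P x) w,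
      map_eq_dirS_add_dirV (fderiv ℝ Q x) v, map_eq_dirS_add_dirV (fderiv ℝ Q x) w]
    linear_combination (v 0 * w 1 - v 1 * w 0) * h1)
  refine ⟨h, (contDiffOn_infty_iff_fderiv_of_isOpen hso).2
    ⟨fun x hx => (hh x hx).differentiableAt.differentiableWithinAt, ?_⟩, hh⟩
  exact hω.congr fun x hx => (hh x hx).fderiv

/-- The Killing equation for the field `p ∂₀ + q ∂₁` and the metric `a dx₀² + 2b dx₀dx₁ + c dx₁²`,
at the point `x`. -/
structure KillingAt (a b c p q : Plane → ℝ) (x : Plane) : Prop where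
  diff_a : DifferentiableAt ℝ a x
  diff_b : DifferentiableAt ℝ b x
  diff_c : DifferentiableAt ℝ c x
  diff_p : DifferentiableAt ℝ p x
  diff_q : DifferentiableAt ℝ q x
  eq₀₀ : p x * fderiv ℝ a x dirS + q x * fderiv ℝ a x dirV
    + 2 * (fderiv ℝ p x dirS * a x + fderiv ℝ q x dirS * b x) = 0
  eq₀₁ : p x * fderiv ℝ b x dirS + q x * fderiv ℝ b x dirV
    + (fderiv ℝ p x dirS * b x + fderiv ℝ q x dirS * c x)
    + (fderiv ℝ p x dirV * a x + fderiv ℝ q x dirV * b x) = 0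
  eq₁₁ : p x * fderiv ℝ c x dirS + q x * fderiv ℝ c x dirV
    + 2 * (fderiv ℝ p x dirV * b x + fderiv ℝ q x dirV * c x) = 0

/-- The square length of `p ∂₀ + q ∂₁`. -/
def sqLength (a b c p q : Plane → ℝ) (y : Plane) : ℝ :=
  a y * p y ^ 2 + 2 * b y * p y * q y + c y * q y ^ 2

namespace KillingAt

variable {a b c p q : Plane → ℝ} {x : Plane} (h : KillingAt a b c p q x)
include h

theorem hasFDerivAt_sqLength : HasFDerivAt (sqLength a b c p q)
    (p x ^ 2 • fderiv ℝ a x + (2 * p x * q x) • fderiv ℝ b x + q x ^ 2 • fderiv ℝ c x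
      + (2 * (a x * p x + b x * q x)) • fderiv ℝ p x
      + (2 * (b x * p x + c x * q x)) • fderiv ℝ q x) x := by
  have h1 := ((h.diff_a.hasFDerivAt.mul (h.diff_p.hasFDerivAt.pow 2)).add
    (((h.diff_b.hasFDerivAt.const_mul 2).mul h.diff_p.hasFDerivAt).mul
      h.diff_q.hasFDerivAt)).add (h.diff_c.hasFDerivAt.mul (h.diff_q.hasFDerivAt.pow 2))
  refine h1.congr_fderiv ?_
  ext v
  simp
  ring

/-- The form α = X^♭/|X|² is invariant under X and α(X) = 1, so ι_X dα = L_X α - d(α(X)) = 0, which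
in dimension two gives dα = 0. The computation is this argument in components. -/
theorem dual_closed (hN : sqLength a b c p q x ≠ 0) :
    fderiv ℝ (fun y => (b y * p y + c y * q y) / sqLength a b c p q y) x dirS =
      fderiv ℝ (fun y => (a y * p y + b y * q y) / sqLength a b c p q y) x dirV := by
  have hNd := h.hasFDerivAt_sqLength
  have h1 := ((h.diff_b.hasFDerivAt.mul h.diff_p.hasFDerivAt).add
    (h.diff_c.hasFDerivAt.mul h.diff_q.hasFDerivAt)).mul
      ((hasDerivAt_inv hN).comp_hasFDerivAt x hNd)
  have h0 := ((h.diff_a.hasFDerivAt.mul h.diff_p.hasFDerivAt).add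
    (h.diff_b.hasFDerivAt.mul h.diff_q.hasFDerivAt)).mul
      ((hasDerivAt_inv hN).comp_hasFDerivAt x hNd)
  have e1 : (fun y => (b y * p y + c y * q y) / sqLength a b c p q y) =
      (b * p + c * q) * (Inv.inv ∘ sqLength a b c p q) := by ext y; simp [div_eq_mul_inv]
  have e0 : (fun y => (a y * p y + b y * q y) / sqLength a b c p q y) =
      (a * p + b * q) * (Inv.inv ∘ sqLength a b c p q) := by ext y; simp [div_eq_mul_inv]
  rw [e1, e0, h1.fderiv, h0.fderiv]
  have k1 := h.eq₀₀
  have k2 := h.eq₀₁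
  have k3 := h.eq₁₁
  have hNe : sqLength a b c p q x =
    a x * p x ^ 2 + 2 * b x * p x * q x + c x * q x ^ 2 := rfl
  simp only [add_apply, smul_apply, smul_eq_mul,
    Pi.add_apply, Pi.mul_apply, Function.comp]
  generalize sqLength a b c p q x = n at *
  generalize fderiv ℝ a x dirS = as at *
  generalize fderiv ℝ a x dirV = av at *
  generalize fderiv ℝ b x dirS = bs at *
  generalize fderiv ℝ b x dirV = bv at *
  generalize fderiv ℝ c x dirS = cs at *
  generalize fderiv ℝ c x dirV = cv at *
  generalize fderiv ℝ p x dirS = ps at *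
  generalize fderiv ℝ p x dirV = pv at *
  generalize fderiv ℝ q x dirS = qs at *
  generalize fderiv ℝ q x dirV = qv at *
  generalize a x = a at *
  generalize b x = b at *
  generalize c x = c at *
  generalize p x = p at *
  generalize q x = q at *
  field_simp
  subst hNe
  linear_combination (-(b * p + c * q)) * (k1 * p + k2 * q) + (a * p + b * q) * (k2 * p + k3 * q)

/-- The form μ(p dx₁ - q dx₀) is the contraction of X with the area form, divided up to sign by |X|.
It is invariant under X and vanishes on X, hence is closed. The derivatives of μ come from
differentiating `hμe`. -/
theorem sq_closed {μ : Plane → ℝ} (hμ : DifferentiableAt ℝ μ x) (hμ0 : μ x ≠ 0)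
    (hN : sqLength a b c p q x ≠ 0)
    (hμe : ∀ᶠ y in 𝓝 x, sqLength a b c p q y * μ y ^ 2 = b y ^ 2 - a y * c y) :
    fderiv ℝ (fun y => μ y * p y) x dirS = fderiv ℝ (fun y => -(μ y * q y)) x dirV := by
  have h1 := h.hasFDerivAt_sqLength.mul (hμ.hasFDerivAt.pow 2)
  have h2 := (h.diff_b.hasFDerivAt.pow 2).sub (h.diff_a.hasFDerivAt.mul h.diff_c.hasFDerivAt)
  have hD := (h1.congr_of_eventuallyEq (f₁ := (b ^ 2 - a * c)) (by
    filter_upwards [hμe] with y hy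
    simpa using hy.symm)).unique h2
  have e1 := congrArg (fun l : Plane →L[ℝ] ℝ => l dirS) hD
  have e2 := congrArg (fun l : Plane →L[ℝ] ℝ => l dirV) hD
  have he := hμe.self_of_nhds
  have hP : HasFDerivAt (fun y => μ y * p y) _ x := hμ.hasFDerivAt.mul h.diff_p.hasFDerivAt
  have hQ : HasFDerivAt (fun y => -(μ y * q y)) _ x :=
    (hμ.hasFDerivAt.mul h.diff_q.hasFDerivAt).neg
  rw [hP.fderiv, hQ.fderiv]
  have k1 := h.eq₀₀
  have k2 := h.eq₀₁
  have k3 := h.eq₁₁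
  have hNe : sqLength a b c p q x =
    a x * p x ^ 2 + 2 * b x * p x * q x + c x * q x ^ 2 := rfl
  simp only [add_apply, sub_apply,
    neg_apply, smul_apply, smul_eq_mul,
    nsmul_eq_mul, Nat.cast_ofNat, Nat.add_one_sub_one, pow_one] at e1 e2 ⊢
  generalize sqLength a b c p q x = n at *
  generalize fderiv ℝ a x dirS = as at *
  generalize fderiv ℝ a x dirV = av at *
  generalize fderiv ℝ b x dirS = bs at *
  generalize fderiv ℝ b x dirV = bv at *
  generalize fderiv ℝ c x dirS = cs at *
  generalize fderiv ℝ c x dirV = cv at *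
  generalize fderiv ℝ p x dirS = ps at *
  generalize fderiv ℝ p x dirV = pv at *
  generalize fderiv ℝ q x dirS = qs at *
  generalize fderiv ℝ q x dirV = qv at *
  generalize fderiv ℝ μ x dirS = ms at *
  generalize fderiv ℝ μ x dirV = mv at *
  generalize a x = a at *
  generalize b x = b at *
  generalize c x = c at *
  generalize p x = p at *
  generalize q x = q at *
  generalize μ x = m at *
  have hdet : (2 * n * m) * (m * ps + p * ms - -(m * qv + q * mv)) = 0 := by
    linear_combination p * e1 + q * e2 + 2 * (ps + qv) * he - c * k1 - a * k3 + 2 * b * k2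
      - m ^ 2 * (p ^ 2 * k1 + 2 * p * q * k2 + q ^ 2 * k3)
  have := (mul_eq_zero.1 hdet).resolve_left (by positivity)
  linear_combination this

end KillingAt

/-- Coordinates adapted to a Killing field `X` of positive square length: in them `X = ∂₁` and the
metric is `N dx₁² - dx₀²` with `N` the square length of `X`. -/
theorem exists_adapted_map {U : Set Plane} (hU : IsOpen U) {x₀ : Plane} (hx₀ : x₀ ∈ U)
    {G : Plane → Plane → Plane → ℝ}
    (hB : ∀ x, ∃ B : Plane →L[ℝ] Plane →L[ℝ] ℝ, ∀ v w, G x v w = B v w)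
    (hsymm : ∀ x v w, G x v w = G x w v)
    (hsm : ∀ v w, ContDiffOn ℝ ∞ (fun y => G y v w) U) {X : Plane → Plane}
    (hX : ContDiffOn ℝ ∞ X U) (hpos : ∀ x ∈ U, 0 < G x (X x) (X x))
    (hneg : ∀ x ∈ U, ∃ v, G x v v < 0)
    (hkill : ∀ x ∈ U, ∀ v w, fderiv ℝ (fun y => G y v w) x (X x) + G x (fderiv ℝ X x v) w
      + G x v (fderiv ℝ X x w) = 0) :
    ∃ N ⊆ U, IsOpen N ∧ x₀ ∈ N ∧ ∃ Ψ : Plane → Plane, ContDiffOn ℝ ∞ Ψ N ∧ ∀ x ∈ N,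
      (∃ L : Plane ≃L[ℝ] Plane, HasFDerivAt Ψ (L : Plane →L[ℝ] Plane) x) ∧
      ∀ L : Plane →L[ℝ] Plane, HasFDerivAt Ψ L x → L (X x) = dirV ∧
        ∀ v w, G x v w = G x (X x) (X x) * (L v 1 * L w 1) - L v 0 * L w 0 := by
  obtain ⟨r, hr, hrU⟩ := Metric.isOpen_iff.1 hU x₀ hx₀
  set a : Plane → ℝ := fun y => G y dirS dirS with ha
  set b : Plane → ℝ := fun y => G y dirS dirV with hb
  set c : Plane → ℝ := fun y => G y dirV dirV with hc
  set p : Plane → ℝ := fun y => X y 0 with hp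
  set q : Plane → ℝ := fun y => X y 1 with hq
  have hG : ∀ x v w, G x v w = a x * (v 0 * w 0) + b x * (v 0 * w 1 + v 1 * w 0)
      + c x * (v 1 * w 1) := by
    intro x v w
    obtain ⟨B, hB⟩ := hB x
    have h1 := hsymm x dirV dirS
    simp only [ha, hb, hc, hB] at h1 ⊢
    conv_lhs => rw [eq_dirS_add_dirV v, eq_dirS_add_dirV w]
    simp only [map_add, map_smul, smul_eq_mul, add_apply, smul_apply, h1]
    ring
  have hN : ∀ x, sqLength a b c p q x = G x (X x) (X x) := fun x => by
    rw [hG, sqLength]; ring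
  have hpsm : ContDiffOn ℝ ∞ p U := contDiffOn_euclidean.1 hX 0
  have hqsm : ContDiffOn ℝ ∞ q U := contDiffOn_euclidean.1 hX 1
  have hda : ∀ x ∈ U, DifferentiableAt ℝ a x := fun x hx =>
    ((hsm dirS dirS).contDiffAt (hU.mem_nhds hx)).differentiableAt (by simp)
  have hdb : ∀ x ∈ U, DifferentiableAt ℝ b x := fun x hx =>
    ((hsm dirS dirV).contDiffAt (hU.mem_nhds hx)).differentiableAt (by simp)
  have hdc : ∀ x ∈ U, DifferentiableAt ℝ c x := fun x hx =>
    ((hsm dirV dirV).contDiffAt (hU.mem_nhds hx)).differentiableAt (by simp)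
  have hdp : ∀ x ∈ U, DifferentiableAt ℝ p x := fun x hx =>
    (hpsm.contDiffAt (hU.mem_nhds hx)).differentiableAt (by simp)
  have hdq : ∀ x ∈ U, DifferentiableAt ℝ q x := fun x hx =>
    (hqsm.contDiffAt (hU.mem_nhds hx)).differentiableAt (by simp)
  have hK : ∀ x ∈ U, KillingAt a b c p q x := by
    intro x hx
    have hXd := ((hX.contDiffAt (hU.mem_nhds hx)).differentiableAt (by simp)).hasFDerivAt
    have hp' : ∀ v, (fderiv ℝ X x v) 0 = fderiv ℝ p x v := fun v => by
      have h1 : HasFDerivAt p _ x :=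
        (EuclideanSpace.proj (0 : Fin 2) : Plane →L[ℝ] ℝ).hasFDerivAt.comp x hXd
      rw [h1.fderiv]; rfl
    have hq' : ∀ v, (fderiv ℝ X x v) 1 = fderiv ℝ q x v := fun v => by
      have h1 : HasFDerivAt q _ x :=
        (EuclideanSpace.proj (1 : Fin 2) : Plane →L[ℝ] ℝ).hasFDerivAt.comp x hXd
      rw [h1.fderiv]; rfl
    have k0 := hkill x hx dirS dirS
    have k1 := hkill x hx dirS dirV
    have k2 := hkill x hx dirV dirV
    rw [hG x (fderiv ℝ X x _), hG x _ (fderiv ℝ X x _), map_eq_dirS_add_dirV _ (X x)] at k0 k1 k2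
    simp only [hp', hq'] at k0 k1 k2
    refine ⟨hda x hx, hdb x hx, hdc x hx, hdp x hx, hdq x hx, ?_, ?_, ?_⟩
    · simp [dirS, dirV] at k0 ⊢
      linear_combination k0
    · simp [dirS, dirV] at k1 ⊢
      linear_combination k1
    · simp [dirS, dirV] at k2 ⊢
      linear_combination k2
  have hNpos : ∀ x ∈ U, 0 < sqLength a b c p q x := fun x hx => hN x ▸ hpos x hx
  -- Lagrange's identity N g = (X^♭)² - (b² - ac)(p dx₁ - q dx₀)². It gives the sign of the
  -- determinant now and the diagonal form of the metric at the end.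
  have hlag : ∀ x (v w : Plane), sqLength a b c p q x * G x v w =
      ((a x * p x + b x * q x) * v 0 + (b x * p x + c x * q x) * v 1) *
        ((a x * p x + b x * q x) * w 0 + (b x * p x + c x * q x) * w 1)
      - (b x ^ 2 - a x * c x) * ((p x * v 1 - q x * v 0) * (p x * w 1 - q x * w 0)) := by
    intro x v w
    rw [hG, sqLength]; ring
  have hdet : ∀ x ∈ U, 0 < b x ^ 2 - a x * c x := by
    intro x hx
    obtain ⟨v, hv⟩ := hneg x hx
    have h1 := hlag x v v
    by_contra! hle
    have h2 := mul_neg_of_pos_of_neg (hNpos x hx) hv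
    nlinarith [mul_nonneg (neg_nonneg.2 hle) (mul_self_nonneg (p x * v 1 - q x * v 0)),
      mul_self_nonneg ((a x * p x + b x * q x) * v 0 + (b x * p x + c x * q x) * v 1)]
  have hNsm : ContDiffOn ℝ ∞ (sqLength a b c p q) U :=
    (((hsm dirS dirS).mul (hpsm.pow 2)).add
      (((contDiffOn_const.mul (hsm dirS dirV)).mul hpsm).mul hqsm)).add
        ((hsm dirV dirV).mul (hqsm.pow 2))
  -- The factor that makes μ(p dx₁ - q dx₀) have square length -1.
  set μ : Plane → ℝ := fun y => Real.sqrt ((b y ^ 2 - a y * c y) / sqLength a b c p q y) with hμ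
  have hquot : ∀ x ∈ U, 0 < (b x ^ 2 - a x * c x) / sqLength a b c p q x := fun x hx =>
    div_pos (hdet x hx) (hNpos x hx)
  have hμsm : ContDiffOn ℝ ∞ μ U :=
    ((((hsm dirS dirV).pow 2).sub ((hsm dirS dirS).mul (hsm dirV dirV))).div hNsm
      fun x hx => (hNpos x hx).ne').sqrt fun x hx => (hquot x hx).ne'
  have hμe : ∀ x ∈ U, sqLength a b c p q x * μ x ^ 2 = b x ^ 2 - a x * c x := fun x hx => by
    rw [hμ, Real.sq_sqrt (hquot x hx).le]
    field_simp [(hNpos x hx).ne']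
  have hμ0 : ∀ x ∈ U, μ x ≠ 0 := fun x hx => (Real.sqrt_pos.2 (hquot x hx)).ne'
  clear_value a b c p q μ
  have hA0 : ContDiffOn ℝ ∞ (fun y => (a y * p y + b y * q y) / sqLength a b c p q y) U := by
    subst ha hb hc
    exact (((hsm dirS dirS).mul hpsm).add ((hsm dirS dirV).mul hqsm)).div hNsm
      fun x hx => (hNpos x hx).ne'
  have hA1 : ContDiffOn ℝ ∞ (fun y => (b y * p y + c y * q y) / sqLength a b c p q y) U := by
    subst ha hb hc
    exact (((hsm dirS dirV).mul hpsm).add ((hsm dirV dirV).mul hqsm)).div hNsm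
      fun x hx => (hNpos x hx).ne'
  obtain ⟨t, htsm, ht⟩ := exists_primitive_of_closed (convex_ball x₀ r) Metric.isOpen_ball
    (hA0.mono hrU) (hA1.mono hrU)
    fun x hx => (hK x (hrU hx)).dual_closed (hNpos x (hrU hx)).ne'
  obtain ⟨s, hssm, hs⟩ := exists_primitive_of_closed (convex_ball x₀ r) Metric.isOpen_ball
    (P := fun y => -(μ y * q y)) (Q := fun y => μ y * p y)
    ((hμsm.mul hqsm).neg.mono hrU) ((hμsm.mul hpsm).mono hrU)
    fun x hx => (hK x (hrU hx)).sq_closed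
      ((hμsm.contDiffAt (hU.mem_nhds (hrU hx))).differentiableAt (by simp)) (hμ0 x (hrU hx))
      (hNpos x (hrU hx)).ne'
      (Filter.eventually_of_mem (hU.mem_nhds (hrU hx)) hμe)
  refine ⟨Metric.ball x₀ r, hrU, Metric.isOpen_ball, Metric.mem_ball_self hr,
    fun y => s y • dirS + t y • dirV,
    (hssm.smul contDiffOn_const).add (htsm.smul contDiffOn_const), fun x hx => ?_⟩
  have hΨ := ((hs x hx).smul_const dirS).add ((ht x hx).smul_const dirV)
  set L₀ := (formOf (fun y => -(μ y * q y)) (fun y => μ y * p y) x).smulRight dirS +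
    (formOf (fun y => (a y * p y + b y * q y) / sqLength a b c p q y)
      (fun y => (b y * p y + c y * q y) / sqLength a b c p q y) x).smulRight dirV with hL₀
  have hL0 : ∀ v : Plane, L₀ v 0 = μ x * (p x * v 1 - q x * v 0) := fun v => by
    simp [hL₀, formOf_apply, dirS, dirV]; ring
  have hL1 : ∀ v : Plane, L₀ v 1 = ((a x * p x + b x * q x) * v 0 +
      (b x * p x + c x * q x) * v 1) / sqLength a b c p q x := fun v => by
    simp [hL₀, formOf_apply, dirS, dirV]; ring
  have hxU := hrU hx
  have hn0 := (hNpos x hxU).ne'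
  have hpx : p x = X x 0 := by rw [hp]
  have hqx : q x = X x 1 := by rw [hq]
  clear_value L₀
  refine ⟨?_, fun L hL => ?_⟩
  · have hinj : Function.Injective (L₀ : Plane →ₗ[ℝ] Plane) := by
      rw [injective_iff_map_eq_zero]
      intro v hv
      have h0 : L₀ v 0 = 0 := by
        have := congrArg (fun u : Plane => u 0) hv
        simpa using this
      have h1 : L₀ v 1 = 0 := by
        have := congrArg (fun u : Plane => u 1) hv
        simpa using this
      rw [hL0] at h0
      rw [hL1] at h1
      have h0' := (mul_eq_zero.1 h0).resolve_left (hμ0 x hxU)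
      have h1' := (div_eq_zero_iff.1 h1).resolve_right hn0
      have e0 : sqLength a b c p q x * v 0 = 0 := by
        rw [sqLength]
        linear_combination p x * h1' - (b x * p x + c x * q x) * h0'
      have e1 : sqLength a b c p q x * v 1 = 0 := by
        rw [sqLength]
        linear_combination q x * h1' + (a x * p x + b x * q x) * h0'
      ext i
      fin_cases i
      · simpa [hn0] using e0
      · simpa [hn0] using e1
    refine ⟨(LinearEquiv.ofInjectiveEndo (L₀ : Plane →ₗ[ℝ] Plane) hinj).toContinuousLinearEquiv,
      hΨ.congr_fderiv ?_⟩
    ext v : 1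
    rfl
  · rw [hL.unique hΨ]
    constructor
    · ext i
      fin_cases i
      · show L₀ (X x) 0 = _
        rw [hL0, ← hpx, ← hqx]
        simp [dirV]; right; ring
      · show L₀ (X x) 1 = _
        rw [hL1, ← hpx, ← hqx]
        rw [show (a x * p x + b x * q x) * p x + (b x * p x + c x * q x) * q x =
          sqLength a b c p q x by rw [sqLength]; ring, div_self hn0]
        simp [dirV]
    · intro v w
      rw [hL0, hL0, hL1, hL1, ← hN]
      have h1 := hlag x v w
      have h2 := hμe x hxU
      apply mul_left_cancel₀ hn0
      rw [h1, ← h2]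
      field_simp

theorem dist_smul_dirS_add (c : Plane) (s : ℝ) :
    dist (s • dirS + c 1 • dirV) c = |s - c 0| := by
  rw [dist_eq_norm]
  conv_lhs => enter [1, 2]; rw [eq_dirS_add_dirV c]
  rw [add_sub_add_right_eq_sub, ← sub_smul, norm_smul, Real.norm_eq_abs]
  simp [dirS]

theorem abs_sub_le_dist (x c : Plane) : |x 0 - c 0| ≤ dist x c := by
  rw [dist_eq_norm]
  exact PiLp.norm_apply_le (x - c) 0

/-- A function on a ball whose derivative in the direction `dirV` vanishes depends only on the
first coordinate. -/
theorem eq_on_ball_of_fderiv_dirV_eq_zero {H : Plane → ℝ} {c : Plane} {r : ℝ}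
    (hH : DifferentiableOn ℝ H (Metric.ball c r))
    (h0 : ∀ x ∈ Metric.ball c r, fderiv ℝ H x dirV = 0) {x : Plane} (hx : x ∈ Metric.ball c r) :
    H x = H (x 0 • dirS + c 1 • dirV) := by
  set γ : ℝ → Plane := fun t => x 0 • dirS + t • dirV with hγ
  have hγd : ∀ t, HasDerivAt γ dirV t := fun t => by
    have h := ((hasDerivAt_id t).smul_const dirV).const_add (x 0 • dirS)
    rwa [one_smul] at h
  have hγc : Continuous γ := continuous_iff_continuousAt.2 fun t => (hγd t).continuousAt
  set J : Set ℝ := γ ⁻¹' Metric.ball c r with hJ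
  have hJo : IsOpen J := Metric.isOpen_ball.preimage hγc
  have hJc : Convex ℝ J := by
    intro t ht u hu a b ha hb hab
    have h := convex_ball c r ht hu ha hb hab
    show γ (a • t + b • u) ∈ Metric.ball c r
    have e : γ (a • t + b • u) = a • γ t + b • γ u := by
      calc γ (a • t + b • u) = (a + b) • (x 0 • dirS) + (a • t + b • u) • dirV := by
            rw [hab, one_smul]
        _ = a • γ t + b • γ u := by simp only [hγ, smul_eq_mul]; module
    rwa [e]
  have hd : ∀ t ∈ J, HasDerivAt (H ∘ γ) 0 t := fun t ht => by
    have := ((hH.differentiableAt (Metric.isOpen_ball.mem_nhds ht)).hasFDerivAt).comp_hasDerivAt t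
      (hγd t)
    rwa [h0 _ ht] at this
  have h1 : γ (x 1) = x := (eq_dirS_add_dirV x).symm
  have hx1 : x 1 ∈ J := by show γ (x 1) ∈ Metric.ball c r; rwa [h1]
  -- Moving a point to the height of the centre does not increase its distance from the centre, so
  -- the foot stays in the ball.
  have hc1 : c 1 ∈ J := by
    show dist (x 0 • dirS + c 1 • dirV) c < r
    rw [dist_smul_dirS_add]
    exact (abs_sub_le_dist x c).trans_lt hx
  have h2 := hJo.is_const_of_deriv_eq_zero hJc.isPreconnected
    (fun t ht => (hd t ht).differentiableAt.differentiableWithinAt)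
    (fun t ht => (hd t ht).deriv) hx1 hc1
  simpa only [Function.comp, h1] using h2

section Charts

variable {M : Type*} [TopologicalSpace M] [ChartedSpace Plane M] [IsManifold 𝓘(ℝ, Plane) ∞ M]

open IsManifold LorentzianMetric

/-- Near every point, a Lorentzian metric with a timelike Killing field has the form
`F(s)² dv² - ds²`. -/
theorem LorentzianMetric.exists_warped_chart (g : LorentzianMetric M)
    {V : ∀ p : M, TangentSpace 𝓘(ℝ, Plane) p} (killing : g.IsKilling V)
    (timelike : ∀ p, 0 < g.inner p (V p) (V p)) (p : M) :
    ∃ φ ∈ maximalAtlas 𝓘(ℝ, Plane) ∞ M, p ∈ φ.source ∧ ∃ r > 0,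
      φ.target = Metric.ball (φ p) r ∧ ∃ F : ℝ → ℝ,
        ContDiffOn ℝ ∞ F (Metric.ball (φ p 0) r) ∧ (∀ s ∈ Metric.ball (φ p 0) r, 0 < F s) ∧
        ∀ x ∈ φ.target, ∀ v w,
          g.inChart φ x v w = F (x 0) ^ 2 * (v 1 * w 1) - v 0 * w 0 := by
  set φ := chartAt Plane p with hφdef
  have hφ : φ ∈ maximalAtlas 𝓘(ℝ, Plane) ∞ M := chart_mem_maximalAtlas p
  have hp : p ∈ φ.source := mem_chart_source Plane p
  clear_value φ
  obtain ⟨N, hNU, hNo, hpN, Ψ, hΨ, hN⟩ := exists_adapted_map φ.open_target (φ.map_source hp)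
    (G := g.inChart φ) (g.exists_inChart_eq_bilin) g.inChart_comm (g.contDiffOn_inChart hφ)
    (contDiffOn_fieldInChart killing.contMDiff hφ)
    (fun x hx => g.inChart_fieldInChart_pos timelike hφ hx)
    (fun x hx => g.exists_inChart_neg hφ hx) (killing.lie_eq_zero φ hφ)
  obtain ⟨⟨L, hL⟩, -⟩ := hN _ hpN
  obtain ⟨r, hr, φ', hφ', hp', hφp, ht, -, hch⟩ :=
    exists_chart_of_localDiffeo g hφ hp hNo hΨ hpN hL Filter.univ_mem
  rw [← hφp] at ht
  have hfield : ∀ y ∈ φ'.target, fieldInChart V φ' y = dirV := by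
    intro y hy
    obtain ⟨x, hx, -, -, L', hL', hV, -⟩ := hch y hy
    rw [hV V]
    exact ((hN x hx.1).2 _ hL').1
  set H : Plane → ℝ := fun y => g.inChart φ' y dirV dirV with hH
  have hHform : ∀ y ∈ φ'.target, 0 < H y ∧ ∀ v w,
      g.inChart φ' y v w = H y * (v 1 * w 1) - v 0 * w 0 := by
    intro y hy
    obtain ⟨x, hx, -, -, L', hL', -, hG⟩ := hch y hy
    have h1 := (hN x hx.1).2 _ hL'
    have h2 : ∀ v w : Plane, g.inChart φ' y v w =
        g.inChart φ x (fieldInChart V φ x) (fieldInChart V φ x) * (v 1 * w 1) - v 0 * w 0 := by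
      intro v w
      have h3 := hG (L'.symm v) (L'.symm w)
      rw [h1.2] at h3
      simpa using h3
    have h4 : H y = g.inChart φ x (fieldInChart V φ x) (fieldInChart V φ x) := by
      rw [hH]; show g.inChart φ' y dirV dirV = _; rw [h2]; simp [dirV]
    rw [h4]
    exact ⟨g.inChart_fieldInChart_pos timelike hφ hx.2, h2⟩
  have hHsm : ContDiffOn ℝ ∞ H φ'.target := g.contDiffOn_inChart hφ' _ _
  -- The Killing field is the constant field ∂₁ in this chart, so the Killing equation reduces to
  -- ∂₁H = 0.
  have hH0 : ∀ y ∈ φ'.target, fderiv ℝ H y dirV = 0 := by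
    intro y hy
    have h1 := killing.lie_eq_zero φ' hφ' y hy dirV dirV
    have h2 : fderiv ℝ (fieldInChart V φ') y = 0 := by
      have : fieldInChart V φ' =ᶠ[𝓝 y] fun _ => dirV :=
        Filter.eventually_of_mem (φ'.open_target.mem_nhds hy) hfield
      rw [this.fderiv_eq]; simp
    rw [hfield y hy, h2, (hHform y hy).2, (hHform y hy).2] at h1
    simpa using h1
  set c := φ' p with hc
  have hcI : ∀ s ∈ Metric.ball (c 0) r, s • dirS + c 1 • dirV ∈ φ'.target := fun s hs => by
    rw [ht, Metric.mem_ball, dist_smul_dirS_add]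
    exact hs
  -- H depends only on s, so F is √H along the line through the centre of the ball in the direction
  -- ∂₀.
  refine ⟨φ', hφ', hp', r, hr, ht, fun s => Real.sqrt (H (s • dirS + c 1 • dirV)), ?_,
    fun s hs => Real.sqrt_pos.2 (hHform _ (hcI s hs)).1, fun x hx v w => ?_⟩
  · have : ContDiff ℝ ∞ fun s : ℝ => s • dirS + c 1 • dirV := by fun_prop
    exact (hHsm.comp this.contDiffOn hcI).sqrt fun s hs => (hHform _ (hcI s hs)).1.ne'
  · have hx' := hx
    rw [ht] at hx'
    rw [(hHform x hx).2, eq_on_ball_of_fderiv_dirV_eq_zero (H := H)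
      (by rw [← ht]; exact hHsm.differentiableOn (by simp)) (by rw [← ht]; exact hH0) hx',
      Real.sq_sqrt (hHform _ (hcI _ ((abs_sub_le_dist x c).trans_lt hx'))).1.le]

end Charts

/-! ### Warped metrics and integration of the curvature equation -/

theorem extD_etaV {f : ℝ → ℝ} {x : Plane} (hf : DifferentiableAt ℝ f (x 0)) (v w : Plane) :
    extD (etaV f) x v w = deriv f (x 0) * (v 0 * w 1 - w 0 * v 1) := by
  have h0 : HasFDerivAt (fun y : Plane => y 0) (EuclideanSpace.proj (0 : Fin 2) : Plane →L[ℝ] ℝ) x :=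
    (EuclideanSpace.proj (0 : Fin 2) : Plane →L[ℝ] ℝ).hasFDerivAt
  have h1 : HasFDerivAt (etaV f) _ x := (hf.hasDerivAt.comp_hasFDerivAt x h0).smul_const
    (EuclideanSpace.proj (1 : Fin 2) : Plane →L[ℝ] ℝ)
  rw [extD, h1.fderiv]
  simp
  ring

theorem isOrthonormalCoframing_warped {G : Plane → Plane → Plane → ℝ} {D : Set Plane}
    (hD : IsOpen D) {f : ℝ → ℝ} {I : Set ℝ} (hI : IsOpen I) (hf : ContDiffOn ℝ ∞ f I)
    (hDI : ∀ x ∈ D, x 0 ∈ I)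
    (hG : ∀ x ∈ D, ∀ v w, G x v w = f (x 0) ^ 2 * (v 1 * w 1) - v 0 * w 0) :
    IsOrthonormalCoframing G D (etaV f) etaS (etaV (deriv f)) where
  isOpen := hD
  smooth₁ := contDiffOn_etaV hf hDI
  smooth₂ := contDiffOn_const
  smooth₁₂ := contDiffOn_etaV (hf.deriv_of_isOpen hI (by simp)) hDI
  metric_eq x hx v w := by
    rw [hG x hx]
    simp [etaV, etaS]
    ring
  structure₁ x hx v w := by
    rw [extD_etaV ((hf.contDiffAt (hI.mem_nhds (hDI x hx))).differentiableAt (by simp))]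
    simp [wedge, etaV, etaS]
    ring
  structure₂ x hx v w := by
    have h0 : fderiv ℝ etaS x = 0 := fderiv_const_apply _
    have h : extD etaS x v w = 0 := by simp [extD, h0]
    rw [h]
    simp [wedge, etaV]
    ring

theorem eq_zero_deriv_const {I : Set ℝ} (hI : IsOpen I) (hIc : IsPreconnected I) {h : ℝ → ℝ}
    (hd : ∀ s ∈ I, HasDerivAt h 0 s) {s t : ℝ} (hs : s ∈ I) (ht : t ∈ I) : h s = h t :=
  hI.is_const_of_deriv_eq_zero hIc
    (fun u hu => (hd u hu).differentiableAt.differentiableWithinAt)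
    (fun u hu => (hd u hu).deriv) hs ht

/-- First integrals of the equations `F'' = -k² F`, `k' F' = -2 k³ F`. -/
theorem exists_first_integrals {I : Set ℝ} (hI : IsOpen I) (hIc : IsPreconnected I)
    {s₀ : ℝ} (hs₀ : s₀ ∈ I) {F k : ℝ → ℝ} (hF : ContDiffOn ℝ ∞ F I) (hk : ContDiffOn ℝ ∞ k I)
    (hF0 : ∀ s ∈ I, 0 < F s) (hk0 : ∀ s ∈ I, 0 < k s)
    (hF2 : ∀ s ∈ I, deriv (deriv F) s = -(k s ^ 2 * F s))
    (hk1 : ∀ s ∈ I, deriv k s * deriv F s = -2 * k s ^ 3 * F s) :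
    ∃ l > 0, ∃ C, ∀ s ∈ I, deriv F s ≠ 0 ∧ k s = l * deriv F s ^ 2 ∧
      deriv F s ^ 2 * (l ^ 2 * F s ^ 2 + C) = 1 := by
  have hF1 : ∀ s ∈ I, deriv F s ≠ 0 := by
    intro s hs h
    have h1 := hk1 s hs
    rw [h, mul_zero] at h1
    have := mul_pos (pow_pos (hk0 s hs) 3) (hF0 s hs)
    linarith
  have hFd : ∀ s ∈ I, HasDerivAt F (deriv F s) s := fun s hs =>
    ((hF.contDiffAt (hI.mem_nhds hs)).differentiableAt (by simp)).hasDerivAt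
  have hkd : ∀ s ∈ I, HasDerivAt k (deriv k s) s := fun s hs =>
    ((hk.contDiffAt (hI.mem_nhds hs)).differentiableAt (by simp)).hasDerivAt
  have hFd2 : ∀ s ∈ I, HasDerivAt (deriv F) (-(k s ^ 2 * F s)) s := fun s hs => by
    rw [← hF2 s hs]
    exact (((hF.deriv_of_isOpen hI (m := ∞) (by simp)).contDiffAt
      (hI.mem_nhds hs)).differentiableAt (by simp)).hasDerivAt
  -- The numerator is F'(k'F' - 2kF''), and both k'F' and 2kF'' equal -2k³F.
  have hl : ∀ s ∈ I, HasDerivAt (fun s => k s / deriv F s ^ 2) 0 s := fun s hs => by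
    refine ((hkd s hs).div ((hFd2 s hs).pow 2) (pow_ne_zero 2 (hF1 s hs))).congr_deriv ?_
    have h1 := hk1 s hs
    have h2 := hF1 s hs
    rw [div_eq_zero_iff]
    left
    simp
    linear_combination deriv F s * h1
  set l := k s₀ / deriv F s₀ ^ 2 with hldef
  have hkl : ∀ s ∈ I, k s = l * deriv F s ^ 2 := fun s hs => by
    rw [hldef, eq_zero_deriv_const hI hIc hl hs₀ hs]
    field_simp [hF1 s hs]
  -- With k = lF'² one has (1/F'²)' = 2k²F/F'³ = 2l²FF'.
  have hC : ∀ s ∈ I, HasDerivAt (fun s => 1 / deriv F s ^ 2 - l ^ 2 * F s ^ 2) 0 s := fun s hs => by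
    refine ((((hasDerivAt_const s (1 : ℝ)).div ((hFd2 s hs).pow 2)
      (pow_ne_zero 2 (hF1 s hs)))).sub (((hFd s hs).pow 2).const_mul (l ^ 2))).congr_deriv ?_
    have h2 := hF1 s hs
    rw [hkl s hs]
    simp
    field_simp
    ring
  have hlpos : 0 < l := div_pos (hk0 s₀ hs₀) (by have := hF1 s₀ hs₀; positivity)
  refine ⟨l, hlpos, 1 / deriv F s₀ ^ 2 - l ^ 2 * F s₀ ^ 2, fun s hs => ⟨hF1 s hs, hkl s hs, ?_⟩⟩
  rw [eq_zero_deriv_const hI hIc hC hs₀ hs]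
  have h2 := hF1 s hs
  field_simp
  ring

section Charts

variable {M : Type*} [TopologicalSpace M] [ChartedSpace Plane M] [IsManifold 𝓘(ℝ, Plane) ∞ M]

open IsManifold LorentzianMetric

/-- Reparametrization of the coordinates of a warped product. -/
theorem LorentzianMetric.exists_reparametrized_chart (g : LorentzianMetric M)
    {φ : OpenPartialHomeomorph M Plane}
    (hφ : φ ∈ maximalAtlas 𝓘(ℝ, Plane) ∞ M) {p : M} (hp : p ∈ φ.source) {I : Set ℝ}
    (hI : IsOpen I) (hφI : ∀ x ∈ φ.target, x 0 ∈ I) {F : ℝ → ℝ}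
    (hG : ∀ x ∈ φ.target, ∀ v w,
      g.inChart φ x v w = F (x 0) ^ 2 * (v 1 * w 1) - v 0 * w 0)
    {U : ℝ → ℝ} (hU : ContDiffOn ℝ ∞ U I) (hU1 : ∀ s ∈ I, deriv U s ≠ 0) {β : ℝ} (hβ : β ≠ 0) :
    ∃ φ' ∈ maximalAtlas 𝓘(ℝ, Plane) ∞ M, p ∈ φ'.source ∧
      ∀ y ∈ φ'.target, ∃ x ∈ φ.target, y 0 = U (x 0) ∧ φ'.symm y = φ.symm x ∧
        ∀ v w, g.inChart φ' y v w =
          F (x 0) ^ 2 * (v 1 * w 1) / β ^ 2 - v 0 * w 0 / deriv U (x 0) ^ 2 := by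
  set Ψ : Plane → Plane := fun x => U (x 0) • dirS + (β * x 1) • dirV with hΨ
  have hΨsm : ContDiffOn ℝ ∞ Ψ φ.target := by
    have h0 : ContDiff ℝ ∞ (fun x : Plane => x 0) := by fun_prop
    have h1 : ContDiff ℝ ∞ (fun x : Plane => (β * x 1) • dirV) := by fun_prop
    exact ((hU.comp h0.contDiffOn hφI).smul contDiffOn_const).add h1.contDiffOn
  have hder : ∀ x ∈ φ.target, HasFDerivAt Ψ
      ((deriv U (x 0) • EuclideanSpace.proj (0 : Fin 2) : Plane →L[ℝ] ℝ).smulRight dirS +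
        (β • EuclideanSpace.proj (1 : Fin 2) : Plane →L[ℝ] ℝ).smulRight dirV) x := by
    intro x hx
    have h0 : HasFDerivAt (fun y : Plane => y 0) (EuclideanSpace.proj (0 : Fin 2) : Plane →L[ℝ] ℝ) x :=
      (EuclideanSpace.proj (0 : Fin 2) : Plane →L[ℝ] ℝ).hasFDerivAt
    have h1 : HasFDerivAt (fun y : Plane => y 1) (EuclideanSpace.proj (1 : Fin 2) : Plane →L[ℝ] ℝ) x :=
      (EuclideanSpace.proj (1 : Fin 2) : Plane →L[ℝ] ℝ).hasFDerivAt
    have hUd := ((hU.contDiffAt (hI.mem_nhds (hφI x hx))).differentiableAt (by simp)).hasDerivAt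
    exact ((hUd.comp_hasFDerivAt x h0).smul_const dirS).add
      ((h1.const_mul β).smul_const dirV)
  have hpt := φ.map_source hp
  set A : Plane →L[ℝ] Plane :=
    (deriv U (φ p 0) • EuclideanSpace.proj (0 : Fin 2) : Plane →L[ℝ] ℝ).smulRight dirS +
      (β • EuclideanSpace.proj (1 : Fin 2) : Plane →L[ℝ] ℝ).smulRight dirV with hA
  have hinj : Function.Injective (A : Plane →ₗ[ℝ] Plane) := by
    rw [injective_iff_map_eq_zero]
    intro v hv
    have h0 : A v 0 = 0 := by simpa using congrArg (fun u : Plane => u 0) hv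
    have h1 : A v 1 = 0 := by simpa using congrArg (fun u : Plane => u 1) hv
    ext i
    fin_cases i
    · simpa [hA, dirS, dirV, hU1 _ (hφI _ hpt)] using h0
    · simpa [hA, dirS, dirV, hβ] using h1
  have hL : HasFDerivAt Ψ ((LinearEquiv.ofInjectiveEndo (A : Plane →ₗ[ℝ] Plane)
      hinj).toContinuousLinearEquiv : Plane →L[ℝ] Plane) (φ p) := by
    refine (hder _ hpt).congr_fderiv ?_
    ext v : 1
    rfl
  obtain ⟨r, hr, φ', hφ', hp', -, -, -, hch⟩ :=
    exists_chart_of_localDiffeo g hφ hp φ.open_target hΨsm hpt hL Filter.univ_mem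
  refine ⟨φ', hφ', hp', fun y hy => ?_⟩
  obtain ⟨x, hx, hΨx, hsymm, L', hL', -, hg⟩ := hch y hy
  refine ⟨x, hx.1, by rw [← hΨx]; simp [hΨ, dirS, dirV], hsymm, fun v w => ?_⟩
  have hu := hL'.unique (hder x hx.1)
  have h0 : ∀ v : Plane, L' v 0 = deriv U (x 0) * v 0 := fun v => by
    have := congrArg (fun B : Plane →L[ℝ] Plane => B v 0) hu
    simpa [dirS, dirV] using this
  have h1 : ∀ v : Plane, L' v 1 = β * v 1 := fun v => by
    have := congrArg (fun B : Plane →L[ℝ] Plane => B v 1) hu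
    simpa [dirS, dirV] using this
  have h2 := hg (L'.symm v) (L'.symm w)
  rw [hG x hx.1, L'.apply_symm_apply, L'.apply_symm_apply] at h2
  have hv0 := h0 (L'.symm v)
  have hw0 := h0 (L'.symm w)
  have hv1 := h1 (L'.symm v)
  have hw1 := h1 (L'.symm w)
  rw [L'.apply_symm_apply] at hv0 hw0 hv1 hw1
  have hU1' := hU1 _ (hφI x hx.1)
  rw [h2, hv0, hw0, hv1, hw1]
  field_simp

/-- A Darboux integrable metric of negative curvature with a timelike Killing field is, near every
point, `F(s)² dv² - ds²` with an explicit first integral for `F`. -/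
theorem LorentzianMetric.exists_integrated_chart (g : LorentzianMetric M)
    {K : M → ℝ} (hK : g.IsGaussCurvature K) (hyperbolic : ∀ p, K p < 0)
    (darboux : g.IsDarbouxIntegrable) {V : ∀ p : M, TangentSpace 𝓘(ℝ, Plane) p}
    (killing : g.IsKilling V) (timelike : ∀ p, 0 < g.inner p (V p) (V p)) (p : M) :
    ∃ φ ∈ maximalAtlas 𝓘(ℝ, Plane) ∞ M, p ∈ φ.source ∧ ∃ I : Set ℝ, IsOpen I ∧
      (∀ x ∈ φ.target, x 0 ∈ I) ∧ ∃ F : ℝ → ℝ, ContDiffOn ℝ ∞ F I ∧ (∀ s ∈ I, 0 < F s) ∧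
      (∀ x ∈ φ.target, ∀ v w, g.inChart φ x v w = F (x 0) ^ 2 * (v 1 * w 1) - v 0 * w 0) ∧
      ∃ l > 0, ∃ C, (∀ s ∈ I, deriv F s ≠ 0 ∧ deriv F s ^ 2 * (l ^ 2 * F s ^ 2 + C) = 1) ∧
        ∀ x ∈ φ.target, K (φ.symm x) = -(l ^ 2 * deriv F (x 0) ^ 4) := by
  obtain ⟨φ, hφ, hp, r, hr, ht, F, hF, hF0, hG⟩ := g.exists_warped_chart killing timelike p
  set I := Metric.ball (φ p 0) r with hIdef
  have hI : IsOpen I := Metric.isOpen_ball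
  have hφI : ∀ x ∈ φ.target, x 0 ∈ I := fun x hx => by
    rw [ht] at hx
    exact (abs_sub_le_dist x _).trans_lt hx
  have hcI : ∀ s ∈ I, s • dirS + φ p 1 • dirV ∈ φ.target := fun s hs => by
    rw [ht, Metric.mem_ball, dist_smul_dirS_add]
    exact hs
  have hcof := isOrthonormalCoframing_warped φ.open_target hI hF hφI hG
  have hFsm1 : ContDiffOn ℝ ∞ (deriv F) I := hF.deriv_of_isOpen hI (by simp)
  have hFsm2 : ContDiffOn ℝ ∞ (deriv (deriv F)) I := hFsm1.deriv_of_isOpen hI (by simp)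
  -- Comparison of dη¹₂ = F'' ds ∧ dv with -K η¹ ∧ η² = K F ds ∧ dv.
  have hcurv : ∀ x ∈ φ.target, deriv (deriv F) (x 0) = K (φ.symm x) * F (x 0) := by
    intro x hx
    have h := hK φ hφ φ.target subset_rfl _ _ _ hcof x hx dirS dirV
    rw [extD_etaV ((hFsm1.contDiffAt (hI.mem_nhds (hφI x hx))).differentiableAt (by simp))] at h
    simpa [wedge, etaV, etaS, dirS, dirV] using h
  have hq : ∀ s ∈ I, 0 < -deriv (deriv F) s / F s := by
    intro s hs
    have h := hcurv _ (hcI s hs)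
    simp only [dirS, dirV] at h
    simp at h
    rw [h]
    have := hyperbolic (φ.symm (s • dirS + φ p 1 • dirV))
    refine div_pos ?_ (hF0 s hs)
    have h2 := mul_neg_of_neg_of_pos this (hF0 s hs)
    simp only [dirS, dirV] at h2
    linarith
  set k : ℝ → ℝ := fun s => Real.sqrt (-deriv (deriv F) s / F s) with hkdef
  have hk : ContDiffOn ℝ ∞ k I :=
    (hFsm2.neg.div hF fun s hs => (hF0 s hs).ne').sqrt fun s hs => (hq s hs).ne'
  have hk0 : ∀ s ∈ I, 0 < k s := fun s hs => Real.sqrt_pos.2 (hq s hs)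
  have hF2 : ∀ s ∈ I, deriv (deriv F) s = -(k s ^ 2 * F s) := fun s hs => by
    rw [hkdef, Real.sq_sqrt (hq s hs).le]
    field_simp [(hF0 s hs).ne']
  clear_value k
  have hk1 : ∀ s ∈ I, deriv k s * deriv F s = -2 * k s ^ 3 * F s := by
    intro s hs
    have h := curvature_equation_of_darboux hI hφI hF hk (fun s hs => (hF0 s hs).ne')
      (fun s hs => (hk0 s hs).ne') hF2
      (darboux φ hφ φ.target subset_rfl _ _ _ hcof _ _ _ isFrameParametrization) (hcI s hs)
    simpa [dirS, dirV] using h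
  obtain ⟨l, hl, C, hlC⟩ := exists_first_integrals hI
    (convex_ball (φ p 0) r).isPreconnected (Metric.mem_ball_self hr) hF hk hF0 hk0 hF2 hk1
  refine ⟨φ, hφ, hp, I, hI, hφI, F, hF, hF0, hG, l, hl, C,
    fun s hs => ⟨(hlC s hs).1, (hlC s hs).2.2⟩, fun x hx => ?_⟩
  have h1 := hcurv x hx
  have h2 := (hF0 _ (hφI x hx)).ne'
  rw [hF2 _ (hφI x hx), (hlC _ (hφI x hx)).2.1] at h1
  apply mul_right_cancel₀ h2
  rw [← h1]
  ring

end Charts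

/-! ### The three normal forms -/

theorem deriv_of_sinh_comp_eq {I : Set ℝ} (hI : IsOpen I) {F U : ℝ → ℝ} {m : ℝ}
    (hF : ContDiffOn ℝ ∞ F I) (hU : ContDiffOn ℝ ∞ U I)
    (h : ∀ s ∈ I, Real.sinh (U s) = m * F s) {s : ℝ} (hs : s ∈ I) :
    Real.cosh (U s) * deriv U s = m * deriv F s := by
  have hFd := ((hF.contDiffAt (hI.mem_nhds hs)).differentiableAt (by simp)).hasDerivAt
  have hUd := ((hU.contDiffAt (hI.mem_nhds hs)).differentiableAt (by simp)).hasDerivAt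
  exact (hUd.sinh.congr_of_eventuallyEq
    (Filter.eventually_of_mem (hI.mem_nhds hs) fun t ht => (h t ht).symm)).unique
      (hFd.const_mul m)

theorem deriv_of_cosh_comp_eq {I : Set ℝ} (hI : IsOpen I) {F U : ℝ → ℝ} {m : ℝ}
    (hF : ContDiffOn ℝ ∞ F I) (hU : ContDiffOn ℝ ∞ U I)
    (h : ∀ s ∈ I, Real.cosh (U s) = m * F s) {s : ℝ} (hs : s ∈ I) :
    Real.sinh (U s) * deriv U s = m * deriv F s := by
  have hFd := ((hF.contDiffAt (hI.mem_nhds hs)).differentiableAt (by simp)).hasDerivAt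
  have hUd := ((hU.contDiffAt (hI.mem_nhds hs)).differentiableAt (by simp)).hasDerivAt
  exact (hUd.cosh.congr_of_eventuallyEq
    (Filter.eventually_of_mem (hI.mem_nhds hs) fun t ht => (h t ht).symm)).unique
      (hFd.const_mul m)

/-- Common to C = D² with (z, w) = (sinh u, cosh u) and C = -D² with (z, w) = (cosh u, sinh u): in
both cases l²F² + C = D²w², so `hf` is the first integral. It gives u'² = l²/(D⁴w⁴), whence the
constant c = D⁴/l²; the factor D⁻¹ for v makes the other coefficient carry the same constant. -/
theorem normal_form_identities {D l z w u' f' f : ℝ} (hD : 0 < D) (hl : 0 < l)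
    (hz : z = l / D * f) (hw : w * u' = l / D * f') (hf : f' ^ 2 * (D ^ 2 * w ^ 2) = 1) :
    (∀ X Y : ℝ, f ^ 2 * X / D⁻¹ ^ 2 - Y / u' ^ 2 = D ^ 4 / l ^ 2 * (z ^ 2 * X - w ^ 4 * Y)) ∧
      -(l ^ 2 * f' ^ 4) = -(D ^ 4 / l ^ 2 * w ^ 4)⁻¹ := by
  have hf0 : f' ≠ 0 := by rintro rfl; simp at hf
  have hw0 : w ≠ 0 := by rintro rfl; simp at hf
  have hu0 : u' ≠ 0 := by
    rintro rfl
    rw [mul_zero] at hw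
    exact mul_ne_zero (div_pos hl hD).ne' hf0 hw.symm
  have hu : u' ^ 2 * (D ^ 4 * w ^ 4) = l ^ 2 := by
    have h1 : (w * u') ^ 2 = (l / D * f') ^ 2 := by rw [hw]
    field_simp at h1
    linear_combination D ^ 2 * w ^ 2 * h1 + l ^ 2 * hf
  constructor
  · intro X Y
    have h1 : Y / u' ^ 2 = D ^ 4 / l ^ 2 * w ^ 4 * Y := by
      field_simp
      linear_combination -Y * hu
    rw [h1, hz]
    field_simp
  · congr 1
    field_simp
    linear_combination (f' ^ 2 * (D ^ 2 * w ^ 2) + 1) * hf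

end DarbouxEmbedding

end

theorem mainTheorem10 {M : Type*} [TopologicalSpace M]
    [ChartedSpace DarbouxEmbedding.Plane M] [IsManifold 𝓘(ℝ, DarbouxEmbedding.Plane) ∞ M]
    (g : DarbouxEmbedding.LorentzianMetric M)
    (K : M → ℝ) (hK : g.IsGaussCurvature K)
    (hyperbolic : ∀ p, K p < 0)
    (darboux : g.IsDarbouxIntegrable)
    (V : ∀ p : M, TangentSpace 𝓘(ℝ, DarbouxEmbedding.Plane) p)
    (killing : g.IsKilling V)
    (timelike : ∀ p, 0 < g.inner p (V p) (V p)) (p : M) :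
    ∃ φ ∈ IsManifold.maximalAtlas 𝓘(ℝ, DarbouxEmbedding.Plane) ∞ M,
      p ∈ φ.source ∧ (∀ x ∈ φ.target, 0 < x 0) ∧
      ((∃ c : ℝ, 0 < c ∧ ∀ x ∈ φ.target,
          (∀ v w, g.inChart φ x v w =
            c * (Real.sinh (x 0) ^ 2 * (v 1 * w 1) - Real.cosh (x 0) ^ 4 * (v 0 * w 0))) ∧
          K (φ.symm x) = - (c * Real.cosh (x 0) ^ 4)⁻¹) ∨
        (∃ c : ℝ, 0 < c ∧ ∀ x ∈ φ.target,
          (∀ v w, g.inChart φ x v w =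
            c * (Real.cosh (x 0) ^ 2 * (v 1 * w 1) - Real.sinh (x 0) ^ 4 * (v 0 * w 0))) ∧
          K (φ.symm x) = - (c * Real.sinh (x 0) ^ 4)⁻¹) ∨
        (∀ x ∈ φ.target,
          (∀ v w, g.inChart φ x v w = x 0 ^ 2 * (v 1 * w 1 - v 0 * w 0)) ∧
          K (φ.symm x) = - (x 0 ^ 4)⁻¹)) := by
  obtain ⟨φ, hφ, hp, I, hI, hφI, F, hF, hF0, hG, l, hl, C, hFC, hKF⟩ :=
    g.exists_integrated_chart hK hyperbolic darboux killing timelike p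
  rcases lt_trichotomy C 0 with hC | hC | hC
  · obtain ⟨D, hD, rfl⟩ : ∃ D > 0, C = -D ^ 2 :=
      ⟨√(-C), Real.sqrt_pos.2 (by linarith), by rw [Real.sq_sqrt (by linarith)]; ring⟩
    set U : ℝ → ℝ := fun s => Real.arcosh (l / D * F s) with hU
    -- The first integral forces l²F² > D², so the hyperbolic cosine of a positive u can be equal to
    -- lF/D.
    have h1 : ∀ s ∈ I, 1 < l / D * F s := by
      intro s hs
      have hpos : 0 < l * F s := mul_pos hl (hF0 s hs)
      have h2 : D < l * F s := by
        by_contra! hle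
        have h3 := (hFC s hs).2
        have h4 : l ^ 2 * F s ^ 2 + -D ^ 2 ≤ 0 := by nlinarith
        nlinarith [mul_nonneg (sq_nonneg (deriv F s)) (neg_nonneg.2 h4)]
      rw [div_mul_eq_mul_div, one_lt_div hD]
      exact h2
    have hUsm : ContDiffOn ℝ ∞ U I :=
      Real.contDiffOn_arcosh.comp (contDiffOn_const.mul hF) h1
    have hcosh : ∀ s ∈ I, Real.cosh (U s) = l / D * F s := fun s hs =>
      Real.cosh_arcosh (h1 s hs).le
    have hUpos : ∀ s ∈ I, 0 < U s := fun s hs => Real.arcosh_pos (h1 s hs)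
    have hUd : ∀ s ∈ I, Real.sinh (U s) * deriv U s = l / D * deriv F s := fun s hs =>
      DarbouxEmbedding.deriv_of_cosh_comp_eq hI hF hUsm hcosh hs
    have hU0 : ∀ s ∈ I, deriv U s ≠ 0 := fun s hs h => by
      have h2 := hUd s hs
      rw [h, mul_zero] at h2
      exact mul_ne_zero (div_pos hl hD).ne' (hFC s hs).1 h2.symm
    clear_value U
    obtain ⟨φ', hφ', hp', hch⟩ := g.exists_reparametrized_chart hφ hp hI hφI hG hUsm hU0
      (β := D⁻¹) (by positivity)
    refine ⟨φ', hφ', hp', fun y hy => ?_, Or.inr (Or.inl ⟨D ^ 4 / l ^ 2, by positivity,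
      fun y hy => ?_⟩)⟩
    · obtain ⟨x, hx, hyx, -⟩ := hch y hy
      rw [hyx]
      exact hUpos _ (hφI x hx)
    · obtain ⟨x, hx, hyx, hsymm, hg⟩ := hch y hy
      have hs := hφI x hx
      have e1 := hcosh _ hs
      have e3 := (hFC _ hs).2
      have e4 := Real.cosh_sq (U (x 0))
      obtain ⟨h2, h3⟩ := DarbouxEmbedding.normal_form_identities hD hl e1 (hUd _ hs) (by
        rw [e1] at e4
        field_simp at e4
        linear_combination e3 - deriv F (x 0) ^ 2 * e4)
      rw [hsymm, hKF x hx, hyx]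
      exact ⟨fun v w => (hg v w).trans (h2 _ _), h3⟩
  -- For C = 0 the first integral is lFF' = ±1, so u = √l F satisfies u'² = lF'² = 1/u². The
  -- rescaling of v by 1/√l makes both coefficients equal to u².
  · subst hC
    have hsl : 0 < √l := Real.sqrt_pos.2 hl
    have hsl2 : √l ^ 2 = l := Real.sq_sqrt hl.le
    have hFd : ∀ s ∈ I, deriv (fun s => √l * F s) s = √l * deriv F s := fun s hs =>
      deriv_const_mul _ ((hF.contDiffAt (hI.mem_nhds hs)).differentiableAt (by simp))
    obtain ⟨φ', hφ', hp', hch⟩ := g.exists_reparametrized_chart hφ hp hI hφI hG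
      (U := fun s => √l * F s) (contDiffOn_const.mul hF)
      (fun s hs => by rw [hFd s hs]; exact mul_ne_zero hsl.ne' (hFC s hs).1)
      (β := (√l)⁻¹) (by positivity)
    refine ⟨φ', hφ', hp', fun y hy => ?_, Or.inr (Or.inr fun y hy => ?_)⟩
    · obtain ⟨x, hx, hyx, -⟩ := hch y hy
      rw [hyx]
      exact mul_pos hsl (hF0 _ (hφI x hx))
    · obtain ⟨x, hx, hyx, hsymm, hg⟩ := hch y hy
      have hs := hφI x hx
      obtain ⟨e1, e2⟩ := hFC _ hs
      have e3 := (hF0 _ hs).ne'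
      rw [hsymm, hKF x hx, hyx]
      simp only [hg, hFd _ hs]
      rw [add_zero] at e2
      generalize √l = r at *
      subst hsl2
      generalize deriv F (x 0) = f' at *
      generalize F (x 0) = f at *
      have hr := hsl.ne'
      constructor
      · intro v w
        have h1 : v 0 * w 0 / (r * f') ^ 2 = (r * f) ^ 2 * (v 0 * w 0) := by
          field_simp
          linear_combination -(v 0 * w 0) * e2
        rw [h1]
        field_simp
      · congr 1
        field_simp
        linear_combination (f' ^ 2 * r ^ 4 * f ^ 2 + 1) * e2
  · obtain ⟨D, hD, rfl⟩ : ∃ D > 0, C = D ^ 2 :=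
      ⟨√C, Real.sqrt_pos.2 hC, by rw [Real.sq_sqrt hC.le]⟩
    -- Chosen so that l²F² + D² = D² cosh² u.
    set U : ℝ → ℝ := fun s => Real.arsinh (l / D * F s) with hU
    have hUsm : ContDiffOn ℝ ∞ U I := (contDiffOn_const.mul hF).arsinh
    have hsinh : ∀ s ∈ I, Real.sinh (U s) = l / D * F s := fun s hs => Real.sinh_arsinh _
    have hUpos : ∀ s ∈ I, 0 < U s := fun s hs =>
      Real.arsinh_pos_iff.2 (mul_pos (div_pos hl hD) (hF0 s hs))
    have hUd : ∀ s ∈ I, Real.cosh (U s) * deriv U s = l / D * deriv F s := fun s hs =>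
      DarbouxEmbedding.deriv_of_sinh_comp_eq hI hF hUsm hsinh hs
    have hU0 : ∀ s ∈ I, deriv U s ≠ 0 := fun s hs h => by
      have h2 := hUd s hs
      rw [h, mul_zero] at h2
      exact mul_ne_zero (div_pos hl hD).ne' (hFC s hs).1 h2.symm
    clear_value U
    obtain ⟨φ', hφ', hp', hch⟩ := g.exists_reparametrized_chart hφ hp hI hφI hG hUsm hU0
      (β := D⁻¹) (by positivity)
    refine ⟨φ', hφ', hp', fun y hy => ?_, Or.inl ⟨D ^ 4 / l ^ 2, by positivity,
      fun y hy => ?_⟩⟩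
    · obtain ⟨x, hx, hyx, -⟩ := hch y hy
      rw [hyx]
      exact hUpos _ (hφI x hx)
    · obtain ⟨x, hx, hyx, hsymm, hg⟩ := hch y hy
      have hs := hφI x hx
      have e1 := hsinh _ hs
      have e3 := (hFC _ hs).2
      have e4 := Real.cosh_sq (U (x 0))
      obtain ⟨h2, h3⟩ := DarbouxEmbedding.normal_form_identities hD hl e1 (hUd _ hs) (by
        rw [e1] at e4
        field_simp at e4
        linear_combination e3 + deriv F (x 0) ^ 2 * e4)
      rw [hsymm, hKF x hx, hyx]
      exact ⟨fun v w => (hg v w).trans (h2 _ _), h3⟩
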